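/- **Setting.** Fix integers $N,K\ge 0$, a real constant $\gamma\neq 0$ and a sign $\pm$. All series are formal in $\lambda$; a dot denotes $\dot A=\lambda\,\partial A/\partial\lambda$, $X_{\le -1}$ and $X_{\ge 1}$ are the parts of negative and of positive $\lambda$-degree, and $X^{*}$ denotes the formal conjugate transpose ($\lambda\mapsto\lambda^{-1}$, coefficients replaced by independent conjugate variables). *Functions.* The variables are $t_m,\bar t_m$ ($0\le m\le N$); the coefficients of $$Y=\begin{pmatrix}-\mathrm i\mathbf a&2\mathbf c\\2\mathbf b&\mathrm i\mathbf a\end{pmatrix},\quad \mathbf a=\sum_{n\ge1}\lambda^{2n}a^{2n+1},\ \mathbf b=\sum_{n\ge0}\lambda^{2n+1}b^{2n+2},\ \mathbf c=\sum_{n\ge0}\lambda^{2n+1}c^{2n+2};$$ the coefficients of a matrix series $\check S$ of the same shape; the conjugates of all these coefficients; and the coefficients $u_j$ ($j\ge0$) of $u_\pm=\pm2K\log\lambda+\sum_j u_j\lambda^{\pm2j}$. Put $S=\tfrac{\mathrm i}{2}\sum_{m=0}^N(2m+1)t_m\lambda^{-(2m+2)}\,Y+\check S$ (the normalized spectral Killing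 field). Let $\mathcal A$ be the polynomial $\mathbb C$-algebra in these variables modulo the relations $\det Y=-4\gamma\lambda^2$, $[S,\lambda^{-1}Y]+(\lambda^{-1}Y)^{\cdot}=0$, and their conjugates. *Forms.* The coframe consists of $\rho$, $dt_m$, $d\bar t_m$ ($0\le m\le N$) and one-forms $\sigma_k$ ($k\ge K$), written $\bar\sigma_k$ for the sign $+$; infinite sums of the $\sigma_k$ are allowed. A *formal exterior derivative* $d$ on forms over $\mathcal A$ is a $\mathbb C$-linear antiderivation of degree one, given by its (locally finite) values on functions and on the coframe; $d^2=0$ is not assumed. *Lie algebra and Maurer–Cartan form.* On pairs (derivation part $f\,\lambda\partial_\lambda$, loop part $A$) let $[(f,A),(g,B)]=(f\dot g-g\dot f,\ [A,B]+f\dot B-g\dot A)$. The truncated Virasoro algebra $\mathrm{Vir}^\pm_{K}$ is spanned by $\mp\lambda^{\pm2j}\lambda\partial_\lambda$, $j\ge K$, and $\mathfrak g$ is the twisted $\mathfrak{sl}(2,\mathbb C)$ loop algebra (even diagonal, odd off-diagonal). Put $U_m=\frac1{2\mathrm i}(\lambda^{-2m-2}Y)_{\le-1}$, $S_k=(\lambda^{-2k}S)_{\le-1}$,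 $$\phi=-\sum_{m=0}^N U_m^{*}\,d\bar t_m+\begin{pmatrix}\frac{\mathrm i}{2}\rho&0\\0&-\frac{\mathrm i}{2}\rho\end{pmatrix}+\sum_{m=0}^N U_m\,dt_m ,$$ $$\Phi_+=\Big(-\sum_{k\ge K}\lambda^{2k}\bar\sigma_k,\ \phi-\sum_{k\ge K} S_k^{*}\bar\sigma_k\Big),\qquad \Phi_-=\Big(\sum_{k\ge K}\lambda^{-2k}\sigma_k,\ \phi+\sum_{k\ge K}S_k\sigma_k\Big),$$ which are valued in $\mathrm{Vir}^\pm_K\ltimes\mathfrak g$. Put $\hat Y=(0,\lambda^{-1}Y)$ and $\hat S_\pm=(e^{u_\pm},e^{u_\pm}S)$. The *extended CMC hierarchy* with Virasoro cut-off $K$ is the system for $d$: the differential of the function $t_m$ is $dt_m$, that of $\bar t_m$ is $d\bar t_m$, the one-forms $dt_m,d\bar t_m$ are closed, and $$d\hat Y+[\Phi_\pm,\hat Y]=0,\qquad d\hat S_\pm+[\Phi_\pm,\hat S_\pm]=0,\qquad d\Phi_\pm+\tfrac12[\Phi_\pm,\Phi_\pm]=0,$$ together with the same Killing field equations for $(0,\lambda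 Y^{*})$ and for $(e^{u_\pm},e^{u_\pm}S^{*})$, the conjugates of those for $\hat Y$ and $\hat S_\mp$. The equations containing $e^{u_\pm}$ are understood after multiplication by $e^{-u_\pm}$. **Theorem.** Let $K\ge N+1$ (the $N$-truncated Virasoro algebra is the case $K=N+1$). For either sign the extended CMC hierarchy is compatible: there is exactly one formal exterior derivative $d$ over $\mathcal A$ that satisfies all of its structure equations, and it satisfies $d^2=0$. Moreover, let $\partial_{t_m},\partial_{\bar t_m},\partial_{k},\partial_\rho$ be the derivations of $\mathcal A$ dual to the coframe. Then $[\partial_j,\partial_k]=(2j-2k)\,\partial_{j+k}$ for $j,k\ge K$, and the Virasoro flows commute with the flows of the CMC hierarchy: for the sign $-$ one has $[\partial_{t_m},\partial_k]=0$ and $[\partial_{\bar t_m},\partial_k]\in\mathcal A\,\partial_\rho$, and for the sign $+$ one has $[\partial_{\bar t_m},\partial_k]=0$ and $[\partial_{t_m},\partial_k]\in\mathcal A\,\partial_\rho$ (that is, the mixed flows commute up to the infinitesimal rotation $\partial_\rho$ dual to the connection form). The truncation is needed: if $K\le N$, then no formal exterior derivative over $\mathcal A$ satisfies the structure equations. 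-/

import Mathlib

/-!
The extended CMC hierarchy as a formal exterior differential system.

All series in the spectral parameter `lam` are bilateral coefficient families indexed by `ℤ`.  All
the products that occur below have, for every index, only finitely many nonzero terms, so the finite
sum operator `∑ᶠ` computes them.
-/

set_option linter.unusedSectionVars false

noncomputable section

namespace CMCHierarchy

section Series

variable {R : Type*} [CommRing R]

/-- Formal scalar series `∑ f n * lam ^ n`. -/
abbrev Ser (R : Type*) := ℤ → R

/-- Formal series with values in the two by two matrices. -/
abbrev Loop (R : Type*) := ℤ → Matrix (Fin 2) (Fin 2) R

/-- Product of two scalar series. -/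
def serMul (f g : Ser R) : Ser R := fun n => ∑ᶠ m : ℤ, f m * g (n - m)

/-- Product of a scalar series and a matrix valued series. -/
def serSmul (f : Ser R) (X : Loop R) : Loop R := fun n => ∑ᶠ m : ℤ, f m • X (n - m)

/-- Pointwise commutator `[X, Y] = X Y - Y X`. -/
def loopBracket (X Y : Loop R) : Loop R :=
  fun n => ∑ᶠ m : ℤ, (X m * Y (n - m) - Y (n - m) * X m)

/-- Determinant of a matrix valued series. -/
def loopDet (X : Loop R) : Ser R :=
  fun n => ∑ᶠ m : ℤ, (X m 0 0 * X (n - m) 1 1 - X m 0 1 * X (n - m) 1 0)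

/-- The Euler operator `lam * d / d lam` (the upper dot). -/
def euler {M : Type*} [AddCommGroup M] (X : ℤ → M) : ℤ → M := fun n => n • X n

/-- Multiplication by `lam ^ p`. -/
def shift {M : Type*} (p : ℤ) (X : ℤ → M) : ℤ → M := fun n => X (n - p)

/-- The part of degree at most `-1`. -/
def negPart {M : Type*} [Zero M] (X : ℤ → M) : ℤ → M := fun n => if n ≤ -1 then X n else 0

/-- The part of degree at least `1`. -/
def posPart {M : Type*} [Zero M] (X : ℤ → M) : ℤ → M := fun n => if 1 ≤ n then X n else 0

/-- The monomial `lam ^ p`. -/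
def lamPow (R : Type*) [CommRing R] (p : ℤ) : Ser R := Pi.single p 1

/-- A formal element `f(lam) * (lam d/d lam) + X(lam)`: derivation part and loop part. -/
abbrev Aff (R : Type*) := Ser R × Loop R

/-- The bracket of the semidirect product of derivations and loops,
`[(f, A), (g, B)] = (f g' - g f', [A, B] + f B' - g A')`, the prime being the Euler operator. -/
def affBracket (x y : Aff R) : Aff R :=
  (serMul x.1 (euler y.1) - serMul y.1 (euler x.1),
   loopBracket x.2 y.2 + serSmul x.1 (euler y.2) - serSmul y.1 (euler x.2))

/-- Multiplication of an element by a scalar series. -/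
def affSmul (f : Ser R) (x : Aff R) : Aff R := (serMul f x.1, serSmul f x.2)

end Series

/-- The two types (positive and negative) of truncated Virasoro algebras. -/
inductive Sgn
  | plus
  | minus

/-- The sign `1` or `-1` of a type. -/
def Sgn.val : Sgn → ℤ
  | .plus => 1
  | .minus => -1

section KacMoody

variable {R : Type*} [CommRing R]

/-- Membership in the twisted loop algebra: trace free formal Laurent series whose diagonal is even
and whose off-diagonal entries are odd in `lam`. -/
def IsTwisted (X : Loop R) : Prop :=
  (∃ B : ℤ, ∀ n < B, X n = 0) ∧ (∀ n, (X n).trace = 0) ∧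
    (∀ n, Odd n → X n 0 0 = 0 ∧ X n 1 1 = 0) ∧ (∀ n, Even n → X n 0 1 = 0 ∧ X n 1 0 = 0)

/-- Membership in the truncated Virasoro algebra, spanned by the derivations
`∓ lam ^ (± 2 j) * (lam d/d lam)` with `j ≥ K`. -/
def IsVir (s : Sgn) (K : ℕ) (f : Ser R) : Prop :=
  (Function.support f).Finite ∧ ∀ n, f n ≠ 0 → ∃ j : ℕ, K ≤ j ∧ n = s.val * (2 * j)

/-- The affine Kac-Moody algebra: semidirect product of the truncated Virasoro algebra and the
twisted loop algebra, with the bracket `affBracket`. -/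
def affineKacMoody (R : Type*) [CommRing R] (s : Sgn) (K : ℕ) : Set (Aff R) :=
  {x | IsVir s K x.1 ∧ IsTwisted x.2}

end KacMoody

/-- The dependent variables (functions) of the hierarchy:
the times `t m`, `tb m` for `0 ≤ m ≤ N`;
the coefficients `a ^ (2 n + 3)`, `b ^ (2 n + 2)`, `c ^ (2 n + 2)` of `Y` and (with the suffix `bar`)
their formal complex conjugates;
the coefficients `sa n`, `sb n`, `sc n` of degrees `2 n + 2`, `2 n + 1`, `2 n + 1` of the dressed
spectral Killing field and their conjugates;
the coefficients `u n` of the conformal factor. -/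
inductive Gen (N : ℕ)
  | t (m : Fin (N + 1))
  | tb (m : Fin (N + 1))
  | a (n : ℕ)
  | b (n : ℕ)
  | c (n : ℕ)
  | abar (n : ℕ)
  | bbar (n : ℕ)
  | cbar (n : ℕ)
  | sa (n : ℕ)
  | sb (n : ℕ)
  | sc (n : ℕ)
  | sabar (n : ℕ)
  | sbbar (n : ℕ)
  | scbar (n : ℕ)
  | u (n : ℕ)

/-- The coframe: the connection form `rho`, the forms `dt m` and `dtb m`, and the forms `s k`, which
are dual to the Virasoro generators of index `k ≥ K` (of positive or of negative type). -/
inductive Idx (N K : ℕ)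
  | rho
  | t (m : Fin (N + 1))
  | tb (m : Fin (N + 1))
  | s (k : {k : ℕ // K ≤ k})

section Fields

variable {N : ℕ} {R : Type*} [CommRing R] [Algebra ℂ R] (v : Gen N → R)

/-- The series `∑ f n * lam ^ (2 n + 2)`. -/
def evenSer (f : ℕ → R) : Ser R := fun n => if 2 ≤ n ∧ Even n then f ((n - 2) / 2).toNat else 0

/-- The series `∑ f n * lam ^ (2 n + 1)`. -/
def oddSer (f : ℕ → R) : Ser R := fun n => if 1 ≤ n ∧ Odd n then f ((n - 1) / 2).toNat else 0

/-- The trace free matrix series with rows `(-i a, 2 c)` and `(2 b, i a)`. -/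
def mkLoop (a b c : ℕ → R) : Loop R := fun n =>
  !![-(Complex.I • evenSer a n), 2 * oddSer c n; 2 * oddSer b n, Complex.I • evenSer a n]

/-- Formal conjugate transpose of `mkLoop`: `lam` becomes `lam⁻¹` and the coefficients are replaced
by their conjugates. -/
def mkLoopBar (a b c : ℕ → R) : Loop R := fun n =>
  !![Complex.I • evenSer a (-n), 2 * oddSer b (-n); 2 * oddSer c (-n), -(Complex.I • evenSer a (-n))]

/-- The formal Killing field `Y`. -/
def fieldY : Loop R := mkLoop (fun n => v (.a n)) (fun n => v (.b n)) (fun n => v (.c n))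

/-- The conjugate transpose of `Y`. -/
def fieldYbar : Loop R :=
  mkLoopBar (fun n => v (.abar n)) (fun n => v (.bbar n)) (fun n => v (.cbar n))

/-- The dressed spectral Killing field, which has only terms of positive degree. -/
def dressedS : Loop R := mkLoop (fun n => v (.sa n)) (fun n => v (.sb n)) (fun n => v (.sc n))

/-- The conjugate transpose of the dressed spectral Killing field. -/
def dressedSbar : Loop R :=
  mkLoopBar (fun n => v (.sabar n)) (fun n => v (.sbbar n)) (fun n => v (.scbar n))

/-- The series `(i / 2) ∑ (2 m + 1) t m * lam ^ (-(2 m + 2))`. -/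
def timeSer : Ser R := fun n => ∑ m : Fin (N + 1),
  if n = -(2 * (m : ℤ) + 2) then (Complex.I / 2 * (2 * (m : ℂ) + 1)) • v (.t m) else 0

/-- The conjugate of `timeSer`. -/
def timeSerBar : Ser R := fun n => ∑ m : Fin (N + 1),
  if n = 2 * (m : ℤ) + 2 then (-Complex.I / 2 * (2 * (m : ℂ) + 1)) • v (.tb m) else 0

/-- The normalized spectral Killing field `S`. -/
def fieldS : Loop R := serSmul (timeSer v) (fieldY v) + dressedS v

/-- The conjugate transpose of `S`. -/
def fieldSbar : Loop R := serSmul (timeSerBar v) (fieldYbar v) + dressedSbar v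

/-- `U m`, the part of negative degree of `(2 i)⁻¹ * lam ^ (-(2 m + 2)) * Y`. -/
def fieldU (m : ℕ) : Loop R :=
  fun n => (1 / (2 * Complex.I)) • negPart (shift (-(2 * (m : ℤ) + 2)) (fieldY v)) n

/-- The conjugate transpose of `U m`. -/
def fieldUbar (m : ℕ) : Loop R :=
  fun n => (-1 / (2 * Complex.I)) • posPart (shift (2 * (m : ℤ) + 2) (fieldYbar v)) n

/-- `S k`, the part of negative degree of `lam ^ (-2 k) * S`. -/
def partS (k : ℕ) : Loop R := negPart (shift (-(2 * (k : ℤ))) (fieldS v))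

/-- The conjugate transpose of `S k`. -/
def partSbar (k : ℕ) : Loop R := posPart (shift (2 * (k : ℤ)) (fieldSbar v))

/-- The diagonal matrix `diag (i / 2, - i / 2)`, of degree zero. -/
def rotLoop (R : Type*) [CommRing R] [Algebra ℂ R] : Loop R :=
  Pi.single 0 !![algebraMap ℂ R (Complex.I / 2), 0; 0, -algebraMap ℂ R (Complex.I / 2)]

/-- The extended Maurer-Cartan form, given by its components in the coframe.  For the positive type
it is the pair of `∑ -lam ^ (2 l) s l` and `phi - ∑ (Sbar l) s l`, for the negative type the pair of
`∑ lam ^ (-2 k) s k` and `phi + ∑ (S k) s k`, where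
`phi = -∑ (Ubar m) dtb m + diag (i / 2, -i / 2) rho + ∑ (U m) dt m`. -/
def extPhi (s : Sgn) (K : ℕ) : Idx N K → Aff R
  | .rho => (0, rotLoop R)
  | .t m => (0, fieldU v m)
  | .tb m => (0, -fieldUbar v m)
  | .s k => match s with
    | .plus => (-lamPow R (2 * (k : ℤ)), -partSbar v k)
    | .minus => (lamPow R (-(2 * (k : ℤ))), partS v k)

/-- The affine lift `(0, lam⁻¹ Y)`. -/
def hatY : Aff R := (0, shift (-1) (fieldY v))

/-- The lift `(0, lam Ybar)` of the conjugate transpose of `Y`. -/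
def hatYbar : Aff R := (0, shift 1 (fieldYbar v))

/-- The lift `(1, S)`, which is the lift `(exp u, exp u * S)` divided by its conformal factor. -/
def hatS : Aff R := (lamPow R 0, fieldS v)

/-- The lift `(1, Sbar)`. -/
def hatSbar : Aff R := (lamPow R 0, fieldSbar v)

/-- The exponent of the conformal factor `exp u`, without the logarithmic term:
`u = ± 2 K log lam + ∑ (u j) lam ^ (± 2 j)`, so that `exp u` is `lam ^ (± 2 K)` times an invertible
power series in `lam ^ (± 2)`. -/
def confSer (s : Sgn) : Ser R :=
  fun n => if 0 ≤ s.val * n ∧ Even n then v (.u (s.val * n / 2).toNat) else 0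

/-- The Euler operator applied to `u`. -/
def confDot (s : Sgn) (K : ℕ) : Ser R :=
  (2 * s.val * (K : ℤ)) • lamPow R 0 + euler (confSer v s)

end Fields

section Membership

variable {N : ℕ} {R : Type*} [CommRing R] [Algebra ℂ R] (v : Gen N → R)

/-- Trace free, with even diagonal and odd off-diagonal entries. -/
def IsParity (X : Loop R) : Prop :=
  (∀ n, (X n).trace = 0) ∧
    (∀ n, Odd n → X n 0 0 = 0 ∧ X n 1 1 = 0) ∧ (∀ n, Even n → X n 0 1 = 0 ∧ X n 1 0 = 0)

theorem isParity_mkLoop (a b c : ℕ → R) : IsParity (mkLoop a b c) := by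
  refine ⟨fun n => by simp [mkLoop, Matrix.trace_fin_two], fun n hn => ?_, fun n hn => ?_⟩
  · have h : ¬ Even n := Int.not_even_iff_odd.2 hn
    simp [mkLoop, evenSer, h]
  · have h : ¬ Odd n := Int.not_odd_iff_even.2 hn
    simp [mkLoop, oddSer, h]

theorem isParity_mkLoopBar (a b c : ℕ → R) : IsParity (mkLoopBar a b c) := by
  refine ⟨fun n => by simp [mkLoopBar, Matrix.trace_fin_two], fun n hn => ?_, fun n hn => ?_⟩
  · have h : ¬ Even n := Int.not_even_iff_odd.2 hn
    simp [mkLoopBar, evenSer, h]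
  · have h : ¬ Odd n := Int.not_odd_iff_even.2 hn
    simp [mkLoopBar, oddSer, h]

theorem IsParity.add {X Y : Loop R} (hX : IsParity X) (hY : IsParity Y) : IsParity (X + Y) := by
  refine ⟨fun n => by simp [hX.1 n, hY.1 n], fun n hn => ?_, fun n hn => ?_⟩
  · simp [hX.2.1 n hn, hY.2.1 n hn]
  · simp [hX.2.2 n hn, hY.2.2 n hn]

theorem IsParity.neg {X : Loop R} (hX : IsParity X) : IsParity (-X) := by
  refine ⟨fun n => by simp [hX.1 n], fun n hn => ?_, fun n hn => ?_⟩
  · simp [hX.2.1 n hn]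
  · simp [hX.2.2 n hn]

theorem IsParity.smul {X : Loop R} (z : ℂ) (hX : IsParity X) : IsParity (fun n => z • X n) := by
  refine ⟨fun n => by simp [hX.1 n], fun n hn => ?_, fun n hn => ?_⟩
  · simp [hX.2.1 n hn]
  · simp [hX.2.2 n hn]

theorem IsParity.negPart {X : Loop R} (hX : IsParity X) : IsParity (negPart X) := by
  refine ⟨fun n => ?_, fun n hn => ?_, fun n hn => ?_⟩ <;> unfold CMCHierarchy.negPart <;> split_ifs
  · exact hX.1 n
  · simp
  · exact hX.2.1 n hn
  · simp
  · exact hX.2.2 n hn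
  · simp

theorem IsParity.posPart {X : Loop R} (hX : IsParity X) : IsParity (posPart X) := by
  refine ⟨fun n => ?_, fun n hn => ?_, fun n hn => ?_⟩ <;> unfold CMCHierarchy.posPart <;> split_ifs
  · exact hX.1 n
  · simp
  · exact hX.2.1 n hn
  · simp
  · exact hX.2.2 n hn
  · simp

theorem IsParity.shift {X : Loop R} {p : ℤ} (hp : Even p) (hX : IsParity X) :
    IsParity (shift p X) :=
  ⟨fun _ => hX.1 _, fun _ hn => hX.2.1 _ (hn.sub_even hp), fun _ hn => hX.2.2 _ (hn.sub hp)⟩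

theorem IsParity.serSmul {X : Loop R} {f : Ser R} (hf : ∀ m, Odd m → f m = 0) (hX : IsParity X) :
    IsParity (serSmul f X) := by
  refine ⟨fun n => ?_, fun n hn => ?_, fun n hn => ?_⟩
  · refine finsum_induction (p := fun A : Matrix (Fin 2) (Fin 2) R => A.trace = 0) (by simp)
      (fun A B hA hB => by simp [hA, hB]) fun m => by simp [hX.1]
  · refine finsum_induction (p := fun A : Matrix (Fin 2) (Fin 2) R => A 0 0 = 0 ∧ A 1 1 = 0)
      (by simp) (fun A B hA hB => by simp [hA, hB]) fun m => ?_
    rcases Int.even_or_odd m with h | h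
    · simp [hX.2.1 _ (hn.sub_even h)]
    · simp [hf m h]
  · refine finsum_induction (p := fun A : Matrix (Fin 2) (Fin 2) R => A 0 1 = 0 ∧ A 1 0 = 0)
      (by simp) (fun A B hA hB => by simp [hA, hB]) fun m => ?_
    rcases Int.even_or_odd m with h | h
    · simp [hX.2.2 _ (hn.sub h)]
    · simp [hf m h]

theorem timeSer_odd (m : ℤ) (hm : Odd m) : timeSer v m = 0 := by
  refine Finset.sum_eq_zero fun k _ => if_neg ?_
  rintro rfl
  rcases hm with ⟨j, hj⟩
  omega

theorem timeSerBar_odd (m : ℤ) (hm : Odd m) : timeSerBar v m = 0 := by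
  refine Finset.sum_eq_zero fun k _ => if_neg ?_
  rintro rfl
  rcases hm with ⟨j, hj⟩
  omega

theorem isParity_fieldS : IsParity (fieldS v) :=
  ((isParity_mkLoop _ _ _).serSmul (timeSer_odd v)).add (isParity_mkLoop _ _ _)

theorem isParity_fieldSbar : IsParity (fieldSbar v) :=
  ((isParity_mkLoopBar _ _ _).serSmul (timeSerBar_odd v)).add (isParity_mkLoopBar _ _ _)

theorem mkLoop_of_nonpos (a b c : ℕ → R) (n : ℤ) (hn : n ≤ 0) : mkLoop a b c n = 0 := by
  have h1 : ¬ (2 ≤ n) := by omega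
  have h2 : ¬ (1 ≤ n) := by omega
  ext i j
  fin_cases i <;> fin_cases j <;> simp [mkLoop, evenSer, oddSer, h1, h2]

theorem fieldS_of_lt (n : ℤ) (hn : n < -(2 * (N : ℤ) + 1)) : fieldS v n = 0 := by
  have h1 : serSmul (timeSer v) (fieldY v) n = 0 := by
    refine finsum_eq_zero_of_forall_eq_zero fun m => ?_
    by_cases hm : m < -(2 * (N : ℤ) + 2)
    · have : timeSer v m = 0 := by
        refine Finset.sum_eq_zero fun k _ => if_neg ?_
        have := k.2
        omega
      simp [this]
    · rw [fieldY, mkLoop_of_nonpos _ _ _ _ (by omega), smul_zero]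
  have h2 : dressedS v n = 0 := mkLoop_of_nonpos _ _ _ _ (by omega)
  simp [fieldS, h1, h2]

/-- The components of the extended Maurer-Cartan form lie in the affine Kac-Moody algebra. -/
theorem extPhi_mem (s : Sgn) (K : ℕ) (i : Idx N K) : extPhi v s K i ∈ affineKacMoody R s K := by
  have zeroVir : IsVir s K (0 : Ser R) := ⟨by simp, by simp⟩
  have posTw : ∀ X : Loop R, IsParity X → IsTwisted (posPart X) := fun X hX =>
    ⟨⟨1, fun n hn => if_neg (by omega)⟩, hX.posPart⟩
  have negTw : ∀ X : Loop R, IsTwisted X → IsTwisted (-X) := fun X hX =>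
    ⟨⟨hX.1.choose, fun n hn => by simp [hX.1.choose_spec n hn]⟩, IsParity.neg hX.2⟩
  cases i with
  | rho =>
    refine ⟨zeroVir, ⟨0, fun n hn => Pi.single_eq_of_ne (ne_of_lt hn) _⟩, fun n => ?_,
      fun n hn => ?_, fun n hn => ?_⟩
    · by_cases h : n = 0
      · subst h; simp [extPhi, rotLoop, Matrix.trace_fin_two]
      · simp [extPhi, rotLoop, Pi.single_eq_of_ne h]
    · have h : n ≠ 0 := by rintro rfl; simp at hn
      simp [extPhi, rotLoop, Pi.single_eq_of_ne h]
    · by_cases h : n = 0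
      · subst h; simp [extPhi, rotLoop]
      · simp [extPhi, rotLoop, Pi.single_eq_of_ne h]
  | t m =>
    refine ⟨zeroVir, ⟨-(2 * (m : ℤ) + 2), fun n hn => ?_⟩, ?_⟩
    · have : negPart (shift (-(2 * (m : ℤ) + 2)) (fieldY v)) n = 0 := by
        unfold negPart shift
        split_ifs
        · exact mkLoop_of_nonpos _ _ _ _ (by omega)
        · rfl
      simp only [extPhi, fieldU, this, smul_zero]
    · exact (((isParity_mkLoop _ _ _).shift ⟨-((m : ℤ) + 1), by ring⟩).negPart).smul _
  | tb m =>
    refine ⟨zeroVir, negTw _ ⟨⟨1, fun n hn => ?_⟩, ?_⟩⟩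
    · have : ¬ (1 ≤ n) := by omega
      simp [fieldUbar, posPart, this]
    · exact (((isParity_mkLoopBar _ _ _).shift ⟨(m : ℤ) + 1, by ring⟩).posPart).smul _
  | s k =>
    cases s with
    | plus =>
      refine ⟨⟨(Set.finite_singleton (2 * (k : ℤ))).subset fun n hn => ?_, fun n hn => ?_⟩,
        negTw _ (posTw _ ((isParity_fieldSbar v).shift ⟨(k : ℤ), by ring⟩))⟩
      · by_contra h
        exact hn (by simp [extPhi, lamPow, Pi.single_eq_of_ne (show n ≠ 2 * (k : ℤ) from h)])
      · refine ⟨k, k.2, ?_⟩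
        by_contra h
        refine hn ?_
        have h' : n ≠ 2 * (k : ℤ) := by simpa [Sgn.val] using h
        simp [extPhi, lamPow, Pi.single_eq_of_ne h']
    | minus =>
      refine ⟨⟨(Set.finite_singleton (-(2 * (k : ℤ)))).subset fun n hn => ?_, fun n hn => ?_⟩,
        ⟨-(2 * (N : ℤ) + 1) - 2 * (k : ℤ), fun n hn => ?_⟩,
        ((isParity_fieldS v).shift ⟨-(k : ℤ), by ring⟩).negPart⟩
      · by_contra h
        exact hn (by simp [extPhi, lamPow, Pi.single_eq_of_ne (show n ≠ -(2 * (k : ℤ)) from h)])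
      · refine ⟨k, k.2, ?_⟩
        by_contra h
        refine hn ?_
        have h' : n ≠ -(2 * (k : ℤ)) := by simpa [Sgn.val] using h
        simp [extPhi, lamPow, Pi.single_eq_of_ne h']
      · simp only [extPhi, partS, negPart, shift]
        split_ifs
        · exact fieldS_of_lt v _ (by omega)
        · rfl

end Membership

/-- The algebraic relations among the variables, for the constant `γ`:
`det Y = -4 γ lam ^ 2` and `[S, lam⁻¹ Y] + (lam⁻¹ Y)' = 0`, that is, the lifts of `S` and `Y` commute,
together with the conjugate relations. -/
def relations (N : ℕ) (γ : ℝ) : Set (MvPolynomial (Gen N) ℂ) :=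
  {p | ∃ n : ℤ,
    p = loopDet (fieldY MvPolynomial.X) n +
        (if n = 2 then MvPolynomial.C (4 * (γ : ℂ)) else 0) ∨
    p = loopDet (fieldYbar MvPolynomial.X) n +
        (if n = -2 then MvPolynomial.C (4 * (γ : ℂ)) else 0) ∨
    ∃ i j : Fin 2,
      p = (affBracket (hatS MvPolynomial.X) (hatY MvPolynomial.X)).2 n i j ∨
      p = (affBracket (hatSbar MvPolynomial.X) (hatYbar MvPolynomial.X)).2 n i j}

/-- The algebra of functions: polynomials in the dependent variables modulo the relations. -/
abbrev Fn (N : ℕ) (γ : ℝ) := MvPolynomial (Gen N) ℂ ⧸ Ideal.span (relations N γ)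

/-- The dependent variables, as functions. -/
def coord (N : ℕ) (γ : ℝ) (g : Gen N) : Fn N γ := Ideal.Quotient.mk _ (MvPolynomial.X g)

/-- A formal exterior derivative over the functions `R` for a coframe indexed by `I`.  It is
determined by the components of the differentials of functions (derivations `D i`) and of the coframe
(`c i j k` is the coefficient of the `i`-th wedge the `j`-th in the differential of the `k`-th coframe
element), and is extended by the Leibniz rule.  Nothing is assumed about its square. -/
@[ext]
structure FormalDiff (R : Type*) [CommRing R] [Algebra ℂ R] (I : Type*) where
  D : I → Derivation ℂ R R
  c : I → I → I →₀ R
  c_self : ∀ i, c i i = 0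
  c_swap : ∀ i j, c j i = -c i j

namespace FormalDiff

variable {R : Type*} [CommRing R] [Algebra ℂ R] {I : Type*} (d : FormalDiff R I)

/-- Differential of a function. -/
def dFun (f : R) : I → R := fun i => d.D i f

/-- Differential of a one-form (possibly an infinite formal sum), as an alternating family. -/
def dOne (w : I → R) : I → I → R := fun i j =>
  d.D i (w j) - d.D j (w i) + (d.c i j).sum fun k r => r * w k

/-- Differential of a two-form. -/
def dTwo (w : I → I → R) : I → I → I → R := fun i j k =>
  d.D i (w j k) + d.D j (w k i) + d.D k (w i j) +
    ((d.c i j).sum fun l r => r * w l k) + ((d.c j k).sum fun l r => r * w l i) +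
    ((d.c k i).sum fun l r => r * w l j)

/-- The square of the exterior derivative vanishes: on all functions and on all one-forms, hence on
the exterior algebra generated by them. -/
def SquareZero : Prop :=
  (∀ f, d.dOne (d.dFun f) = 0) ∧ ∀ w, d.dTwo (d.dOne w) = 0

/-- The coframe element of index `i`. -/
def coframe (i : I) : I → R := by
  classical exact Pi.single i 1

/-- Differential of an element with series components, coefficient by coefficient. -/
def dAff (x : Aff R) : I → Aff R := fun i =>
  (fun n => d.dFun (x.1 n) i, fun n => Matrix.of fun a b => d.dFun (x.2 n a b) i)

/-- Differential of a one-form with series components, coefficient by coefficient. -/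
def dAffOne (w : I → Aff R) : I → I → Aff R := fun i j =>
  (fun n => d.dOne (fun k => (w k).1 n) i j,
   fun n => Matrix.of fun a b => d.dOne (fun k => (w k).2 n a b) i j)

/-- `dX + [Φ, X]`. -/
def covariant (Φ : I → Aff R) (x : Aff R) : I → Aff R := fun i =>
  d.dAff x i + affBracket (Φ i) x

/-- `dΦ + (1 / 2) [Φ, Φ]`. -/
def curvature (Φ : I → Aff R) : I → I → Aff R := fun i j =>
  d.dAffOne Φ i j + affBracket (Φ i) (Φ j)

end FormalDiff

/-- The one-form `du + u' σ`, where `σ` is the derivation part of the extended Maurer-Cartan form. -/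
def confForm {N K : ℕ} {R : Type*} [CommRing R] [Algebra ℂ R] (v : Gen N → R) (s : Sgn)
    (d : FormalDiff R (Idx N K)) : Idx N K → Ser R := fun i =>
  (fun n => d.dFun (confSer v s n) i) + serMul (confDot v s K) (extPhi v s K i).1

/-- The structure equations of the extended CMC hierarchy.

The Killing field equation `d X + [Φ, X] = 0` for `X = exp u * (1, S)` is multiplied by `exp (-u)`.
By the Leibniz rule and the definition of the bracket,
`exp (-u) * (d X + [Φ, X]) = d (1, S) + [Φ, (1, S)] + (du + u' σ) * (1, S)`.
In this form all products are well defined for both types: for the negative type the coefficients of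
`exp u * S` itself are infinite sums. -/
structure IsExtendedCMC {N K : ℕ} {γ : ℝ} (s : Sgn)
    (d : FormalDiff (Fn N γ) (Idx N K)) : Prop where
  d_t : ∀ m, d.dFun (coord N γ (.t m)) = FormalDiff.coframe (.t m)
  d_tb : ∀ m, d.dFun (coord N γ (.tb m)) = FormalDiff.coframe (.tb m)
  closed_t : ∀ m, d.dOne (FormalDiff.coframe (.t m)) = 0
  closed_tb : ∀ m, d.dOne (FormalDiff.coframe (.tb m)) = 0
  killing_Y : d.covariant (extPhi (coord N γ) s K) (hatY (coord N γ)) = 0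
  killing_Ybar : d.covariant (extPhi (coord N γ) s K) (hatYbar (coord N γ)) = 0
  killing_S : ∀ i, d.covariant (extPhi (coord N γ) s K) (hatS (coord N γ)) i +
    affSmul (confForm (coord N γ) s d i) (hatS (coord N γ)) = 0
  killing_Sbar : ∀ i, d.covariant (extPhi (coord N γ) s K) (hatSbar (coord N γ)) i +
    affSmul (confForm (coord N γ) s d i) (hatSbar (coord N γ)) = 0
  maurer_cartan : d.curvature (extPhi (coord N γ) s K) = 0

/-- The Virasoro relations for the flows `D (s k)`. -/
def VirasoroRelations {N K : ℕ} {R : Type*} [CommRing R] [Algebra ℂ R]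
    (d : FormalDiff R (Idx N K)) : Prop :=
  ∀ j k : {k : ℕ // K ≤ k},
    ⁅d.D (.s j), d.D (.s k)⁆ =
      (2 * (j : ℤ) - 2 * (k : ℤ)) • d.D (.s ⟨j + k, le_trans j.2 (Nat.le_add_right _ _)⟩)

/-- The Virasoro flows commute with the flows of the CMC hierarchy.  The negative flows commute with
the `t` flows, the positive flows commute with the `tb` flows, and the mixed commutators are multiples
of the infinitesimal rotation dual to the connection form `rho`. -/
def FlowsCommute {N K : ℕ} {R : Type*} [CommRing R] [Algebra ℂ R] (s : Sgn)
    (d : FormalDiff R (Idx N K)) : Prop :=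
  match s with
  | .plus => ∀ (m : Fin (N + 1)) (k : {k : ℕ // K ≤ k}),
      ⁅d.D (.tb m), d.D (.s k)⁆ = 0 ∧ ∃ r : R, ⁅d.D (.t m), d.D (.s k)⁆ = r • d.D .rho
  | .minus => ∀ (m : Fin (N + 1)) (k : {k : ℕ // K ≤ k}),
      ⁅d.D (.t m), d.D (.s k)⁆ = 0 ∧ ∃ r : R, ⁅d.D (.tb m), d.D (.s k)⁆ = r • d.D .rho

end CMCHierarchy

end

/-!
The structure equations are studied in the associative algebra of matrix valued Laurent series,
where brackets are commutators.  Written in components, they prescribe the derivatives of the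
series `Y` and `S` along each coframe direction: `dC (D i) (hY v) = rhsY v s i` and
`dC (D i) (hS v) = rhsS v s i` (`killing_Y_iff`, `killing_S_iff`).  What has to be shown is that
these right hand sides are derivatives of series of the given shape, and that they are compatible
with the relations and with each other.

*Conjugation.*  The substitution `lam ↦ lam⁻¹` exchanges each series with its conjugate, `dt m`
with `dtb m`, and the two types of the hierarchy.  The conjugate equations are therefore the same
equations for conjugate variables (`killing_Ybar_iff`, `killing_Sbar_iff`, `coeff_loopCurv_swap`).
For this reason everything is done for one half of the system, for both types, and for arbitrary
values `v` of the variables.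

*Untruncated components.*  A component `A` of the Maurer-Cartan form is the negative part of a
multiple of `lam ^ (-(2 m + 2)) Y` or of `lam ^ (-2 k) S`, or has no negative part.  Since the
lifts of `S` and `Y` commute, the untruncated series drops out of the Killing field equations, and
`A` may be replaced by `rest`, which has only nonnegative degrees (`rhsY_eq`, `rhsD_eq`).  Hence
the derivatives of `Y` and of the dressed part of `S` have only positive degrees (`geDeg_rhsY`,
`geDeg_rhsD`), so they have the shape of `Y` and can be read as definitions of the derivatives of
the variables.  The exception is the term of degree `2 K - 2 N - 1` produced by the action of the
positive Virasoro generators on the times: it is admissible for `K ≥ N + 1`, and for `K ≤ N` it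
excludes any solution (`timeCoef_smul_coeff_hY`), as one sees at a point where `Y` is a monomial
and the times do not vanish.

*Existence and uniqueness.*  The flows so defined preserve the relations (`IsFlowAlong.map_detRel`,
`IsFlowAlong.map_liftRel`), and descend to the algebra of functions.  The replacement of `A` by
`rest` also shows that the curvature of the Maurer-Cartan form has no part of negative degree
(`geDeg_loopCurv`), hence none of positive degree.  Its part of degree zero is diagonal, and
determines the differential of the connection form `rho` (`connCurv`).  The differentials of the
other elements of the coframe are determined by the derivation part of the Maurer-Cartan equation
(`hasVirasoroCoframe_of_curvature`).

*Compatibility.*  The commutators of the flows on `Y` and `S` follow from the Maurer-Cartan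
equation (`commutator_eq`), which is the vanishing of the square of the exterior derivative on
functions.  On one-forms what remains is the closedness of the curvature of the connection form;
this is the entry of degree zero of the Bianchi identity (`squareZero_of_commutator`).  The
commutation relations of the flows follow since the curvature of the connection form vanishes on
pairs of directions for which both loop parts have positive degree, or both have negative degree.
-/

noncomputable section

namespace CMCHierarchy

/-! ### The associative algebra of matrix valued Laurent series -/

section LaurentLoops

variable {R P : Type*} [CommRing R] [CommRing P]

/-- Matrix valued series with bounded below support.  With these, unlike with bilateral families,
the bracket of loops is the commutator of an associative product, so that identities between
brackets can be checked by expanding. -/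
def LaurentLoop (R : Type*) [CommRing R] := HahnSeries ℤ (Matrix (Fin 2) (Fin 2) R)

instance : Ring (LaurentLoop R) :=
  inferInstanceAs (Ring (HahnSeries ℤ (Matrix (Fin 2) (Fin 2) R)))

instance : Algebra R (LaurentLoop R) :=
  inferInstanceAs (Algebra R (HahnSeries ℤ (Matrix (Fin 2) (Fin 2) R)))

namespace LaurentLoop

/-- The family of coefficients. -/
def coeff (x : LaurentLoop R) : Loop R := HahnSeries.coeff x

theorem coeff_injective : Function.Injective (coeff : LaurentLoop R → Loop R) :=
  HahnSeries.coeff_injective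

@[ext] theorem ext {x y : LaurentLoop R} (h : ∀ n, x.coeff n = y.coeff n) : x = y :=
  coeff_injective (funext h)

@[simp] theorem coeff_zero (n : ℤ) : (0 : LaurentLoop R).coeff n = 0 := rfl

@[simp] theorem coeff_add (x y : LaurentLoop R) (n : ℤ) :
    (x + y).coeff n = x.coeff n + y.coeff n := rfl

theorem coeff_add' (x y : LaurentLoop R) : (x + y).coeff = x.coeff + y.coeff := rfl

@[simp] theorem coeff_neg (x : LaurentLoop R) (n : ℤ) : (-x).coeff n = -x.coeff n := rfl

@[simp] theorem coeff_sub (x y : LaurentLoop R) (n : ℤ) :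
    (x - y).coeff n = x.coeff n - y.coeff n := rfl

@[simp] theorem coeff_smul (r : R) (x : LaurentLoop R) (n : ℤ) :
    (r • x).coeff n = r • x.coeff n := rfl

/-- The coefficient of a fixed degree, as an additive map. -/
def coeffHom (n : ℤ) : LaurentLoop R →+ Matrix (Fin 2) (Fin 2) R where
  toFun x := x.coeff n
  map_zero' := rfl
  map_add' _ _ := rfl

@[simp] theorem coeff_zsmul (k : ℤ) (x : LaurentLoop R) (n : ℤ) :
    (k • x).coeff n = k • x.coeff n := map_zsmul (coeffHom n) k x

@[simp] theorem coeff_sum {ι : Type*} (t : Finset ι) (f : ι → LaurentLoop R) (n : ℤ) :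
    (∑ i ∈ t, f i).coeff n = ∑ i ∈ t, (f i).coeff n := map_sum (coeffHom n) f t

end LaurentLoop

open LaurentLoop

/-- A bounded below family of matrices, as an element of `LaurentLoop R`. -/
def ofLoop (X : Loop R) (h : ∃ B : ℤ, ∀ n < B, X n = 0) : LaurentLoop R :=
  HahnSeries.ofSuppBddBelow X (h.imp fun _ hB n hn => not_lt.1 fun hlt => hn (hB n hlt))

/-- The monomial `A * lam ^ p`. -/
def monomial (p : ℤ) (A : Matrix (Fin 2) (Fin 2) R) : LaurentLoop R := HahnSeries.single p A

theorem coeff_monomial (p : ℤ) (A : Matrix (Fin 2) (Fin 2) R) (n : ℤ) :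
    (monomial p A).coeff n = if n = p then A else 0 := by
  by_cases h : n = p
  · subst h
    rw [if_pos rfl]
    exact HahnSeries.coeff_single_same _ _
  · rw [if_neg h]
    exact HahnSeries.coeff_single_of_ne h

@[simp] theorem coeff_ofLoop (X : Loop R) (h : ∃ B : ℤ, ∀ n < B, X n = 0) :
    (ofLoop X h).coeff = X := rfl

theorem bddBelow (x : LaurentLoop R) : ∃ B : ℤ, ∀ n < B, x.coeff n = 0 := by
  exact ⟨HahnSeries.order x, fun n hn => HahnSeries.coeff_eq_zero_of_lt_order hn⟩

theorem finite_support_mul (x y : LaurentLoop R) (n : ℤ) :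
    (fun m : ℤ => x.coeff m * y.coeff (n - m)).HasFiniteSupport := by
  obtain ⟨A, hA⟩ := bddBelow x
  obtain ⟨B, hB⟩ := bddBelow y
  refine (Set.finite_Icc A (n - B)).subset fun m hm => ⟨?_, ?_⟩
  · by_contra h
    exact hm (by simp [hA m (by omega)])
  · by_contra h
    exact hm (by simp [hB (n - m) (by omega)])

theorem coeff_mul_eq_finsum (x y : LaurentLoop R) (n : ℤ) :
    (x * y).coeff n = ∑ᶠ m : ℤ, x.coeff m * y.coeff (n - m) := by
  refine (HahnSeries.coeff_mul (R := Matrix (Fin 2) (Fin 2) R)).trans ?_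
  rw [finsum_eq_sum_of_support_subset (s := (Finset.antidiagonal
    (HahnSeries.isPWO_support x) (HahnSeries.isPWO_support y) n).image Prod.fst), Finset.sum_image]
  · refine Finset.sum_congr rfl fun p hp => ?_
    rw [Finset.mem_antidiagonal] at hp
    rw [← hp.2.2, add_sub_cancel_left]
    rfl
  · intro p hp q hq h
    simp only [Finset.mem_coe, Finset.mem_antidiagonal] at hp hq
    have := hp.2.2.trans hq.2.2.symm
    exact Prod.ext h (by rw [h] at this; exact add_left_cancel this)
  · intro m hm
    simp only [Finset.coe_image, Set.mem_image, Finset.mem_coe, Finset.mem_antidiagonal]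
    refine ⟨(m, n - m), ⟨?_, ?_, by simp⟩, rfl⟩
    · exact fun h => hm (by beta_reduce; rw [show x.coeff m = 0 from h, zero_mul])
    · exact fun h => hm (by beta_reduce; rw [show y.coeff (n - m) = 0 from h, mul_zero])

theorem coeff_mul_eq_finsum' (x y : LaurentLoop R) (n : ℤ) :
    (x * y).coeff n = ∑ᶠ m : ℤ, x.coeff (n - m) * y.coeff m := by
  rw [coeff_mul_eq_finsum, ← finsum_comp_equiv (Equiv.subLeft n)]
  simp

theorem finite_support_mul' (x y : LaurentLoop R) (n : ℤ) :
    (fun m : ℤ => x.coeff (n - m) * y.coeff m).HasFiniteSupport := by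
  have := (finite_support_mul x y n).preimage ((Equiv.subLeft n).injective.injOn)
  refine this.subset fun m hm => ?_
  simpa using hm

/-- The bracket of loops is the commutator of the product. -/
theorem loopBracket_coeff (x y : LaurentLoop R) :
    loopBracket x.coeff y.coeff = (x * y - y * x).coeff := by
  funext n
  rw [coeff_sub, coeff_mul_eq_finsum, coeff_mul_eq_finsum',
    ← finsum_sub_distrib (finite_support_mul x y n) (finite_support_mul' y x n)]
  rfl

/-- Multiplication by `lam ^ p`. -/
def sh (p : ℤ) : LaurentLoop R →+ LaurentLoop R := AddMonoidHom.mulLeft (monomial p 1)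

@[simp] theorem coeff_sh (p : ℤ) (x : LaurentLoop R) (n : ℤ) :
    (sh p x).coeff n = x.coeff (n - p) := by
  exact (HahnSeries.coeff_single_mul (R := Matrix (Fin 2) (Fin 2) R)).trans (one_mul _)

theorem sh_mul (p : ℤ) (x y : LaurentLoop R) : sh p x * y = sh p (x * y) := by
  simp [sh, mul_assoc]

theorem mul_sh (p : ℤ) (x y : LaurentLoop R) : x * sh p y = sh p (x * y) := by
  have h : x * monomial p 1 = monomial p 1 * x := by
    ext n : 1
    exact ((HahnSeries.coeff_mul_single (R := Matrix (Fin 2) (Fin 2) R)).trans (mul_one _)).trans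
      (coeff_sh p x n).symm
  simp only [sh, AddMonoidHom.coe_mulLeft]
  rw [← mul_assoc, h, mul_assoc]

theorem sh_sh (p q : ℤ) (x : LaurentLoop R) : sh p (sh q x) = sh (p + q) x := by
  ext n : 1
  simp [sub_sub]

@[simp] theorem sh_zero (x : LaurentLoop R) : sh 0 x = x := by
  ext n : 1
  simp

theorem sh_smul (p : ℤ) (r : R) (x : LaurentLoop R) : sh p (r • x) = r • sh p x := by
  ext n : 1
  simp

/-- The Euler operator on Laurent series. -/
def eul : LaurentLoop R →+ LaurentLoop R where
  toFun x := ofLoop (euler x.coeff) ((bddBelow x).imp fun B hB n hn => by simp [euler, hB n hn])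
  map_zero' := by ext n : 1; simp [euler]
  map_add' x y := by ext n : 1; simp [euler]

@[simp] theorem coeff_eul (x : LaurentLoop R) (n : ℤ) : (eul x).coeff n = n • x.coeff n := rfl

theorem eul_mul (x y : LaurentLoop R) : eul (x * y) = eul x * y + x * eul y := by
  ext n : 1
  rw [coeff_add, coeff_eul, coeff_mul_eq_finsum, coeff_mul_eq_finsum,
    coeff_mul_eq_finsum, ← finsum_add_distrib (finite_support_mul _ _ n)
    (finite_support_mul _ _ n), smul_finsum' _ (finite_support_mul _ _ n)]
  refine finsum_congr fun m => ?_
  rw [coeff_eul, coeff_eul, smul_mul_assoc, mul_smul_comm, ← add_smul]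
  congr 1
  ring

theorem eul_sh (p : ℤ) (x : LaurentLoop R) : eul (sh p x) = sh p (eul x) + p • sh p x := by
  ext n : 1
  simp only [coeff_eul, coeff_sh, coeff_add, coeff_zsmul, ← add_smul]
  congr 1
  ring

theorem eul_smul (r : R) (x : LaurentLoop R) : eul (r • x) = r • eul x := by
  ext n : 1
  simp [smul_comm]

/-- An additive map applied to all coefficients. -/
def mapC (δ : P →+ R) : LaurentLoop P →+ LaurentLoop R where
  toFun x := ofLoop (fun n => (x.coeff n).map δ)
    ((bddBelow x).imp fun B hB n hn => by ext; simp [hB n hn])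
  map_zero' := by ext n : 1; ext; simp
  map_add' x y := by ext n : 1; ext; simp

@[simp] theorem coeff_mapC (δ : P →+ R) (x : LaurentLoop P) (n : ℤ) (a b : Fin 2) :
    (mapC δ x).coeff n a b = δ (x.coeff n a b) := rfl

theorem mapC_sh (δ : P →+ R) (p : ℤ) (x : LaurentLoop P) : mapC δ (sh p x) = sh p (mapC δ x) := by
  ext n : 1; ext a b; simp

theorem mapC_eul (δ : P →+ R) (x : LaurentLoop P) : mapC δ (eul x) = eul (mapC δ x) := by
  ext n : 1; ext a b; simp [-zsmul_eq_mul]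

theorem mapC_id (x : LaurentLoop R) : mapC (AddMonoidHom.id R) x = x := by
  ext n : 1; ext a b; simp

/-- The product rule, for a derivation `δ` along a map `π`. -/
theorem mapC_mul (δ π : P →+ R) (h : ∀ a b, δ (a * b) = δ a * π b + π a * δ b)
    (x y : LaurentLoop P) :
    mapC δ (x * y) = mapC δ x * mapC π y + mapC π x * mapC δ y := by
  ext n : 1
  have e : (mapC δ (x * y)).coeff n = (AddMonoidHom.mapMatrix δ) ((x * y).coeff n) := rfl
  rw [coeff_add, e, coeff_mul_eq_finsum, coeff_mul_eq_finsum,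
    coeff_mul_eq_finsum, ← finsum_add_distrib (finite_support_mul _ _ n)
    (finite_support_mul _ _ n), map_finsum _ (finite_support_mul _ _ n)]
  refine finsum_congr fun m => ?_
  ext a b
  simp [Matrix.mul_apply, Fin.sum_univ_two, h]
  ring

/-- The series `x` has no terms of degree less than `d`. -/
def GeDeg (d : ℤ) (x : LaurentLoop R) : Prop := ∀ n < d, x.coeff n = 0

theorem GeDeg.mono {d e : ℤ} {x : LaurentLoop R} (h : GeDeg e x) (hd : d ≤ e) : GeDeg d x :=
  fun n hn => h n (by omega)

theorem geDeg_zero (d : ℤ) : GeDeg d (0 : LaurentLoop R) := fun n _ => by simp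

theorem GeDeg.add {d : ℤ} {x y : LaurentLoop R} (hx : GeDeg d x) (hy : GeDeg d y) :
    GeDeg d (x + y) := fun n hn => by simp [hx n hn, hy n hn]

theorem GeDeg.sub {d : ℤ} {x y : LaurentLoop R} (hx : GeDeg d x) (hy : GeDeg d y) :
    GeDeg d (x - y) := fun n hn => by simp [hx n hn, hy n hn]

theorem GeDeg.neg {d : ℤ} {x : LaurentLoop R} (hx : GeDeg d x) :
    GeDeg d (-x) := fun n hn => by simp [hx n hn]

theorem GeDeg.zsmul {d : ℤ} {x : LaurentLoop R} (hx : GeDeg d x) (k : ℤ) :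
    GeDeg d (k • x) := fun n hn => by rw [coeff_zsmul, hx n hn, smul_zero]

theorem GeDeg.smul {d : ℤ} {x : LaurentLoop R} (hx : GeDeg d x) (r : R) :
    GeDeg d (r • x) := fun n hn => by simp [hx n hn]

theorem GeDeg.eul {d : ℤ} {x : LaurentLoop R} (hx : GeDeg d x) :
    GeDeg d (eul x) := fun n hn => by simp [hx n hn]

theorem GeDeg.mapC {d : ℤ} {x : LaurentLoop P} (hx : GeDeg d x) (δ : P →+ R) :
    GeDeg d (mapC δ x) := fun n hn => by ext; simp [hx n hn]

theorem GeDeg.sh {d e : ℤ} {x : LaurentLoop R} (hx : GeDeg e x) (p : ℤ) (h : d ≤ e + p) :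
    GeDeg d (sh p x) := fun n hn => by
  rw [coeff_sh]
  exact hx _ (by omega)

theorem GeDeg.mul {d e : ℤ} {x y : LaurentLoop R} (hx : GeDeg d x) (hy : GeDeg e y) :
    GeDeg (d + e) (x * y) := fun n hn => by
  rw [coeff_mul_eq_finsum]
  refine finsum_eq_zero_of_forall_eq_zero fun m => ?_
  by_cases h : m < d
  · rw [hx m h, zero_mul]
  · rw [hy (n - m) (by omega), mul_zero]

end LaurentLoops

open LaurentLoop

/-! ### Series operations against monomials, and derivations of series -/

section Translation

variable {R : Type*} [CommRing R]

theorem serMul_monomial_left (k p : ℤ) (g : Ser R) :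
    serMul (k • lamPow R p) g = fun n => k • g (n - p) := by
  funext n
  unfold serMul
  rw [finsum_eq_single _ p (fun m hm => by simp [lamPow, Pi.single_eq_of_ne hm])]
  simp [lamPow]

theorem serMul_comm (f g : Ser R) : serMul f g = serMul g f := by
  funext n
  unfold serMul
  rw [← finsum_comp_equiv (Equiv.subLeft n)]
  simp [mul_comm]

theorem serSmul_monomial (k p : ℤ) (X : Loop R) :
    serSmul (k • lamPow R p) X = fun n => k • X (n - p) := by
  funext n
  unfold serSmul
  rw [finsum_eq_single _ p (fun m hm => by simp [lamPow, Pi.single_eq_of_ne hm])]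
  rw [Pi.smul_apply, lamPow, Pi.single_eq_same, smul_assoc, one_smul]

theorem euler_monomial (k p : ℤ) : euler (k • lamPow R p) = (k * p) • lamPow R p := by
  funext n
  by_cases h : n = p
  · subst h
    simp [euler, lamPow, mul_comm]
  · simp [euler, lamPow, Pi.single_eq_of_ne h]

variable [Algebra ℂ R]

/-- A derivation applied to all coefficients. -/
def dC (D : Derivation ℂ R R) : LaurentLoop R →+ LaurentLoop R := mapC D.toLinearMap.toAddMonoidHom

@[simp] theorem coeff_dC (D : Derivation ℂ R R) (x : LaurentLoop R) (n : ℤ) (a b : Fin 2) :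
    (dC D x).coeff n a b = D (x.coeff n a b) := rfl

theorem dC_mul (D : Derivation ℂ R R) (x y : LaurentLoop R) :
    dC D (x * y) = dC D x * y + x * dC D y := by
  have := mapC_mul D.toLinearMap.toAddMonoidHom (AddMonoidHom.id R)
    (fun a b => by simp [mul_comm, add_comm]) x y
  rwa [mapC_id, mapC_id] at this

theorem dC_sh (D : Derivation ℂ R R) (p : ℤ) (x : LaurentLoop R) :
    dC D (sh p x) = sh p (dC D x) := mapC_sh _ _ _

theorem dC_eul (D : Derivation ℂ R R) (x : LaurentLoop R) :
    dC D (eul x) = eul (dC D x) := mapC_eul _ _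

theorem dC_smul (D : Derivation ℂ R R) (r : R) (x : LaurentLoop R) :
    dC D (r • x) = D r • x + r • dC D x := by
  ext n : 1; ext a b
  simp [mul_comm, add_comm]

theorem GeDeg.dC {d : ℤ} {x : LaurentLoop R} (hx : GeDeg d x) (D : Derivation ℂ R R) :
    GeDeg d (dC D x) := hx.mapC _

end Translation

/-! ### The fields of the hierarchy as Laurent series -/

section Fields

variable {N : ℕ} {R : Type*} [CommRing R] [Algebra ℂ R] (v : Gen N → R) (s : Sgn) (K : ℕ)

/-- The Killing field `Y` in the ring of Laurent series. -/
def hY : LaurentLoop R := ofLoop (fieldY v) ⟨0, fun n hn => mkLoop_of_nonpos _ _ _ n hn.le⟩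

/-- The dressed spectral Killing field in the ring of Laurent series. -/
def hD : LaurentLoop R := ofLoop (dressedS v) ⟨0, fun n hn => mkLoop_of_nonpos _ _ _ n hn.le⟩

/-- The spectral Killing field `S` in the ring of Laurent series. -/
def hS : LaurentLoop R := ofLoop (fieldS v) ⟨_, fieldS_of_lt v⟩

variable {K} in
/-- The loop part of a component of the extended Maurer-Cartan form. -/
def hA (i : Idx N K) : LaurentLoop R := ofLoop (extPhi v s K i).2 (extPhi_mem v s K i).2.1

variable {K} in
/-- The degree of the derivation part of a component of the extended Maurer-Cartan form. -/
def vdeg : Idx N K → ℤ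
  | .s k => s.val * (2 * (k : ℕ))
  | _ => 0

variable {K} in
/-- The coefficient of the derivation part of a component of the extended Maurer-Cartan form. -/
def vcoef : Idx N K → ℤ
  | .s _ => -s.val
  | _ => 0

variable {K} in
theorem extPhi_fst (i : Idx N K) :
    (extPhi v s K i).1 = vcoef s i • lamPow R (vdeg s i) := by
  cases i <;> cases s <;> simp [extPhi, vcoef, vdeg, Sgn.val]

variable {K} in
theorem extPhi_snd (i : Idx N K) : (extPhi v s K i).2 = (hA v s i).coeff := rfl

/-- The coefficient of `timeSer` of degree `-(2 m + 2)`. -/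
def timeCoef (m : Fin (N + 1)) : R := (Complex.I / 2 * (2 * (m : ℂ) + 1)) • v (.t m)

/-- Multiplication by `timeSer`. -/
def timeMul : LaurentLoop R →+ LaurentLoop R where
  toFun x := ∑ m : Fin (N + 1), timeCoef v m • sh (-(2 * (m : ℤ) + 2)) x
  map_zero' := by simp
  map_add' x y := by simp [Finset.sum_add_distrib]

theorem timeMul_apply (x : LaurentLoop R) :
    timeMul v x = ∑ m : Fin (N + 1), timeCoef v m • sh (-(2 * (m : ℤ) + 2)) x := rfl

theorem timeMul_mul (x y : LaurentLoop R) : timeMul v x * y = timeMul v (x * y) := by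
  simp only [timeMul_apply, Finset.sum_mul, smul_mul_assoc, sh_mul]

theorem mul_timeMul (x y : LaurentLoop R) : x * timeMul v y = timeMul v (x * y) := by
  simp only [timeMul_apply, Finset.mul_sum, mul_smul_comm, mul_sh]

theorem sh_timeMul (p : ℤ) (x : LaurentLoop R) : sh p (timeMul v x) = timeMul v (sh p x) := by
  simp only [timeMul_apply, map_sum, sh_smul, sh_sh, add_comm]

theorem hS_eq : hS v = timeMul v (hY v) + hD v := by
  ext n : 1
  have h : serSmul (timeSer v) (fieldY v) n = (timeMul v (hY v)).coeff n := by
    simp only [timeMul_apply, coeff_sum, coeff_smul, coeff_sh, hY,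
      coeff_ofLoop, serSmul, timeSer]
    have : ∀ m : ℤ, (∑ k : Fin (N + 1), if m = -(2 * (k : ℤ) + 2) then
        (Complex.I / 2 * (2 * (k : ℂ) + 1)) • v (.t k) else 0) • fieldY v (n - m) =
        ∑ k : Fin (N + 1), if m = -(2 * (k : ℤ) + 2) then
          timeCoef v k • fieldY v (n - m) else 0 := fun m => by
      rw [Finset.sum_smul]
      exact Finset.sum_congr rfl fun k _ => by split_ifs <;> simp [timeCoef]
    simp only [this]
    rw [finsum_sum_comm]
    · refine Finset.sum_congr rfl fun k _ => ?_
      rw [finsum_eq_single _ (-(2 * (k : ℤ) + 2)) fun m hm => if_neg hm, if_pos rfl]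
    · intro k _
      refine (Set.finite_singleton (-(2 * (k : ℤ) + 2))).subset fun m hm => ?_
      by_contra h
      exact hm (if_neg h)
  rw [coeff_add, ← h]
  rfl

end Fields

/-! ### The Killing field equations in components -/

section HalfSystem

variable {N K : ℕ} {R : Type*} [CommRing R] [Algebra ℂ R] (v : Gen N → R) (s : Sgn)

/-- The right hand side of the equation for the derivative of `Y`. -/
def rhsY (i : Idx N K) : LaurentLoop R :=
  -(hA v s i * hY v - hY v * hA v s i) - vcoef s i • sh (vdeg s i) (eul (hY v) - hY v)

/-- The right hand side of the equation for the derivative of `S`. -/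
def rhsS (i : Idx N K) : LaurentLoop R :=
  -(hA v s i * hS v - hS v * hA v s i)
    - vcoef s i • sh (vdeg s i) (eul (hS v) + vdeg s i • hS v) + eul (hA v s i)

/-- The right hand side of the equation for the derivative of the conformal factor.  It is the
scalar part of the Killing field equation for `S`. -/
def rhsU (i : Idx N K) (n : ℤ) : R :=
  vcoef s i • (vdeg s i • lamPow R (vdeg s i) n - confDot v s K (n - vdeg s i))

/-- The Killing field equations for `Y` and `S`, but not those for their conjugates. -/
structure KillingHalf (D : Idx N K → Derivation ℂ R R) : Prop where
  eqY : ∀ i, dC (D i) (hY v) = rhsY v s i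
  eqS : ∀ i, dC (D i) (hS v) = rhsS v s i
  eqU : ∀ i n, D i (confSer v s n) = rhsU v s i n

theorem killing_Y_iff (d : FormalDiff R (Idx N K)) :
    d.covariant (extPhi v s K) (hatY v) = 0 ↔ ∀ i, dC (d.D i) (hY v) = rhsY v s i := by
  rw [funext_iff]
  refine forall_congr' fun i => ?_
  have hyc : shift (-1) (fieldY v) = (sh (-1) (hY v)).coeff := by
    funext n
    simp [shift, hY]
  have h1 : (d.covariant (extPhi v s K) (hatY v) i).1 = 0 := by
    funext n
    simp [FormalDiff.covariant, FormalDiff.dAff, FormalDiff.dFun, hatY, affBracket, serMul, euler]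
  have h2 : (d.covariant (extPhi v s K) (hatY v) i).2 =
      (sh (-1) (dC (d.D i) (hY v) - rhsY v s i)).coeff := by
    have e1 : (affBracket (extPhi v s K i) (hatY v)).2 =
        (hA v s i * sh (-1) (hY v) - sh (-1) (hY v) * hA v s i +
          vcoef s i • sh (vdeg s i) (eul (sh (-1) (hY v)))).coeff := by
      simp only [affBracket, hatY, hyc, extPhi_snd, loopBracket_coeff, extPhi_fst,
        serSmul_monomial]
      funext n
      simp [serSmul, euler, -zsmul_eq_mul]
    have e2 : (d.dAff (hatY v) i).2 = (sh (-1) (dC (d.D i) (hY v))).coeff := by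
      rw [← dC_sh]
      funext n
      simp only [FormalDiff.dAff, hatY, hyc]
      rfl
    simp only [FormalDiff.covariant, Prod.snd_add, e1, e2]
    rw [← coeff_add']
    congr 1
    simp only [rhsY, map_sub, map_neg, map_zsmul, sh_mul, mul_sh, eul_sh]
    simp only [map_add, map_zsmul, sh_sh, add_comm (-1 : ℤ)]
    module
  rw [Prod.ext_iff, h1, h2]
  simp only [Pi.zero_apply, Prod.fst_zero, Prod.snd_zero, true_and]
  constructor
  · intro h
    have : sh (-1) (dC (d.D i) (hY v) - rhsY v s i) = 0 := coeff_injective h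
    have := congrArg (sh 1) this
    rw [sh_sh, map_zero] at this
    simpa [sub_eq_zero] using this
  · intro h
    rw [h, sub_self, map_zero]
    rfl

theorem confForm_add (d : FormalDiff R (Idx N K)) (i : Idx N K) (n : ℤ) :
    confForm v s d i n = d.D i (confSer v s n) + vcoef s i • confDot v s K (n - vdeg s i) := by
  simp only [confForm, FormalDiff.dFun, serMul_comm (confDot v s K), extPhi_fst,
    serMul_monomial_left, Pi.add_apply]

/-- The Killing field equation for `S`.  Its scalar part says that `du + u' σ` is the derivative of
the derivation part of the Maurer-Cartan form; with this the loop part becomes an equation for `S`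
in which the conformal factor no longer occurs. -/
theorem killing_S_iff (d : FormalDiff R (Idx N K)) :
    (∀ i, d.covariant (extPhi v s K) (hatS v) i + affSmul (confForm v s d i) (hatS v) = 0) ↔
      (∀ i, dC (d.D i) (hS v) = rhsS v s i) ∧ ∀ i n, d.D i (confSer v s n) = rhsU v s i n := by
  rw [← forall_and]
  refine forall_congr' fun i => ?_
  have one : lamPow R 0 = (1 : ℤ) • lamPow R 0 := (one_smul _ _).symm
  have h1 : (d.covariant (extPhi v s K) (hatS v) i + affSmul (confForm v s d i) (hatS v)).1 =
      fun n => d.D i (confSer v s n) - rhsU v s i n := by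
    funext n
    simp only [FormalDiff.covariant, affBracket, hatS, affSmul, Prod.fst_add]
    rw [extPhi_fst, serMul_comm (confForm v s d i), one, euler_monomial, euler_monomial]
    simp only [Pi.add_apply, Pi.sub_apply, serMul_monomial_left, FormalDiff.dAff, FormalDiff.dFun,
      confForm_add, rhsU]
    have : d.D i (lamPow R 0 n) = 0 := by
      by_cases h : n = 0
      · subst h; simp [lamPow]
      · simp [lamPow, Pi.single_eq_of_ne h]
    simp only [one_smul, this, sub_zero, mul_zero, zero_smul, smul_zero,
      Pi.smul_apply]
    module
  have hconf : (∀ n, d.D i (confSer v s n) = rhsU v s i n) →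
      confForm v s d i = (vcoef s i * vdeg s i) • lamPow R (vdeg s i) := fun h => by
    funext n
    rw [confForm_add, h, rhsU, Pi.smul_apply]
    module
  have h2 : (∀ n, d.D i (confSer v s n) = rhsU v s i n) →
      (d.covariant (extPhi v s K) (hatS v) i + affSmul (confForm v s d i) (hatS v)).2 =
      (dC (d.D i) (hS v) - rhsS v s i).coeff := fun h => by
    funext n
    simp only [FormalDiff.covariant, affBracket, hatS, affSmul, Prod.snd_add]
    rw [hconf h, extPhi_fst, one]
    simp only [serSmul_monomial, extPhi_snd]
    rw [show fieldS v = (hS v).coeff from rfl, loopBracket_coeff]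
    rw [show dC (d.D i) (hS v) - rhsS v s i = dC (d.D i) (hS v) +
      ((hA v s i * hS v - hS v * hA v s i) + vcoef s i • sh (vdeg s i) (eul (hS v))
        - eul (hA v s i)) + (vcoef s i * vdeg s i) • sh (vdeg s i) (hS v) by
      simp only [rhsS, map_add, map_zsmul]
      module]
    simp only [Pi.add_apply, Pi.sub_apply, coeff_add, coeff_sub,
      coeff_zsmul, coeff_sh, sub_zero, one_smul]
    rfl
  rw [Prod.ext_iff, h1]
  simp only [Prod.fst_zero, Prod.snd_zero]
  constructor
  · rintro ⟨ha, hb⟩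
    have ha' : ∀ n, d.D i (confSer v s n) = rhsU v s i n := fun n =>
      sub_eq_zero.1 (congrFun ha n)
    rw [h2 ha'] at hb
    exact ⟨sub_eq_zero.1 (coeff_injective hb), ha'⟩
  · rintro ⟨ha, hb⟩
    refine ⟨funext fun n => sub_eq_zero.2 (hb n), ?_⟩
    rw [h2 hb, ha, sub_self]
    rfl

end HalfSystem

/-! ### Untruncated components of the Maurer-Cartan form -/

section Splitting

variable {N K : ℕ} {R : Type*} [CommRing R] [Algebra ℂ R] (v : Gen N → R) (s : Sgn)

/-- The loop part of the untruncated form of a component of the Maurer-Cartan form: a multiple of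
`lam ^ (-(2 m + 2)) Y` for `t m` and, for the negative type, `lam ^ (-2 k) S` for `s k`. -/
def pot (v : Gen N → R) : Sgn → Idx N K → LaurentLoop R
  | _, .t m => algebraMap ℂ R (1 / (2 * Complex.I)) • sh (-(2 * (m : ℤ) + 2)) (hY v)
  | .minus, .s k => sh (-(2 * ((k : ℕ) : ℤ))) (hS v)
  | _, _ => 0

/-- The coefficient of the derivation part of `pot`. -/
def potCoef : Sgn → Idx N K → ℤ
  | .minus, .s _ => 1
  | _, _ => 0

/-- The coefficient of the derivation part of `rest`. -/
def restCoef : Sgn → Idx N K → ℤ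
  | .plus, .s _ => -1
  | _, _ => 0

/-- The difference between a component of the Maurer-Cartan form and its untruncated form.  It has
no terms of negative degree, since the truncation removes only terms of nonnegative degree. -/
def rest (i : Idx N K) : LaurentLoop R := hA v s i - pot v s i

theorem hA_eq (i : Idx N K) : hA v s i = rest v s i + pot v s i := by simp [rest]

theorem vcoef_eq (i : Idx N K) : vcoef s i = restCoef s i + potCoef s i := by
  cases i <;> cases s <;> simp [vcoef, restCoef, potCoef, Sgn.val]

theorem geDeg_hY : GeDeg 1 (hY v) := fun n hn => mkLoop_of_nonpos _ _ _ n (by omega)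

theorem geDeg_hD : GeDeg 1 (hD v) := fun n hn => mkLoop_of_nonpos _ _ _ n (by omega)

theorem geDeg_hA_rho : GeDeg 0 (hA v s (.rho : Idx N K)) := fun _ hn =>
  Pi.single_eq_of_ne (ne_of_lt hn) _

theorem geDeg_hA_tb (m : Fin (N + 1)) : GeDeg 1 (hA v s (.tb m : Idx N K)) := fun n hn => by
  have : ¬ (1 ≤ n) := by omega
  simp [hA, extPhi, fieldUbar, posPart, this]

theorem geDeg_hA_s_plus (k : {k : ℕ // K ≤ k}) :
    GeDeg 1 (hA v .plus (.s k : Idx N K)) := fun n hn => by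
  have : ¬ (1 ≤ n) := by omega
  simp [hA, extPhi, partSbar, posPart, this]

theorem coeff_hA_t (m : Fin (N + 1)) (n : ℤ) : (hA v s (.t m : Idx N K)).coeff n =
    if n ≤ -1 then (pot v s (.t m : Idx N K)).coeff n else 0 := by
  have : (pot v s (.t m : Idx N K)).coeff n =
      (1 / (2 * Complex.I)) • shift (-(2 * (m : ℤ) + 2)) (fieldY v) n := by
    ext a b
    cases s <;> simp only [pot, shift, hY, coeff_smul, coeff_sh, coeff_ofLoop, Matrix.smul_apply,
      smul_eq_mul] <;> exact (Algebra.smul_def _ _).symm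
  rw [this]
  simp only [hA, extPhi, coeff_ofLoop, fieldU, negPart]
  split_ifs <;> simp

theorem coeff_hA_s_minus (k : {k : ℕ // K ≤ k}) (n : ℤ) :
    (hA v .minus (.s k : Idx N K)).coeff n =
    if n ≤ -1 then (pot v .minus (.s k : Idx N K)).coeff n else 0 := by
  simp only [hA, extPhi, coeff_ofLoop, partS, negPart, pot, shift, coeff_sh, hS]

theorem geDeg_rest (i : Idx N K) : GeDeg 0 (rest v s i) := by
  intro n hn
  have hn' : n ≤ -1 := by omega
  rw [rest, coeff_sub]
  cases i with
  | rho => cases s <;> simp [pot, geDeg_hA_rho v _ n hn]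
  | t m => rw [coeff_hA_t, if_pos hn', sub_self]
  | tb m => cases s <;> simp [pot, geDeg_hA_tb v _ m n (by omega)]
  | s k =>
    cases s with
    | plus => simp [pot, geDeg_hA_s_plus v k n (by omega)]
    | minus => rw [coeff_hA_s_minus, if_pos hn', sub_self]

/-- The first relation, `Y² = 4 γ lam²`, which for a trace free matrix prescribes the
determinant. -/
def RelDet (γ : ℂ) : Prop := hY v * hY v = monomial 2 (algebraMap ℂ _ (4 * γ))

/-- The second relation: the lifts of `S` and `Y` commute. -/
def RelLift : Prop := hS v * hY v - hY v * hS v = hY v - eul (hY v)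

end Splitting

/-! ### The flows preserve the shape of the fields -/

section Identities

variable {N K : ℕ} {R : Type*} [CommRing R] [Algebra ℂ R] {v : Gen N → R} {s : Sgn}

/-- The untruncated components commute with the lift of `Y`. -/
theorem pot_bracket_Y (hv : RelLift v) (i : Idx N K) :
    pot v s i * hY v - hY v * pot v s i +
      potCoef s i • sh (vdeg s i) (eul (hY v) - hY v) = 0 := by
  have hS' : hS v * hY v = hY v * hS v + (hY v - eul (hY v)) := by rw [← hv]; abel
  cases i <;> cases s <;>
    simp [pot, potCoef, vdeg, sh_mul, mul_sh, Sgn.val, hS']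

/-- In the equation for `Y` a component of the Maurer-Cartan form may be replaced by its part of
nonnegative degree. -/
theorem rhsY_eq (hv : RelLift v) (i : Idx N K) :
    rhsY v s i = -(rest v s i * hY v - hY v * rest v s i)
      - restCoef s i • sh (vdeg s i) (eul (hY v) - hY v) := by
  have h := pot_bracket_Y (s := s) hv i
  rw [rhsY, hA_eq, vcoef_eq, ← sub_eq_zero, ← neg_eq_zero, ← h]
  simp only [add_mul, mul_add]
  module

theorem vdeg_nonneg {i : Idx N K} (h : restCoef s i ≠ 0) : 2 * (K : ℤ) ≤ vdeg s i := by
  cases i <;> cases s <;> simp [restCoef] at h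
  rename_i k
  have := k.2
  simp [vdeg, Sgn.val]
  omega

theorem geDeg_restCoef_smul {x : LaurentLoop R} {d : ℤ} {i : Idx N K}
    (h : restCoef s i ≠ 0 → GeDeg d x) : GeDeg d (restCoef s i • x) := by
  by_cases hr : restCoef s i = 0
  · rw [hr, zero_smul]
    exact geDeg_zero _
  · exact (h hr).zsmul _

theorem geDeg_rhsY (hv : RelLift v) (i : Idx N K) : GeDeg 1 (rhsY v s i) := by
  rw [rhsY_eq hv]
  refine (GeDeg.sub ?_ ?_).neg.sub (geDeg_restCoef_smul fun h => ?_)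
  · exact (geDeg_rest v s i).mul (geDeg_hY v)
  · exact (geDeg_hY v).mul (geDeg_rest v s i)
  · exact ((geDeg_hY v).eul.sub (geDeg_hY v)).sh _ (by have := vdeg_nonneg h; omega)

/-- The derivative of `timeSer` along the `i`-th flow, times `x`. -/
def timeDer (i : Idx N K) (x : LaurentLoop R) : LaurentLoop R :=
  match i with
  | .t m => algebraMap ℂ R (Complex.I / 2 * (2 * (m : ℂ) + 1)) • sh (-(2 * (m : ℤ) + 2)) x
  | _ => 0

variable (v s) in
/-- The right hand side of the equation for the dressed field `S - timeSer * Y`. -/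
def rhsD (i : Idx N K) : LaurentLoop R :=
  rhsS v s i - timeDer i (hY v) - timeMul v (rhsY v s i)

theorem eul_timeMul (x : LaurentLoop R) : eul (timeMul v x) = timeMul v (eul x) -
    ∑ m : Fin (N + 1), (2 * (m : ℤ) + 2) • timeCoef v m • sh (-(2 * (m : ℤ) + 2)) x := by
  simp only [timeMul_apply, map_sum, eul_smul, eul_sh, ← Finset.sum_sub_distrib]
  exact Finset.sum_congr rfl fun m _ => by module

theorem timeCoef_pot (m : Fin (N + 1)) :
    algebraMap ℂ R (Complex.I / 2 * (2 * (m : ℂ) + 1)) =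
      -(2 * (m : ℤ) + 1) • algebraMap ℂ R (1 / (2 * Complex.I)) := by
  rw [← map_zsmul]
  congr 1
  have : Complex.I ≠ 0 := Complex.I_ne_zero
  push_cast [zsmul_eq_mul]
  field_simp
  rw [Complex.I_sq]
  ring

/-- In the equation for the dressed field, too, only the parts of nonnegative degree of the
Maurer-Cartan form occur, apart from the last sum, which comes from the derivation part of the
positive Virasoro generators acting on the times. -/
theorem rhsD_eq (hv : RelLift v) (i : Idx N K) :
    rhsD v s i = -(rest v s i * hD v - hD v * rest v s i) + eul (rest v s i)
      - restCoef s i • sh (vdeg s i) (eul (hD v) + vdeg s i • hD v)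
      - restCoef s i • ∑ m : Fin (N + 1), (vdeg s i - (2 * m + 1)) • timeCoef v m •
          sh (vdeg s i - (2 * m + 2)) (hY v) := by
  -- the part of the identity which involves the untruncated form
  have hpot : -(pot v s i * hD v - hD v * pot v s i) + eul (pot v s i)
      - potCoef s i • sh (vdeg s i) (eul (hS v) + vdeg s i • hS v)
      + potCoef s i • sh (vdeg s i) (timeMul v (eul (hY v) - hY v)) - timeDer i (hY v) = 0 := by
    have hD' : hD v = hS v - timeMul v (hY v) := by rw [hS_eq]; abel
    have hY' : eul (hY v) = hY v - (hS v * hY v - hY v * hS v) := by rw [hv]; abel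
    cases i with
    | rho => cases s <;> simp [pot, potCoef, timeDer]
    | tb m => cases s <;> simp [pot, potCoef, timeDer]
    | t m =>
      have e : pot v s (.t m : Idx N K) =
        algebraMap ℂ R (1 / (2 * Complex.I)) • sh (-(2 * (m : ℤ) + 2)) (hY v) := by
        cases s <;> rfl
      have e' : potCoef s (.t m : Idx N K) = 0 := by cases s <;> rfl
      simp only [e, e', zero_smul, sub_zero, add_zero, timeDer, timeCoef_pot, hD', mul_sub, sub_mul,
        smul_mul_assoc, mul_smul_comm, sh_mul, mul_sh, mul_timeMul, timeMul_mul, eul_smul, eul_sh]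
      rw [hY']
      simp only [map_sub, sh_timeMul]
      generalize ((m : ℕ) : ℤ) = q
      module
    | s k =>
      cases s with
      | plus => simp [pot, potCoef, timeDer]
      | minus =>
        simp only [pot, potCoef, timeDer, hD', mul_sub, sub_mul, sh_mul, mul_sh, mul_timeMul,
          timeMul_mul, eul_sh, one_smul, vdeg, Sgn.val]
        rw [hY']
        simp only [map_sub, map_add, map_zsmul, neg_mul, one_mul, sh_timeMul]
        module
  have hsum : sh (vdeg s i) (eul (timeMul v (hY v)) + vdeg s i • timeMul v (hY v)
      - timeMul v (eul (hY v) - hY v)) = ∑ m : Fin (N + 1),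
      (vdeg s i - (2 * m + 1)) • timeCoef v m • sh (vdeg s i - (2 * m + 2)) (hY v) := by
    rw [eul_timeMul, map_sub (timeMul v)]
    simp only [timeMul_apply, ← Finset.sum_sub_distrib, map_sub, map_add, map_zsmul, map_sum,
      sh_smul, sh_sh, Finset.smul_sum, ← Finset.sum_add_distrib]
    refine Finset.sum_congr rfl fun m _ => ?_
    rw [← sub_eq_add_neg]
    module
  rw [← hsum]
  rw [← sub_eq_zero, ← hpot]
  simp only [rhsD, rhsS, rhsY, hA_eq, vcoef_eq]
  rw [hS_eq]
  simp only [map_sub, map_add, map_neg, map_zsmul, mul_add, add_mul, mul_timeMul, timeMul_mul,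
    sh_timeMul]
  module

/-- The flows preserve the dressed shape.  The lowest degree of the terms which involve the times is
`2 k - 2 N - 1`, where `k ≥ K` is the index of the generator: it is positive exactly because of the
cut-off. -/
theorem geDeg_rhsD (hK : N + 1 ≤ K) (hv : RelLift v) (i : Idx N K) : GeDeg 1 (rhsD v s i) := by
  have hsum : ∀ x : Fin (N + 1) → LaurentLoop R, (∀ m, GeDeg 1 (x m)) →
      GeDeg 1 (∑ m, x m) := fun x hx n hn => by
    rw [coeff_sum]
    exact Finset.sum_eq_zero fun m _ => hx m n hn
  rw [rhsD_eq hv]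
  refine (((GeDeg.sub ?_ ?_).neg.add ?_).sub (geDeg_restCoef_smul fun h => ?_)).sub
    (geDeg_restCoef_smul fun h => hsum _ fun m => ?_)
  · exact (geDeg_rest v s i).mul (geDeg_hD v)
  · exact (geDeg_hD v).mul (geDeg_rest v s i)
  · intro n hn
    rcases (show n ≤ 0 by omega).lt_or_eq with h | rfl
    · exact (geDeg_rest v s i).eul n h
    · simp
  · exact ((geDeg_hD v).eul.add ((geDeg_hD v).zsmul _)).sh _ (by have := vdeg_nonneg h; omega)
  · refine (((geDeg_hY v).sh _ ?_).smul _).zsmul _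
    have := vdeg_nonneg h
    have := m.2
    omega

end Identities

/-! ### Structure constants and curvature -/

section Structure

variable {N K : ℕ}

/-- The index of the Virasoro generator in the bracket of two coframe directions (a dummy value
unless both directions are Virasoro). -/
def ell : Idx N K → Idx N K → Idx N K
  | .s a, .s b => .s ⟨a + b, le_trans a.2 (Nat.le_add_right _ _)⟩
  | _, _ => .rho

/-- The structure constants of the Virasoro part of the coframe. -/
def mu : Idx N K → Idx N K → ℤ
  | .s a, .s b => 2 * ((b : ℕ) : ℤ) - 2 * ((a : ℕ) : ℤ)
  | _, _ => 0

theorem mu_swap (i j : Idx N K) : mu j i = -mu i j := by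
  cases i <;> cases j <;> simp [mu]

theorem ell_comm (i j : Idx N K) : ell i j = ell j i := by
  cases i <;> cases j <;> simp [ell, add_comm]

/-- The Jacobi identity of the Virasoro algebra. -/
theorem mu_jacobi_smul {M : Type*} [AddCommGroup M] (w : Idx N K → M) (i j k : Idx N K) :
    (mu i j * mu (ell i j) k) • w (ell (ell i j) k)
      + (mu j k * mu (ell j k) i) • w (ell (ell j k) i)
      + (mu k i * mu (ell k i) j) • w (ell (ell k i) j) = 0 := by
  cases i <;> cases j <;> cases k <;> simp [mu, ell, -zsmul_eq_mul]
  rename_i a b c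
  rw [show (⟨b + c + a, le_trans (le_trans b.2 (Nat.le_add_right _ _)) (Nat.le_add_right _ _)⟩ :
      {k : ℕ // K ≤ k}) = ⟨a + b + c, le_trans (le_trans a.2 (Nat.le_add_right _ _))
        (Nat.le_add_right _ _)⟩ from Subtype.ext (by simp only []; omega),
    show (⟨c + a + b, le_trans (le_trans c.2 (Nat.le_add_right _ _)) (Nat.le_add_right _ _)⟩ :
      {k : ℕ // K ≤ k}) = ⟨a + b + c, le_trans (le_trans a.2 (Nat.le_add_right _ _))
        (Nat.le_add_right _ _)⟩ from Subtype.ext (by simp only []; omega), ← add_smul, ← add_smul]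
  convert zero_smul ℤ _
  ring

/-- The derivation parts of the Maurer-Cartan form satisfy the Virasoro relations. -/
theorem vcoef_relation (s : Sgn) (i j : Idx N K) :
    mu i j * vcoef s (ell i j) = vcoef s i * vcoef s j * (vdeg s i - vdeg s j) ∧
      (mu i j ≠ 0 → vdeg s (ell i j) = vdeg s i + vdeg s j) := by
  refine ⟨?_, fun h => ?_⟩
  · cases i <;> cases j <;> cases s <;> simp [mu, ell, vcoef, vdeg, Sgn.val]
    ring
  · cases i <;> cases j <;> simp only [mu, ne_eq, not_true_eq_false] at h
    simp only [ell, vdeg, Nat.cast_add]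
    ring

variable {R : Type*} [CommRing R] [Algebra ℂ R] (v : Gen N → R) (s : Sgn)

theorem mu_vcoef_smul_sh (i j : Idx N K) (x : LaurentLoop R) :
    mu i j • vcoef s (ell i j) • sh (vdeg s (ell i j)) x =
      (vcoef s i * vcoef s j * (vdeg s i - vdeg s j)) • sh (vdeg s i + vdeg s j) x := by
  obtain ⟨h1, h2⟩ := vcoef_relation s i j
  by_cases h : mu i j = 0
  · rw [← h1, h]
    simp
  · rw [h2 h, smul_smul, h1]

/-- The commutator of the loop parts of two components, as elements of the affine algebra. -/
def loopComm (i j : Idx N K) : LaurentLoop R :=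
  hA v s i * hA v s j - hA v s j * hA v s i + vcoef s i • sh (vdeg s i) (eul (hA v s j))
    - vcoef s j • sh (vdeg s j) (eul (hA v s i))

/-- The loop part of the curvature, for the structure functions given by `mu` and by `κ`. -/
def loopCurv (D : Idx N K → Derivation ℂ R R) (κ : Idx N K → Idx N K → R) (i j : Idx N K) :
    LaurentLoop R :=
  dC (D i) (hA v s j) - dC (D j) (hA v s i) + (κ i j • hA v s (.rho : Idx N K)
    + mu i j • hA v s (ell i j)) + loopComm v s i j

end Structure

/-! ### The curvature in negative degrees -/

section Curvature

variable {N K : ℕ} {R : Type*} [CommRing R] [Algebra ℂ R] {v : Gen N → R} {s : Sgn}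

/-- The multiplier in the derivative of the untruncated component of the second index along the flow
of the first index. -/
def potWeight (s : Sgn) (i : Idx N K) : Idx N K → ℤ
  | .t m => 2 * (m : ℤ) + 1
  | .s k => vdeg s i - vdeg s (.s k : Idx N K)
  | _ => 0

/-- In the affine algebra, that is, including the derivation parts in the bracket, the untruncated
components are covariantly constant up to a multiple of themselves. -/
theorem dC_pot {D : Idx N K → Derivation ℂ R R} (hD : KillingHalf v s D) (i j : Idx N K) :
    dC (D i) (pot v s j) = -(hA v s i * pot v s j - pot v s j * hA v s i)
      - vcoef s i • sh (vdeg s i) (eul (pot v s j)) + potCoef s j • sh (vdeg s j) (eul (hA v s i))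
      - (vcoef s i * potWeight s i j) • sh (vdeg s i) (pot v s j) := by
  cases j with
  | rho => cases s <;> simp [pot, potCoef]
  | tb m => cases s <;> simp [pot, potCoef]
  | t m =>
    have e : pot v s (.t m : Idx N K) =
      algebraMap ℂ R (1 / (2 * Complex.I)) • sh (-(2 * (m : ℤ) + 2)) (hY v) := by
      cases s <;> rfl
    have e' : potCoef s (.t m : Idx N K) = 0 := by cases s <;> rfl
    rw [e, e', dC_smul, Derivation.map_algebraMap, dC_sh, hD.eqY, rhsY]
    simp only [zero_smul, smul_mul_assoc, mul_smul_comm, sh_mul, mul_sh, eul_smul, eul_sh,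
      sh_smul, map_sub, map_neg, map_add, map_zsmul, sh_sh, potWeight]
    rw [add_comm (vdeg s i)]
    generalize ((m : ℕ) : ℤ) = q
    module
  | s k =>
    cases s with
    | plus => simp [pot, potCoef]
    | minus =>
      simp only [pot, potCoef, dC_sh, hD.eqS, rhsS]
      simp only [one_smul, sh_mul, mul_sh, eul_sh, map_sub, map_neg, map_add, map_zsmul, sh_sh,
        potWeight]
      rw [add_comm (vdeg Sgn.minus i)]
      simp only [show vdeg Sgn.minus (.s k : Idx N K) = -(2 * ((k : ℕ) : ℤ)) by
        simp [vdeg, Sgn.val]]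
      generalize ((k : ℕ) : ℤ) = q
      module

/-- The terms of the curvature which involve only untruncated components have no part of negative
degree.  They cancel completely, except that for the positive type the generator of index `k` adds a
multiple of `lam ^ (2 k - 2 m - 2) Y` to the component of `t m`, which is harmless for `k > m`. -/
theorem geDeg_defect (hK : N + 1 ≤ K) (hv : RelLift v) (i j : Idx N K) :
    GeDeg 0 (mu i j • pot v s (ell i j) - (pot v s i * pot v s j - pot v s j * pot v s i
      + potCoef s i • sh (vdeg s i) (eul (pot v s j))
      - potCoef s j • sh (vdeg s j) (eul (pot v s i)))
      - (vcoef s i * potWeight s i j) • sh (vdeg s i) (pot v s j)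
      + (vcoef s j * potWeight s j i) • sh (vdeg s j) (pot v s i)) := by
  have hS' : eul (hY v) = hY v - (hS v * hY v - hY v * hS v) := by rw [hv]; abel
  have et : ∀ m, pot v s (.t m : Idx N K) =
      algebraMap ℂ R (1 / (2 * Complex.I)) • sh (-(2 * (m : ℤ) + 2)) (hY v) := fun m => by
    cases s <;> rfl
  have et' : ∀ m, potCoef s (.t m : Idx N K) = 0 := fun m => by cases s <;> rfl
  have er : pot v s (.rho : Idx N K) = 0 := by cases s <;> rfl
  have er' : potCoef s (.rho : Idx N K) = 0 := by cases s <;> rfl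
  have eb : ∀ m, pot v s (.tb m : Idx N K) = 0 := fun m => by cases s <;> rfl
  have eb' : ∀ m, potCoef s (.tb m : Idx N K) = 0 := fun m => by cases s <;> rfl
  have key : ∀ (m : Fin (N + 1)) (k : {k : ℕ // K ≤ k}),
      GeDeg 0 (mu (.t m : Idx N K) (.s k) • pot v s (ell (.t m : Idx N K) (.s k)) -
        (pot v s (.t m : Idx N K) * pot v s (.s k : Idx N K)
        - pot v s (.s k : Idx N K) * pot v s (.t m : Idx N K)
        + potCoef s (.t m : Idx N K) • sh (vdeg s (.t m : Idx N K)) (eul (pot v s (.s k : Idx N K)))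
        - potCoef s (.s k : Idx N K) •
          sh (vdeg s (.s k : Idx N K)) (eul (pot v s (.t m : Idx N K))))
        - (vcoef s (.t m : Idx N K) * potWeight s (.t m : Idx N K) (.s k)) •
          sh (vdeg s (.t m : Idx N K)) (pot v s (.s k : Idx N K))
        + (vcoef s (.s k : Idx N K) * potWeight s (.s k : Idx N K) (.t m)) •
          sh (vdeg s (.s k : Idx N K)) (pot v s (.t m : Idx N K))) := fun m k => by
    have hm := m.2
    have hk := k.2
    cases s with
    | plus =>
      rw [et]
      simp only [mu, ell, vcoef, potWeight, pot, potCoef, vdeg, zero_smul, smul_zero, map_zero,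
        mul_zero, zero_mul, sub_zero, add_zero, zero_add, Sgn.val]
      exact ((((geDeg_hY v).sh _ le_rfl).smul _).sh _ (by omega)).zsmul _
    | minus =>
      rw [et, et']
      simp only [mu, ell, vcoef, potWeight, pot, potCoef, vdeg, zero_smul, zero_mul, sub_zero,
        Sgn.val, smul_mul_assoc, mul_smul_comm, sh_mul, mul_sh, eul_smul, eul_sh, sh_smul, one_smul]
      rw [hS']
      simp only [map_sub, map_add, map_zsmul, sh_sh, neg_mul, one_mul, neg_neg]
      rw [add_comm (-(2 * ((k : ℕ) : ℤ)))]
      convert geDeg_zero 0 using 1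
      generalize ((m : ℕ) : ℤ) = q
      generalize ((k : ℕ) : ℤ) = p
      module
  cases i with
  | rho => simpa [er, er', mu, ell, vcoef, -zsmul_eq_mul] using geDeg_zero 0
  | tb m => simpa [er, eb, eb', mu, ell, vcoef, -zsmul_eq_mul] using geDeg_zero 0
  | t m =>
    cases j with
    | rho => simpa [er, er', et', mu, ell, vcoef, -zsmul_eq_mul] using geDeg_zero 0
    | tb m' => simpa [er, eb, eb', et', mu, ell, vcoef, -zsmul_eq_mul] using geDeg_zero 0
    | t m' =>
      convert geDeg_zero 0 using 1
      simp only [et, et', er, mu, ell, vcoef, zero_smul, smul_mul_assoc, mul_smul_comm,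
        sh_mul, mul_sh, zero_mul, sh_sh, smul_zero]
      rw [add_comm (-(2 * ((m : ℕ) : ℤ) + 2))]
      module
    | s k => exact key m k
  | s k =>
    cases j with
    | rho => simpa [er, er', mu, ell, vcoef, potWeight, -zsmul_eq_mul] using geDeg_zero 0
    | tb m => simpa [er, eb, eb', mu, ell, vcoef, potWeight, -zsmul_eq_mul] using geDeg_zero 0
    | t m =>
      convert (key m k).neg using 1
      rw [mu_swap, ell_comm]
      module
    | s l =>
      convert geDeg_zero 0 using 1
      cases s with
      | plus => simp [pot, potCoef, ell]
      | minus =>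
        simp only [mu, ell, vcoef, potWeight, pot, potCoef, vdeg, Sgn.val, sh_mul, mul_sh, sh_sh,
          eul_sh, map_add, map_zsmul, one_smul, neg_mul, one_mul, neg_neg, Nat.cast_add]
        rw [add_comm (-(2 * ((k : ℕ) : ℤ)))]
        simp only [show -(2 * (((k : ℕ) : ℤ) + ((l : ℕ) : ℤ))) =
          -(2 * ((l : ℕ) : ℤ)) + -(2 * ((k : ℕ) : ℤ)) by ring]
        generalize ((l : ℕ) : ℤ) = q
        generalize ((k : ℕ) : ℤ) = p
        module

/-- The negative part of the zero curvature equation.  The untruncated components are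
covariantly constant up to multiples of themselves, so that the curvature is built from the parts
of nonnegative degree alone. -/
theorem geDeg_loopCurv (hK : N + 1 ≤ K) (hv : RelLift v) {D : Idx N K → Derivation ℂ R R}
    (hD : KillingHalf v s D) (κ : Idx N K → Idx N K → R) (i j : Idx N K) :
    GeDeg 0 (loopCurv v s D κ i j) := by
  have e : loopCurv v s D κ i j =
      (rest v s i * rest v s j - rest v s j * rest v s i) + dC (D i) (rest v s j)
        - dC (D j) (rest v s i) + restCoef s i • sh (vdeg s i) (eul (rest v s j))
        - restCoef s j • sh (vdeg s j) (eul (rest v s i)) + κ i j • hA v s (.rho : Idx N K)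
        + mu i j • rest v s (ell i j) +
      (mu i j • pot v s (ell i j) - (pot v s i * pot v s j - pot v s j * pot v s i
      + potCoef s i • sh (vdeg s i) (eul (pot v s j))
      - potCoef s j • sh (vdeg s j) (eul (pot v s i)))
      - (vcoef s i * potWeight s i j) • sh (vdeg s i) (pot v s j)
      + (vcoef s j * potWeight s j i) • sh (vdeg s j) (pot v s i)) := by
    rw [loopCurv, loopComm, hA_eq v s i, hA_eq v s j, hA_eq v s (ell i j), map_add (dC (D i)),
      map_add (dC (D j)), dC_pot hD, dC_pot hD, hA_eq v s i, hA_eq v s j]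
    simp only [vcoef_eq, mul_add, add_mul, map_add]
    module
  have hr := fun i : Idx N K => geDeg_rest v s i
  rw [e]
  refine (((((((((hr i).mul (hr j)).sub ((hr j).mul (hr i))).add ((hr j).dC _)).sub
    ((hr i).dC _)).add (geDeg_restCoef_smul fun h => ?_)).sub
    (geDeg_restCoef_smul fun h => ?_)).add ((geDeg_hA_rho v s).smul _)).add
    ((hr _).zsmul _)).add (geDeg_defect hK hv i j)
  · exact (hr j).eul.sh _ (by have := vdeg_nonneg h; omega)
  · exact (hr i).eul.sh _ (by have := vdeg_nonneg h; omega)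

end Curvature

/-! ### Commutators of flows on the Killing fields, and the Bianchi identity -/

section Commutators

variable {N K : ℕ} {R : Type*} [CommRing R] [Algebra ℂ R] {v : Gen N → R} {s : Sgn}
  {D : Idx N K → Derivation ℂ R R} {κ : Idx N K → Idx N K → R}

variable (s) in
theorem mu_vcoef_smul_sh_vdeg (i j : Idx N K) (x : LaurentLoop R) :
    mu i j • vcoef s (ell i j) • vdeg s (ell i j) • sh (vdeg s (ell i j)) x =
      (vcoef s i * vcoef s j * (vdeg s i - vdeg s j) * (vdeg s i + vdeg s j)) •
        sh (vdeg s i + vdeg s j) x := by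
  obtain ⟨h1, h2⟩ := vcoef_relation s i j
  by_cases h : mu i j = 0
  · rw [← h1, h]
    simp
  · rw [h2 h, smul_smul, smul_smul, h1]

theorem dC_hA_swap (hM : ∀ i j, loopCurv v s D κ i j = 0) (i j : Idx N K) :
    dC (D i) (hA v s j) = dC (D j) (hA v s i) - (κ i j • hA v s (.rho : Idx N K)
      + mu i j • hA v s (ell i j)) - loopComm v s i j := by
  have := hM i j
  rw [loopCurv] at this
  rw [← sub_eq_zero, ← this]
  abel

/-- The Maurer-Cartan equation makes the flows close under commutators on `Y`. -/
theorem comm_hY (hD : KillingHalf v s D) (hM : ∀ i j, loopCurv v s D κ i j = 0) (i j : Idx N K) :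
    dC (D i) (dC (D j) (hY v)) - dC (D j) (dC (D i) (hY v)) =
      -(κ i j • dC (D .rho) (hY v) + mu i j • dC (D (ell i j)) (hY v)) := by
  have hφ : vcoef s (.rho : Idx N K) = 0 := rfl
  simp only [hD.eqY]
  simp only [rhsY, map_sub, map_neg, map_zsmul, dC_mul, dC_sh, dC_eul, hD.eqY, hφ, zero_smul]
  rw [dC_hA_swap hM i j]
  simp only [loopComm, map_add, map_zsmul, eul_mul, eul_sh, sh_mul, mul_sh,
    mul_add, add_mul, mul_sub, sub_mul, smul_mul_assoc, mul_smul_comm, neg_mul, mul_neg, mul_assoc,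
    smul_add, smul_sub, smul_neg]
  simp only [sh_sh, mu_vcoef_smul_sh]
  rw [add_comm (vdeg s j) (vdeg s i)]
  module

/-- The Maurer-Cartan equation makes the flows close under commutators on `S`. -/
theorem comm_hS (hD : KillingHalf v s D) (hM : ∀ i j, loopCurv v s D κ i j = 0) (i j : Idx N K) :
    dC (D i) (dC (D j) (hS v)) - dC (D j) (dC (D i) (hS v)) =
      -(κ i j • dC (D .rho) (hS v) + mu i j • dC (D (ell i j)) (hS v)) := by
  have hφ : vcoef s (.rho : Idx N K) = 0 := rfl
  simp only [hD.eqS]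
  simp only [rhsS, map_sub, map_add, map_neg, map_zsmul, dC_mul, dC_sh, dC_eul, hD.eqS, hφ,
    zero_smul]
  rw [dC_hA_swap hM i j]
  simp only [loopComm, map_sub, map_add, map_zsmul, eul_mul, eul_sh, sh_mul, mul_sh,
    mul_add, add_mul, mul_sub, sub_mul, smul_mul_assoc, mul_smul_comm, neg_mul, mul_neg, mul_assoc,
    smul_add, smul_sub, smul_neg, eul_smul]
  simp only [sh_sh, mu_vcoef_smul_sh, mu_vcoef_smul_sh_vdeg]
  rw [add_comm (vdeg s j) (vdeg s i)]
  module

theorem coeff_hA_rho (n : ℤ) : (hA v s (.rho : Idx N K)).coeff n =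
    if n = 0 then !![algebraMap ℂ R (Complex.I / 2), 0; 0, -algebraMap ℂ R (Complex.I / 2)]
      else 0 := by
  by_cases h : n = 0
  · subst h
    simp [hA, extPhi, rotLoop]
  · simp [hA, extPhi, rotLoop, h]

theorem coeff_zero_hA {i : Idx N K} (hi : i ≠ .rho) : (hA v s i).coeff 0 = 0 := by
  cases i with
  | rho => exact absurd rfl hi
  | t m => rw [coeff_hA_t, if_neg (by omega)]
  | tb m => exact geDeg_hA_tb v s m 0 (by omega)
  | s k =>
    cases s with
    | plus => exact geDeg_hA_s_plus v k 0 (by omega)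
    | minus => rw [coeff_hA_s_minus, if_neg (by omega)]

theorem eul_hA_rho : eul (hA v s (.rho : Idx N K)) = 0 := by
  ext n : 1
  rw [coeff_eul, coeff_hA_rho]
  split_ifs with h <;> simp [h]

theorem hA_rho_eq_monomial : hA v s (.rho : Idx N K) = monomial 0
    !![algebraMap ℂ R (Complex.I / 2), 0; 0, -algebraMap ℂ R (Complex.I / 2)] := by
  ext n : 1
  rw [coeff_hA_rho, coeff_monomial]

theorem coeff_zero_loopCurv (i j : Idx N K) : (loopCurv v s D κ i j).coeff 0 =
    κ i j • !![algebraMap ℂ R (Complex.I / 2), 0; 0, -algebraMap ℂ R (Complex.I / 2)] +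
      (loopComm v s i j).coeff 0 := by
  have h1 : ∀ i j : Idx N K, (dC (D i) (hA v s j)).coeff 0 = 0 := fun i j => by
    by_cases h : j = .rho
    · rw [h]
      ext a b
      rw [coeff_dC, coeff_hA_rho, if_pos rfl]
      fin_cases a <;> fin_cases b <;> simp
    · ext a b
      rw [coeff_dC, coeff_zero_hA h]
      simp
  have h2 : mu i j • (hA v s (ell i j)).coeff 0 = 0 := by
    cases i <;> cases j <;> simp only [mu, zero_smul]
    rw [coeff_zero_hA (by simp [ell]), smul_zero]
  simp only [loopCurv, coeff_add, coeff_sub, coeff_smul, coeff_zsmul, h1, h2, coeff_hA_rho, if_true]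
  abel

theorem smul_rot_eq_zero {r : R} (h : r • !![algebraMap ℂ R (Complex.I / 2), 0;
    0, -algebraMap ℂ R (Complex.I / 2)] = 0) : r = 0 := by
  have h0 : r * algebraMap ℂ R (Complex.I / 2) = 0 := by simpa using congrFun (congrFun h 0) 0
  have : algebraMap ℂ R (Complex.I / 2) * algebraMap ℂ R (2 / Complex.I) = 1 := by
    rw [← map_mul, ← map_one (algebraMap ℂ R)]
    congr 1
    field_simp [Complex.I_ne_zero]
  rw [← mul_one r, ← this, ← mul_assoc, h0, zero_mul]

theorem coeff_zero_loopComm_rho (k : Idx N K) :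
    (loopComm v s (.rho : Idx N K) k).coeff 0 = 0 := by
  have hφ : vcoef s (.rho : Idx N K) = 0 := rfl
  have e : ∀ x : LaurentLoop R,
      (hA v s (.rho : Idx N K) * x - x * hA v s (.rho : Idx N K)).coeff 0 =
      !![algebraMap ℂ R (Complex.I / 2), 0; 0, -algebraMap ℂ R (Complex.I / 2)] * x.coeff 0
      - x.coeff 0 * !![algebraMap ℂ R (Complex.I / 2), 0; 0, -algebraMap ℂ R (Complex.I / 2)] := by
    intro x
    rw [hA_rho_eq_monomial, coeff_sub, coeff_mul_eq_finsum, coeff_mul_eq_finsum']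
    rw [finsum_eq_single _ 0 fun m hm => by rw [coeff_monomial, if_neg hm, zero_mul],
      finsum_eq_single _ 0 fun m hm => by rw [coeff_monomial, if_neg hm, mul_zero]]
    simp [coeff_monomial]
  rw [loopComm, eul_hA_rho, hφ, zero_smul, add_zero, map_zero, smul_zero, sub_zero, e]
  by_cases h : k = .rho
  · subst h
    rw [coeff_hA_rho, if_pos rfl, sub_self]
  · rw [coeff_zero_hA h, mul_zero, zero_mul, sub_self]

/-- The connection form does not occur in its own differential. -/
theorem kappa_rho (hM : ∀ i j, loopCurv v s D κ i j = 0) (k : Idx N K) : κ .rho k = 0 := by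
  have h := coeff_zero_loopCurv (v := v) (s := s) (D := D) (κ := κ) .rho k
  rw [hM, coeff_zero, coeff_zero_loopComm_rho, add_zero] at h
  exact smul_rot_eq_zero h.symm

/-- The Bianchi identity for the loop part of the bracket of the Maurer-Cartan form with itself. -/
theorem bianchi_loopComm (hM : ∀ i j, loopCurv v s D κ i j = 0) (i j k : Idx N K) :
    (dC (D i) (loopComm v s j k) + dC (D j) (loopComm v s k i) + dC (D k) (loopComm v s i j))
      + (κ i j • loopComm v s .rho k + mu i j • loopComm v s (ell i j) k)
      + (κ j k • loopComm v s .rho i + mu j k • loopComm v s (ell j k) i)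
      + (κ k i • loopComm v s .rho j + mu k i • loopComm v s (ell k i) j) = 0 := by
  have hφ : vcoef s (.rho : Idx N K) = 0 := rfl
  simp only [loopComm, map_sub, map_add, map_zsmul, dC_mul, dC_sh, dC_eul, hφ, zero_smul,
    eul_hA_rho]
  rw [dC_hA_swap hM i j, dC_hA_swap hM j k, dC_hA_swap hM k i]
  simp only [loopComm, map_sub, map_add, map_zsmul, eul_mul, eul_sh, sh_mul, mul_sh,
    mul_add, add_mul, mul_sub, sub_mul, smul_mul_assoc, mul_smul_comm, mul_assoc,
    smul_add, smul_sub, eul_smul, eul_hA_rho, map_zero, smul_zero]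
  simp only [sh_sh, mu_vcoef_smul_sh]
  rw [add_comm (vdeg s j) (vdeg s i), add_comm (vdeg s k) (vdeg s i),
    add_comm (vdeg s k) (vdeg s j)]
  module

end Commutators

/-! ### Derivations are determined by their values on the fields -/

section Generators

variable {N K : ℕ} {R : Type*} [CommRing R] [Algebra ℂ R] {v : Gen N → R} {s : Sgn}

theorem evenSer_apply (f : ℕ → R) (n : ℕ) : evenSer f (2 * n + 2) = f n := by
  have h : (2 : ℤ) ≤ 2 * n + 2 ∧ Even (2 * (n : ℤ) + 2) := ⟨by omega, ⟨n + 1, by ring⟩⟩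
  rw [evenSer, if_pos h]
  congr 1
  omega

theorem oddSer_apply (f : ℕ → R) (n : ℕ) : oddSer f (2 * n + 1) = f n := by
  have h : (1 : ℤ) ≤ 2 * n + 1 ∧ Odd (2 * (n : ℤ) + 1) := ⟨by omega, ⟨n, by ring⟩⟩
  rw [oddSer, if_pos h]
  congr 1
  omega

theorem isUnit_two : IsUnit (2 : R) := by
  have : (2 : R) = algebraMap ℂ R 2 := (map_ofNat _ 2).symm
  rw [this]
  exact (IsUnit.mk0 (2 : ℂ) two_ne_zero).map _

theorem I_smul_injective : Function.Injective fun x : R => Complex.I • x := fun x y h => by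
  have h' : Complex.I • x = Complex.I • y := h
  have := congrArg (fun z : R => (-Complex.I) • z) h'
  simpa only [smul_smul, neg_mul, Complex.I_mul_I, neg_neg, one_smul] using this

/-- Two derivations which agree on a loop of standard shape agree on its entries. -/
theorem eq_of_mkLoop_eq {E F : Derivation ℂ R R} {a b c : ℕ → R}
    (h : ∀ n i j, E (mkLoop a b c n i j) = F (mkLoop a b c n i j)) (n : ℕ) :
    E (a n) = F (a n) ∧ E (b n) = F (b n) ∧ E (c n) = F (c n) := by
  refine ⟨?_, ?_, ?_⟩
  · have := h (2 * n + 2) 1 1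
    simp only [mkLoop, evenSer_apply, Matrix.of_apply, Matrix.cons_val', Matrix.cons_val_one,
      Matrix.cons_val_fin_one, Derivation.map_smul] at this
    exact I_smul_injective this
  · have := h (2 * n + 1) 1 0
    simp only [mkLoop, oddSer_apply, Matrix.of_apply, Matrix.cons_val', Matrix.cons_val_one,
      Matrix.cons_val_zero, Matrix.cons_val_fin_one] at this
    rw [two_mul, map_add, map_add, ← two_mul, ← two_mul] at this
    exact isUnit_two.mul_left_cancel this
  · have := h (2 * n + 1) 0 1
    simp only [mkLoop, oddSer_apply, Matrix.of_apply, Matrix.cons_val', Matrix.cons_val_one,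
      Matrix.cons_val_zero, Matrix.cons_val_fin_one] at this
    rw [two_mul, map_add, map_add, ← two_mul, ← two_mul] at this
    exact isUnit_two.mul_left_cancel this

theorem dC_timeMul (E : Derivation ℂ R R) (x : LaurentLoop R) :
    dC E (timeMul v x) = (∑ m : Fin (N + 1), E (timeCoef v m) • sh (-(2 * (m : ℤ) + 2)) x)
      + timeMul v (dC E x) := by
  simp only [timeMul_apply, map_sum, dC_smul, dC_sh, Finset.sum_add_distrib]

theorem dC_hD_congr {E F : Derivation ℂ R R} (ht : ∀ m, E (v (.t m)) = F (v (.t m)))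
    (hY' : dC E (hY v) = dC F (hY v)) (hS' : dC E (hS v) = dC F (hS v)) :
    dC E (hD v) = dC F (hD v) := by
  have e : hD v = hS v - timeMul v (hY v) := by rw [hS_eq]; abel
  have et : ∀ m, E (timeCoef v m) = F (timeCoef v m) := fun m => by
    simp only [timeCoef, Derivation.map_smul, ht]
  rw [e, map_sub, map_sub, dC_timeMul, dC_timeMul, hY', hS']
  simp only [et]

/-- The generators without a bar are determined by the series built from them. -/
theorem half_ext {E F : Derivation ℂ R R} (ht : ∀ m, E (v (.t m)) = F (v (.t m)))
    (hY' : dC E (hY v) = dC F (hY v)) (hS' : dC E (hS v) = dC F (hS v)) (n : ℕ) :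
    (E (v (.a n)) = F (v (.a n)) ∧ E (v (.b n)) = F (v (.b n)) ∧ E (v (.c n)) = F (v (.c n))) ∧
    (E (v (.sa n)) = F (v (.sa n)) ∧ E (v (.sb n)) = F (v (.sb n)) ∧
      E (v (.sc n)) = F (v (.sc n))) := by
  have hD' := dC_hD_congr ht hY' hS'
  constructor
  · exact eq_of_mkLoop_eq (a := fun n => v (.a n)) (b := fun n => v (.b n)) (c := fun n => v (.c n))
      (fun n i j => congrFun (congrFun (congrArg (fun x => x.coeff n) hY') i) j) n
  · exact eq_of_mkLoop_eq (a := fun n => v (.sa n)) (b := fun n => v (.sb n))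
      (c := fun n => v (.sc n))
      (fun n i j => congrFun (congrFun (congrArg (fun x => x.coeff n) hD') i) j) n

variable (v s) in
theorem confSer_apply (n : ℕ) : confSer v s (s.val * (2 * n)) = v (.u n) := by
  have hs : s.val * (s.val * (2 * (n : ℤ))) = 2 * n := by cases s <;> simp [Sgn.val]
  have h : 0 ≤ s.val * (s.val * (2 * (n : ℤ))) ∧ Even (s.val * (2 * (n : ℤ))) :=
    ⟨by omega, ⟨s.val * n, by ring⟩⟩
  rw [confSer, if_pos h, hs]
  congr 2
  omega

/-- The flows close under commutators on the conformal factor, by the Virasoro relations for the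
derivation parts of the Maurer-Cartan form. -/
theorem comm_confSer {D : Idx N K → Derivation ℂ R R} (hD : KillingHalf v s D) (i j : Idx N K)
    (n : ℤ) : D i (D j (confSer v s n)) - D j (D i (confSer v s n)) =
      -(mu i j • D (ell i j) (confSer v s n)) := by
  have hl : ∀ (i : Idx N K) (p : ℤ), D i (lamPow R 0 p) = 0 := fun i p => by
    by_cases h : p = 0
    · subst h; simp [lamPow]
    · simp [lamPow, Pi.single_eq_of_ne h]
  have hl' : ∀ (i : Idx N K) (q p : ℤ), D i (lamPow R q p) = 0 := fun i q p => by
    by_cases h : p = q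
    · subst h; simp [lamPow]
    · simp [lamPow, Pi.single_eq_of_ne h]
  have hd : ∀ (i : Idx N K) (p : ℤ), D i (confDot v s K p) = p • rhsU v s i p := fun i p => by
    simp only [confDot, euler, Pi.add_apply, Pi.smul_apply, map_add, Derivation.map_smul_of_tower,
      hl, smul_zero, zero_add, hD.eqU]
  have hll : ∀ a b : ℤ, a • lamPow R b a = b • lamPow R b a := fun a b => by
    by_cases h : a = b
    · rw [h]
    · simp [lamPow, Pi.single_eq_of_ne h]
  have hsub : ∀ a b : ℤ, lamPow R a (n - b) = lamPow R (b + a) n := fun a b => by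
    by_cases h : n - b = a
    · have : n = b + a := by omega
      rw [h, ← this]
      simp [lamPow]
    · have : n ≠ b + a := by omega
      simp [lamPow, Pi.single_eq_of_ne h, Pi.single_eq_of_ne this]
  simp only [hD.eqU]
  have hij : mu i j • rhsU v s (ell i j) n = (vcoef s i * vcoef s j * (vdeg s i - vdeg s j)) •
      ((vdeg s i + vdeg s j) • lamPow R (vdeg s i + vdeg s j) n -
        confDot v s K (n - (vdeg s i + vdeg s j))) := by
    obtain ⟨h1, h2⟩ := vcoef_relation s i j
    by_cases h : mu i j = 0
    · rw [← h1, h]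
      simp
    · rw [rhsU, h2 h, smul_smul, h1]
  rw [hij]
  simp only [rhsU, map_sub, Derivation.map_smul_of_tower, hl', hd, hsub, smul_zero, zero_sub,
    sub_sub]
  rw [add_comm (vdeg s j) (vdeg s i)]
  have := hll n (vdeg s i + vdeg s j)
  have key : ∀ (p q n : ℤ) (φ ψ : ℤ) (x y : R), n • x = (p + q) • x →
      φ • -((n - p) • ψ • (q • x - y)) - ψ • -((n - q) • φ • (p • x - y)) =
      -((ψ * φ * (q - p)) • ((p + q) • x - y)) := fun p q n φ ψ x y h => by
    have h' : ((φ * ψ * (p - q)) • n • x) = (φ * ψ * (p - q)) • (p + q) • x := by rw [h]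
    rw [← sub_eq_zero] at h' ⊢
    rw [← h']
    module
  rw [add_comm (vdeg s i) (vdeg s j)] at this ⊢
  exact key _ _ _ _ _ _ _ this

end Generators

/-! ### The substitution of the inverse spectral parameter -/

section Reflection

/-- The opposite type: the reflection exchanges the positive and the negative Virasoro algebra. -/
def Sgn.opp : Sgn → Sgn
  | .plus => .minus
  | .minus => .plus

/-- The substitution `lam ↦ lam⁻¹`. -/
def reflect {M : Type*} (X : ℤ → M) : ℤ → M := fun n => X (-n)

theorem reflect_reflect {M : Type*} (X : ℤ → M) : reflect (reflect X) = X := by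
  funext n
  simp [reflect]

theorem euler_reflect {M : Type*} [AddCommGroup M] (X : ℤ → M) :
    euler (reflect X) = -reflect (euler X) := by
  funext n
  simp [reflect, euler]

theorem euler_neg {M : Type*} [AddCommGroup M] (X : ℤ → M) : euler (-X) = -euler X := by
  funext n
  simp [euler]

variable {R : Type*} [CommRing R]

theorem serMul_reflect (f g : Ser R) : serMul (reflect f) (reflect g) = reflect (serMul f g) := by
  funext n
  simp only [serMul, reflect]
  rw [← finsum_comp_equiv (Equiv.neg ℤ)]
  refine finsum_congr fun m => ?_
  simp only [Equiv.neg_apply, neg_neg]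
  congr 2
  ring

theorem serSmul_reflect (f : Ser R) (X : Loop R) :
    serSmul (reflect f) (reflect X) = reflect (serSmul f X) := by
  funext n
  simp only [serSmul, reflect]
  rw [← finsum_comp_equiv (Equiv.neg ℤ)]
  refine finsum_congr fun m => ?_
  simp only [Equiv.neg_apply, neg_neg]
  congr 2
  ring

theorem loopBracket_reflect (X Y : Loop R) :
    loopBracket (reflect X) (reflect Y) = reflect (loopBracket X Y) := by
  funext n
  simp only [loopBracket, reflect]
  rw [← finsum_comp_equiv (Equiv.neg ℤ)]
  refine finsum_congr fun m => ?_
  simp only [Equiv.neg_apply, neg_neg]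
  rw [show -(n - -m) = -n - m by ring]

theorem serMul_neg (f g : Ser R) : serMul f (-g) = -serMul f g := by
  funext n
  simp only [serMul, Pi.neg_apply, mul_neg, finsum_neg_distrib]

theorem neg_serMul (f g : Ser R) : serMul (-f) g = -serMul f g := by
  funext n
  simp only [serMul, Pi.neg_apply, neg_mul, finsum_neg_distrib]

theorem serSmul_neg (f : Ser R) (X : Loop R) : serSmul f (-X) = -serSmul f X := by
  funext n
  simp only [serSmul, Pi.neg_apply, smul_neg, finsum_neg_distrib]

theorem neg_serSmul (f : Ser R) (X : Loop R) : serSmul (-f) X = -serSmul f X := by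
  funext n
  simp only [serSmul, Pi.neg_apply, neg_smul, finsum_neg_distrib]

theorem loopBracket_neg (X Y : Loop R) : loopBracket X (-Y) = -loopBracket X Y := by
  funext n
  simp only [loopBracket, Pi.neg_apply, mul_neg, neg_mul, ← finsum_neg_distrib, neg_sub,
    sub_neg_eq_add]
  exact finsum_congr fun m => by abel

/-- The substitution `lam ↦ lam⁻¹` on the affine algebra: it changes the sign of the Euler
derivation. -/
def affReflect (x : Aff R) : Aff R := (-reflect x.1, reflect x.2)

theorem affReflect_injective : Function.Injective (affReflect : Aff R → Aff R) := fun x y h => by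
  have h1 : -reflect x.1 = -reflect y.1 := congrArg Prod.fst h
  have h2 : reflect x.2 = reflect y.2 := congrArg Prod.snd h
  refine Prod.ext ?_ ?_
  · rw [← reflect_reflect x.1, neg_injective h1, reflect_reflect]
  · rw [← reflect_reflect x.2, h2, reflect_reflect]

theorem affReflect_add (x y : Aff R) : affReflect (x + y) = affReflect x + affReflect y :=
  Prod.ext (neg_add (reflect x.1) (reflect y.1)) rfl

theorem affReflect_zero : affReflect (0 : Aff R) = 0 := Prod.ext (neg_zero (G := Ser R)) rfl

/-- The substitution `lam ↦ lam⁻¹` respects the bracket. -/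
theorem affBracket_reflect (x y : Aff R) :
    affBracket (affReflect x) (affReflect y) = affReflect (affBracket x y) := by
  refine Prod.ext ?_ ?_
  · simp only [affBracket, affReflect, euler_neg, euler_reflect, neg_serMul, neg_neg,
      serMul_reflect]
    rw [show reflect (serMul x.1 (euler y.1) - serMul y.1 (euler x.1)) =
      reflect (serMul x.1 (euler y.1)) - reflect (serMul y.1 (euler x.1)) from rfl]
    abel
  · simp only [affBracket, affReflect, euler_reflect, neg_serSmul, serSmul_neg, neg_neg,
      serSmul_reflect, loopBracket_reflect]
    rfl

theorem affBracket_neg (x y : Aff R) : affBracket x (-y) = -affBracket x y := by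
  refine Prod.ext ?_ ?_
  · simp only [affBracket, Prod.fst_neg, euler_neg, neg_serMul, serMul_neg]
    abel
  · simp only [affBracket, Prod.snd_neg, Prod.fst_neg, euler_neg, neg_serSmul, serSmul_neg,
      loopBracket_neg]
    abel

theorem affSmul_reflect (f : Ser R) (x : Aff R) :
    affSmul (reflect f) (affReflect x) = affReflect (affSmul f x) := by
  refine Prod.ext ?_ ?_
  · simp only [affSmul, affReflect, serMul_neg, serMul_reflect]
  · simp only [affSmul, affReflect, serSmul_reflect]

theorem affSmul_neg (f : Ser R) (x : Aff R) : affSmul f (-x) = -affSmul f x :=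
  Prod.ext (serMul_neg _ _) (serSmul_neg _ _)

end Reflection

/-! ### The conjugate equations as equations for the conjugate variables -/

section Conjugation

variable {N K : ℕ} {R : Type*} [CommRing R] [Algebra ℂ R]

/-- The relabelling of the variables which exchanges every series with its conjugate. -/
def swapGen (v : Gen N → R) : Gen N → R
  | .t m => v (.tb m)
  | .tb m => v (.t m)
  | .a n => -v (.abar n)
  | .b n => v (.cbar n)
  | .c n => v (.bbar n)
  | .abar n => -v (.a n)
  | .bbar n => v (.c n)
  | .cbar n => v (.b n)
  | .sa n => v (.sabar n)
  | .sb n => -v (.scbar n)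
  | .sc n => -v (.sbbar n)
  | .sabar n => v (.sa n)
  | .sbbar n => -v (.sc n)
  | .scbar n => -v (.sb n)
  | .u n => v (.u n)

theorem swapGen_swapGen (v : Gen N → R) : swapGen (swapGen v) = v := by
  funext g
  cases g <;> simp [swapGen]

/-- The exchange of `dt m` and `dtb m`. -/
def swapIdx : Idx N K → Idx N K
  | .rho => .rho
  | .t m => .tb m
  | .tb m => .t m
  | .s k => .s k

@[simp] theorem swapIdx_swapIdx (i : Idx N K) : swapIdx (swapIdx i) = i := by
  cases i <;> rfl

theorem mu_swapIdx (i j : Idx N K) : mu (swapIdx i) (swapIdx j) = mu i j := by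
  cases i <;> cases j <;> rfl

theorem ell_swapIdx (i j : Idx N K) : ell (swapIdx i) (swapIdx j) = ell i j := by
  cases i <;> cases j <;> rfl

theorem swapIdx_ell (i j : Idx N K) : swapIdx (ell i j) = ell i j := by
  cases i <;> cases j <;> rfl

theorem evenSer_neg (f : ℕ → R) (n : ℤ) : evenSer (fun k => -f k) n = -evenSer f n := by
  simp only [evenSer]
  split_ifs <;> simp

theorem oddSer_neg (f : ℕ → R) (n : ℤ) : oddSer (fun k => -f k) n = -oddSer f n := by
  simp only [oddSer]
  split_ifs <;> simp

variable (v : Gen N → R) (s : Sgn)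

theorem reflect_fieldYbar : reflect (fieldYbar v) = fieldY (swapGen v) := by
  funext n
  ext i j
  fin_cases i <;> fin_cases j <;>
    simp [reflect, fieldYbar, fieldY, mkLoopBar, mkLoop, swapGen, evenSer_neg]

theorem fieldYbar_eq (n : ℤ) : fieldYbar v n = fieldY (swapGen v) (-n) := by
  rw [← reflect_fieldYbar]
  simp [reflect]

theorem dressedSbar_eq (n : ℤ) : dressedSbar v n = -dressedS (swapGen v) (-n) := by
  ext i j
  fin_cases i <;> fin_cases j <;>
    simp [dressedSbar, dressedS, mkLoopBar, mkLoop, swapGen, oddSer_neg]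

theorem timeSerBar_eq : timeSerBar v = -reflect (timeSer (swapGen v)) := by
  funext n
  simp only [timeSerBar, timeSer, reflect, Pi.neg_apply, ← Finset.sum_neg_distrib]
  refine Finset.sum_congr rfl fun m _ => ?_
  have h : n = 2 * (m : ℤ) + 2 ↔ -n = -(2 * (m : ℤ) + 2) := by omega
  simp only [h]
  split_ifs
  · rw [← neg_smul]
    simp only [swapGen]
    congr 1
    ring
  · simp

theorem fieldSbar_eq : fieldSbar v = -reflect (fieldS (swapGen v)) := by
  have h1 : fieldYbar v = reflect (fieldY (swapGen v)) := funext (fieldYbar_eq v)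
  have h2 : dressedSbar v = -reflect (dressedS (swapGen v)) := funext (dressedSbar_eq v)
  rw [fieldSbar, h1, h2, timeSerBar_eq, neg_serSmul, serSmul_reflect, ← neg_add]
  rfl

theorem fieldUbar_eq (m : ℕ) : fieldUbar v m = -reflect (fieldU (swapGen v) m) := by
  funext n
  simp only [fieldUbar, fieldU, reflect, Pi.neg_apply, posPart, negPart, shift, fieldYbar_eq]
  have h : 1 ≤ n ↔ -n ≤ -1 := by omega
  simp only [h, show -(n - (2 * (m : ℤ) + 2)) = -n - -(2 * (m : ℤ) + 2) by ring]
  rw [← neg_smul, neg_div]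

theorem partSbar_eq (k : ℕ) : partSbar v k = -reflect (partS (swapGen v) k) := by
  funext n
  simp only [partSbar, partS, reflect, Pi.neg_apply, posPart, negPart, shift, fieldSbar_eq]
  have h : 1 ≤ n ↔ -n ≤ -1 := by omega
  simp only [h, show -(n - 2 * (k : ℤ)) = -n - -(2 * (k : ℤ)) by ring]
  split_ifs <;> simp

theorem reflect_lamPow (p : ℤ) : reflect (lamPow R p) = lamPow R (-p) := by
  funext n
  by_cases h : n = -p
  · subst h
    simp [reflect, lamPow]
  · have : -n ≠ p := by omega
    simp [reflect, lamPow, Pi.single_eq_of_ne h, Pi.single_eq_of_ne this]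

/-- The Maurer-Cartan form of the opposite type, for the conjugate variables. -/
theorem extPhi_swap (i : Idx N K) :
    extPhi (swapGen v) s.opp K (swapIdx i) = affReflect (extPhi v s K i) := by
  have h0 : -reflect (0 : Ser R) = 0 := funext fun n => neg_zero
  have hneg : ∀ X : Ser R, reflect (-X) = -reflect X := fun X => rfl
  cases i with
  | rho =>
    refine Prod.ext h0.symm ?_
    funext n
    by_cases h : n = 0
    · subst h; simp [affReflect, extPhi, swapIdx, reflect]
    · have : -n ≠ 0 := by omega
      simp [affReflect, extPhi, swapIdx, reflect, rotLoop, Pi.single_eq_of_ne h,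
        Pi.single_eq_of_ne this]
  | t m =>
    refine Prod.ext h0.symm ?_
    simp only [affReflect, extPhi, swapIdx, fieldUbar_eq, swapGen_swapGen, neg_neg]
  | tb m =>
    refine Prod.ext h0.symm ?_
    simp only [affReflect, extPhi, swapIdx, fieldUbar_eq, neg_neg, reflect_reflect]
  | s k =>
    cases s with
    | plus =>
      simp only [affReflect, extPhi, swapIdx, Sgn.opp, partSbar_eq, neg_neg, hneg, reflect_lamPow,
        reflect_reflect]
    | minus =>
      simp only [affReflect, extPhi, swapIdx, Sgn.opp, partSbar_eq, swapGen_swapGen, neg_neg,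
        reflect_lamPow]

theorem affReflect_hatYbar : affReflect (hatYbar v) = hatY (swapGen v) := by
  refine Prod.ext (funext fun n => neg_zero) ?_
  funext n
  simp only [affReflect, hatYbar, hatY, reflect, shift, fieldYbar_eq]
  congr 1
  ring

/-- The sign comes from the scalar part: the reflection reverses the Euler operator. -/
theorem affReflect_hatSbar : affReflect (hatSbar v) = -hatS (swapGen v) := by
  refine Prod.ext ?_ ?_
  · simp only [affReflect, hatSbar, hatS, Prod.fst_neg, reflect_lamPow, neg_zero]
  · simp only [affReflect, hatSbar, hatS, Prod.snd_neg, fieldSbar_eq]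
    exact congrArg Neg.neg (reflect_reflect (fieldS (swapGen v)))

theorem confSer_swap (n : ℤ) : confSer (swapGen v) s.opp n = confSer v s (-n) := by
  have : s.opp.val * n = s.val * -n := by cases s <;> simp [Sgn.opp, Sgn.val]
  simp only [confSer, this, even_neg, swapGen]

/-- The exterior derivative with `dt m` and `dtb m` exchanged. -/
def FormalDiff.swap (d : FormalDiff R (Idx N K)) : FormalDiff R (Idx N K) where
  D i := d.D (swapIdx i)
  c i j := (d.c (swapIdx i) (swapIdx j)).mapDomain swapIdx
  c_self i := by rw [d.c_self, Finsupp.mapDomain_zero]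
  c_swap i j := by
    rw [d.c_swap]
    exact map_neg (Finsupp.mapDomain.addMonoidHom swapIdx) _

variable (K) in
theorem confDot_swap : confDot (swapGen v) s.opp K = -reflect (confDot v s K) := by
  funext n
  have : s.opp.val = -s.val := by cases s <;> rfl
  have h0 : lamPow R 0 (-n) = lamPow R 0 n := by
    have := congrFun (reflect_lamPow (R := R) 0) n
    simpa [reflect] using this
  simp only [confDot, reflect, Pi.add_apply, Pi.smul_apply, Pi.neg_apply, euler, confSer_swap,
    this, h0]
  module

theorem confForm_swap (d : FormalDiff R (Idx N K)) (i : Idx N K) :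
    confForm (swapGen v) s.opp d.swap (swapIdx i) = reflect (confForm v s d i) := by
  have h1 : (extPhi (swapGen v) s.opp K (swapIdx i)).1 = -reflect (extPhi v s K i).1 := by
    rw [extPhi_swap]
    rfl
  simp only [confForm]
  rw [confDot_swap, h1, serMul_neg, neg_serMul, neg_neg, serMul_reflect]
  funext n
  simp only [Pi.add_apply, reflect, FormalDiff.dFun, confSer_swap, FormalDiff.swap,
    swapIdx_swapIdx]

theorem covariant_swap (d : FormalDiff R (Idx N K)) (x : Aff R) (i : Idx N K) :
    d.swap.covariant (extPhi (swapGen v) s.opp K) (affReflect x) (swapIdx i) =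
      affReflect (d.covariant (extPhi v s K) x i) := by
  have h : d.swap.dAff (affReflect x) (swapIdx i) = affReflect (d.dAff x i) := by
    refine Prod.ext ?_ ?_
    · funext n
      simp [FormalDiff.dAff, FormalDiff.dFun, affReflect, FormalDiff.swap, reflect]
    · funext n
      ext a b
      simp [FormalDiff.dAff, FormalDiff.dFun, affReflect, FormalDiff.swap, reflect]
  simp only [FormalDiff.covariant]
  rw [h, extPhi_swap, affBracket_reflect, affReflect_add]

theorem covariant_neg (d : FormalDiff R (Idx N K)) (Φ : Idx N K → Aff R) (x : Aff R)
    (i : Idx N K) : d.covariant Φ (-x) i = -d.covariant Φ x i := by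
  have h : d.dAff (-x) i = -d.dAff x i := by
    refine Prod.ext ?_ ?_
    · funext n
      simp [FormalDiff.dAff, FormalDiff.dFun]
    · funext n
      ext a b
      simp [FormalDiff.dAff, FormalDiff.dFun]
  simp only [FormalDiff.covariant]
  rw [h, affBracket_neg, neg_add]

theorem killing_Ybar_iff (d : FormalDiff R (Idx N K)) :
    d.covariant (extPhi v s K) (hatYbar v) = 0 ↔
      d.swap.covariant (extPhi (swapGen v) s.opp K) (hatY (swapGen v)) = 0 := by
  rw [← affReflect_hatYbar]
  constructor
  · intro h
    funext i
    rw [← swapIdx_swapIdx i, covariant_swap, h]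
    exact affReflect_zero
  · intro h
    funext i
    apply affReflect_injective
    rw [← covariant_swap, h]
    exact affReflect_zero.symm

theorem killing_Sbar_iff (d : FormalDiff R (Idx N K)) :
    (∀ i, d.covariant (extPhi v s K) (hatSbar v) i +
      affSmul (confForm v s d i) (hatSbar v) = 0) ↔
    ∀ i, d.swap.covariant (extPhi (swapGen v) s.opp K) (hatS (swapGen v)) i +
      affSmul (confForm (swapGen v) s.opp d.swap i) (hatS (swapGen v)) = 0 := by
  have key : ∀ i, d.swap.covariant (extPhi (swapGen v) s.opp K) (hatS (swapGen v)) (swapIdx i) +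
      affSmul (confForm (swapGen v) s.opp d.swap (swapIdx i)) (hatS (swapGen v)) =
      -affReflect (d.covariant (extPhi v s K) (hatSbar v) i +
        affSmul (confForm v s d i) (hatSbar v)) := fun i => by
    rw [affReflect_add, ← covariant_swap, ← affSmul_reflect, affReflect_hatSbar, covariant_neg,
      affSmul_neg, confForm_swap, neg_add, neg_neg, neg_neg]
  constructor
  · intro h i
    rw [← swapIdx_swapIdx i, key, h, affReflect_zero, neg_zero]
  · intro h i
    apply affReflect_injective
    rw [affReflect_zero, ← neg_eq_zero, ← key, h]

theorem affBracket_extPhi_snd (i j : Idx N K) :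
    (affBracket (extPhi v s K i) (extPhi v s K j)).2 = (loopComm v s i j).coeff := by
  simp only [affBracket, extPhi_snd, loopBracket_coeff, extPhi_fst, serSmul_monomial]
  funext n
  simp [loopComm, euler, -zsmul_eq_mul]

theorem coeff_loopComm_swap (i j : Idx N K) (n : ℤ) :
    (loopComm (swapGen v) s.opp (swapIdx i) (swapIdx j)).coeff n =
      (loopComm v s i j).coeff (-n) := by
  rw [← affBracket_extPhi_snd, ← affBracket_extPhi_snd, extPhi_swap, extPhi_swap,
    affBracket_reflect]
  rfl

theorem coeff_hA_swap (i : Idx N K) (n : ℤ) :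
    (hA (swapGen v) s.opp (swapIdx i)).coeff n = (hA v s i).coeff (-n) := by
  rw [← extPhi_snd, extPhi_swap]
  rfl

theorem coeff_loopCurv_swap (D : Idx N K → Derivation ℂ R R) (κ : Idx N K → Idx N K → R)
    (i j : Idx N K) (n : ℤ) :
    (loopCurv (swapGen v) s.opp (fun i => D (swapIdx i))
      (fun i j => κ (swapIdx i) (swapIdx j)) (swapIdx i) (swapIdx j)).coeff n =
      (loopCurv v s D κ i j).coeff (-n) := by
  have h1 : ∀ i j : Idx N K, (dC (D i) (hA (swapGen v) s.opp (swapIdx j))).coeff n =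
      (dC (D i) (hA v s j)).coeff (-n) := fun i j => by
    ext a b
    simp [coeff_hA_swap]
  have h2 : (hA (swapGen v) s.opp (.rho : Idx N K)).coeff n =
      (hA v s (.rho : Idx N K)).coeff (-n) :=
    coeff_hA_swap v s (.rho : Idx N K) n
  have h3 : (hA (swapGen v) s.opp (ell i j)).coeff n = (hA v s (ell i j)).coeff (-n) := by
    rw [← coeff_hA_swap, swapIdx_ell]
  simp only [loopCurv, coeff_add, coeff_sub, coeff_smul, coeff_zsmul, swapIdx_swapIdx, mu_swapIdx,
    ell_swapIdx, h1, h2, h3, coeff_loopComm_swap]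

end Conjugation

/-! ### The differentials of the coframe -/

section StructureFunctions

variable {N K : ℕ} {R : Type*} [CommRing R] [Algebra ℂ R] {v : Gen N → R} {s : Sgn}
  {d : FormalDiff R (Idx N K)} {κ : Idx N K → Idx N K → R}

/-- The differentials of the coframe have only the Virasoro structure constants and a component
along the connection form. -/
def HasVirasoroCoframe (d : FormalDiff R (Idx N K)) (κ : Idx N K → Idx N K → R) : Prop :=
  ∀ i j, d.c i j = Finsupp.single .rho (κ i j) + Finsupp.single (ell i j) ((mu i j : ℤ) : R)

theorem HasVirasoroCoframe.sum (hc : HasVirasoroCoframe d κ) (i j : Idx N K) (w : Idx N K → R) :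
    ((d.c i j).sum fun k r => r * w k) = κ i j * w .rho + mu i j • w (ell i j) := by
  rw [hc, Finsupp.sum_add_index' (fun _ => zero_mul _) fun _ _ _ => add_mul _ _ _,
    Finsupp.sum_single_index (zero_mul _), Finsupp.sum_single_index (zero_mul _), zsmul_eq_mul]

theorem dOne_coframe (x i j : Idx N K) : d.dOne (FormalDiff.coframe x) i j = d.c i j x := by
  classical
  have h : ∀ k : Idx N K, (FormalDiff.coframe x : Idx N K → R) k = if k = x then 1 else 0 := by
    intro k
    by_cases hk : k = x
    · subst hk; simp [FormalDiff.coframe]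
    · simp [FormalDiff.coframe, hk]
  have h0 : ∀ i k, d.D i ((FormalDiff.coframe x : Idx N K → R) k) = 0 := fun i k => by
    rw [h]
    split_ifs <;> simp
  rw [FormalDiff.dOne, h0, h0]
  simp only [h, mul_ite, mul_one, mul_zero, sub_zero, zero_add]
  rw [Finsupp.sum, Finset.sum_ite_eq']
  split_ifs with hx
  · rfl
  · exact (Finsupp.notMem_support_iff.1 hx).symm

theorem D_extPhi_fst (i j : Idx N K) (n : ℤ) : d.D i ((extPhi v s K j).1 n) = 0 := by
  have : d.D i (lamPow R (vdeg s j) n) = 0 := by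
    by_cases h : n = vdeg s j
    · rw [h]; simp [lamPow]
    · simp [lamPow, Pi.single_eq_of_ne h]
  rw [extPhi_fst, Pi.smul_apply, Derivation.map_smul_of_tower, this, smul_zero]

theorem affBracket_extPhi_fst (i j : Idx N K) : (affBracket (extPhi v s K i) (extPhi v s K j)).1 =
    -(mu i j • (extPhi v s K (ell i j)).1) := by
  obtain ⟨h1, h2⟩ := vcoef_relation s i j
  have hmul : ∀ p q : ℤ, (fun n => lamPow R q (n - p)) = lamPow R (p + q) := fun p q => by
    funext n
    by_cases h : n = p + q
    · subst h; simp [lamPow]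
    · have : n - p ≠ q := by omega
      simp [lamPow, Pi.single_eq_of_ne h, Pi.single_eq_of_ne this]
  have key : (affBracket (extPhi v s K i) (extPhi v s K j)).1 =
      -((vcoef s i * vcoef s j * (vdeg s i - vdeg s j)) • lamPow R (vdeg s i + vdeg s j)) := by
    simp only [affBracket, extPhi_fst, euler_monomial, serMul_monomial_left]
    funext n
    have e1 := congrFun (hmul (vdeg s i) (vdeg s j)) n
    have e2 := congrFun (hmul (vdeg s j) (vdeg s i)) n
    beta_reduce at e1 e2
    simp only [Pi.sub_apply, Pi.smul_apply, Pi.neg_apply, e1, e2]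
    rw [add_comm (vdeg s j)]
    module
  rw [key, extPhi_fst, smul_smul, h1]
  by_cases h : mu i j = 0
  · rw [← h1, h]
    simp
  · rw [h2 h]

theorem HasVirasoroCoframe.curvature_fst (hc : HasVirasoroCoframe d κ) (i j : Idx N K) :
    (d.curvature (extPhi v s K) i j).1 = 0 := by
  funext n
  simp only [FormalDiff.curvature, Prod.fst_add, affBracket_extPhi_fst, FormalDiff.dAffOne,
    Pi.add_apply, FormalDiff.dOne, hc.sum, D_extPhi_fst]
  simp [extPhi]

theorem HasVirasoroCoframe.curvature_snd (hc : HasVirasoroCoframe d κ) (i j : Idx N K) :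
    (d.curvature (extPhi v s K) i j).2 = (loopCurv v s d.D κ i j).coeff := by
  funext n
  ext a b
  simp only [FormalDiff.curvature, Prod.snd_add, affBracket_extPhi_snd, FormalDiff.dAffOne,
    Pi.add_apply, FormalDiff.dOne, hc.sum, loopCurv, coeff_add, coeff_sub, coeff_smul, coeff_zsmul,
    Matrix.add_apply, Matrix.sub_apply, Matrix.smul_apply, Matrix.of_apply, coeff_dC, extPhi_snd,
    smul_eq_mul]

theorem HasVirasoroCoframe.curvature_eq_zero_iff (hc : HasVirasoroCoframe d κ) :
    d.curvature (extPhi v s K) = 0 ↔ ∀ i j, loopCurv v s d.D κ i j = 0 := by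
  constructor
  · intro h i j
    apply coeff_injective
    rw [← hc.curvature_snd, h]
    rfl
  · intro h
    funext i j
    refine Prod.ext (hc.curvature_fst i j) ?_
    rw [hc.curvature_snd, h]
    rfl

/-- The closedness of `dt m` and `dtb m` and the Maurer-Cartan equation determine the differential
of the coframe, except for its components along the connection form. -/
theorem hasVirasoroCoframe_of_curvature (ht : ∀ m i j, d.c i j (.t m) = 0)
    (htb : ∀ m i j, d.c i j (.tb m) = 0) (hΦ : d.curvature (extPhi v s K) = 0) :
    HasVirasoroCoframe d fun i j => d.c i j .rho := by
  classical
  have hs : ∀ i j k, d.c i j (.s k) = ((if ell i j = .s k then mu i j else 0 : ℤ) : R) := by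
    intro i j k
    -- only `s k` contributes to the derivation part of degree `± 2 k`
    have h := congrFun (congrArg Prod.fst (congrFun (congrFun hΦ i) j)) (vdeg s (.s k : Idx N K))
    simp only [FormalDiff.curvature, Prod.fst_add, affBracket_extPhi_fst, FormalDiff.dAffOne,
      Pi.add_apply, FormalDiff.dOne, D_extPhi_fst, sub_zero, zero_add, Pi.neg_apply,
      Pi.smul_apply] at h
    have hval : ∀ l : Idx N K, (extPhi v s K l).1 (vdeg s (.s k : Idx N K)) =
        if l = .s k then ((-s.val : ℤ) : R) else 0 := by
      intro l
      rw [extPhi_fst, Pi.smul_apply]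
      cases l with
      | rho => simp [vcoef]
      | t m => simp [vcoef]
      | tb m => simp [vcoef]
      | s l =>
        by_cases hl : l = k
        · subst hl
          simp [vcoef, lamPow]
        · have hl' : (l : ℕ) ≠ k := fun e => hl (Subtype.ext e)
          have : vdeg s (.s k : Idx N K) ≠ vdeg s (.s l : Idx N K) := by
            cases s <;> simp [vdeg, Sgn.val] <;> omega
          simp [hl, lamPow, Pi.single_eq_of_ne this]
    simp only [hval, mul_ite, mul_zero] at h
    rw [Finsupp.sum, Finset.sum_ite_eq'] at h
    have hv2 : ((-s.val : ℤ) : R) * ((-s.val : ℤ) : R) = 1 := by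
      cases s <;> simp [Sgn.val]
    have h' : d.c i j (.s k) * ((-s.val : ℤ) : R) =
        ((if ell i j = .s k then mu i j else 0 : ℤ) : R) * ((-s.val : ℤ) : R) := by
      have e1 : (if Idx.s k ∈ (d.c i j).support then d.c i j (.s k) * ((-s.val : ℤ) : R) else 0) =
          d.c i j (.s k) * ((-s.val : ℤ) : R) := by
        split_ifs with hx
        · rfl
        · rw [Finsupp.notMem_support_iff.1 hx, zero_mul]
      rw [e1] at h
      simp only [Prod.fst_zero, Pi.zero_apply] at h
      rw [← sub_eq_zero, ← h]
      split_ifs <;> simp [sub_eq_add_neg]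
    have := congrArg (fun z => z * ((-s.val : ℤ) : R)) h'
    simpa only [mul_assoc, hv2, mul_one] using this
  intro i j
  ext x
  rw [Finsupp.add_apply, Finsupp.single_apply, Finsupp.single_apply]
  cases x with
  | rho =>
    rw [if_pos rfl]
    cases i <;> cases j <;> simp [ell, mu]
  | t m =>
    rw [ht, if_neg (by simp), zero_add, if_neg]
    cases i <;> cases j <;> simp [ell]
  | tb m =>
    rw [htb, if_neg (by simp), zero_add, if_neg]
    cases i <;> cases j <;> simp [ell]
  | s k =>
    rw [hs, if_neg (show ¬ (Idx.rho : Idx N K) = .s k by simp), zero_add]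
    split_ifs <;> simp

end StructureFunctions

/-! ### Commutators of flows and the square of the exterior derivative -/

section Consequences

variable {N K : ℕ} {R : Type*} [CommRing R] [Algebra ℂ R] {v : Gen N → R} {s : Sgn}
  {d : FormalDiff R (Idx N K)} {κ : Idx N K → Idx N K → R}

theorem dC_commutator (E F : Derivation ℂ R R) (x : LaurentLoop R) :
    dC ⁅E, F⁆ x = dC E (dC F x) - dC F (dC E x) := by
  ext n : 1
  ext a b
  simp [Derivation.commutator_apply]

theorem dC_neg_add_smul (E F : Derivation ℂ R R) (r : R) (k : ℤ) (x : LaurentLoop R) :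
    dC (-(r • E + k • F)) x = -(r • dC E x + k • dC F x) := by
  ext n : 1
  ext a b
  simp [-zsmul_eq_mul]

/-- A derivation is determined on all variables by its values on the times, on the conformal factor
and on the two Killing fields and their conjugates. -/
theorem eq_on_generators {E F : Derivation ℂ R R} (et : ∀ m, E (v (.t m)) = F (v (.t m)))
    (etb : ∀ m, E (v (.tb m)) = F (v (.tb m))) (eu : ∀ n, E (v (.u n)) = F (v (.u n)))
    (hY1 : dC E (hY v) = dC F (hY v)) (hS1 : dC E (hS v) = dC F (hS v))
    (hY2 : dC E (hY (swapGen v)) = dC F (hY (swapGen v)))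
    (hS2 : dC E (hS (swapGen v)) = dC F (hS (swapGen v))) (g : Gen N) : E (v g) = F (v g) := by
  have e1 := half_ext (v := v) et hY1 hS1
  have e2 := half_ext (v := swapGen v) etb hY2 hS2
  cases g with
  | t m => exact et m
  | tb m => exact etb m
  | a n => exact (e1 n).1.1
  | b n => exact (e1 n).1.2.1
  | c n => exact (e1 n).1.2.2
  | sa n => exact (e1 n).2.1
  | sb n => exact (e1 n).2.2.1
  | sc n => exact (e1 n).2.2.2
  | abar n => simpa only [swapGen, map_neg, neg_inj] using (e2 n).1.1
  | bbar n => exact (e2 n).1.2.2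
  | cbar n => exact (e2 n).1.2.1
  | sabar n => exact (e2 n).2.1
  | sbbar n => simpa only [swapGen, map_neg, neg_inj] using (e2 n).2.2.2
  | scbar n => simpa only [swapGen, map_neg, neg_inj] using (e2 n).2.2.1
  | u n => exact eu n

/-- The flows close under commutators, with the structure functions of the coframe. -/
theorem commutator_eq (hgen : ∀ E F : Derivation ℂ R R, (∀ g, E (v g) = F (v g)) → E = F)
    (ht : ∀ m i, d.D i (v (.t m)) = FormalDiff.coframe (.t m) i)
    (htb : ∀ m i, d.D i (v (.tb m)) = FormalDiff.coframe (.tb m) i)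
    (h : KillingHalf v s d.D) (h' : KillingHalf (swapGen v) s.opp d.swap.D)
    (hM : ∀ i j, loopCurv v s d.D κ i j = 0) (i j : Idx N K) :
    ⁅d.D i, d.D j⁆ = -(κ i j • d.D .rho + mu i j • d.D (ell i j)) := by
  have hM' : ∀ i j, loopCurv (swapGen v) s.opp d.swap.D
      (fun i j => κ (swapIdx i) (swapIdx j)) i j = 0 := fun i j => by
    ext n : 1
    rw [← swapIdx_swapIdx i, ← swapIdx_swapIdx j]
    exact (coeff_loopCurv_swap v s d.D κ _ _ n).trans (by rw [hM]; rfl)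
  have hco : ∀ x i j, d.D i ((FormalDiff.coframe x : Idx N K → R) j) = 0 := fun x i j => by
    classical
    by_cases hj : j = x
    · subst hj; simp [FormalDiff.coframe]
    · simp [FormalDiff.coframe, hj]
  have hl : ∀ m, (FormalDiff.coframe (.t m) : Idx N K → R) (ell i j) = 0 := fun m => by
    cases i <;> cases j <;> simp [ell, FormalDiff.coframe]
  have hlb : ∀ m, (FormalDiff.coframe (.tb m) : Idx N K → R) (ell i j) = 0 := fun m => by
    cases i <;> cases j <;> simp [ell, FormalDiff.coframe]
  have hr : ∀ m, (FormalDiff.coframe (.t m) : Idx N K → R) .rho = 0 := fun m => by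
    simp [FormalDiff.coframe]
  have hrb : ∀ m, (FormalDiff.coframe (.tb m) : Idx N K → R) .rho = 0 := fun m => by
    simp [FormalDiff.coframe]
  have et : ∀ m, ⁅d.D i, d.D j⁆ (v (.t m)) =
      (-(κ i j • d.D .rho + mu i j • d.D (ell i j)) : Derivation ℂ R R) (v (.t m)) := fun m => by
    simp [Derivation.commutator_apply, ht, hco, hl, hr]
  have etb : ∀ m, ⁅d.D i, d.D j⁆ (v (.tb m)) =
      (-(κ i j • d.D .rho + mu i j • d.D (ell i j)) : Derivation ℂ R R) (v (.tb m)) := fun m => by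
    simp [Derivation.commutator_apply, htb, hco, hlb, hrb]
  have aux : ∀ x : LaurentLoop R, dC (d.swap.D (swapIdx i)) (dC (d.swap.D (swapIdx j)) x)
      - dC (d.swap.D (swapIdx j)) (dC (d.swap.D (swapIdx i)) x) = dC ⁅d.D i, d.D j⁆ x := fun x => by
    simp [FormalDiff.swap, dC_commutator]
  have aux' : ∀ x : LaurentLoop R, -(κ (swapIdx (swapIdx i)) (swapIdx (swapIdx j)) •
      dC (d.swap.D .rho) x + mu (swapIdx i) (swapIdx j) •
      dC (d.swap.D (ell (swapIdx i) (swapIdx j))) x) =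
      dC (-(κ i j • d.D .rho + mu i j • d.D (ell i j)) : Derivation ℂ R R) x := fun x => by
    rw [dC_neg_add_smul, swapIdx_swapIdx, swapIdx_swapIdx, mu_swapIdx, ell_swapIdx]
    simp only [FormalDiff.swap, swapIdx_ell]
    rfl
  refine hgen _ _ (eq_on_generators et etb (fun n => ?_)
    ((dC_commutator _ _ _).trans ((comm_hY h hM i j).trans (dC_neg_add_smul _ _ _ _ _).symm))
    ((dC_commutator _ _ _).trans ((comm_hS h hM i j).trans (dC_neg_add_smul _ _ _ _ _).symm))
    ?_ ?_)
  · have := comm_confSer h i j (s.val * (2 * n))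
    rw [confSer_apply] at this
    have h0 : d.D .rho (v (.u n)) = 0 := by
      rw [← confSer_apply v s, h.eqU, rhsU]
      simp [vcoef]
    rw [Derivation.commutator_apply, this]
    simp [h0]
  · rw [← aux, ← aux']
    exact comm_hY h' hM' (swapIdx i) (swapIdx j)
  · rw [← aux, ← aux']
    exact comm_hS h' hM' (swapIdx i) (swapIdx j)

/-- On one-forms the square of the exterior derivative is a multiple of the component along the
connection form. -/
theorem dTwo_dOne (hc : HasVirasoroCoframe d κ)
    (hcomm : ∀ i j, ⁅d.D i, d.D j⁆ = -(κ i j • d.D .rho + mu i j • d.D (ell i j)))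
    (hκ : ∀ k, κ .rho k = 0) (w : Idx N K → R) (i j k : Idx N K) :
    d.dTwo (d.dOne w) i j k =
      (d.D i (κ j k) + d.D j (κ k i) + d.D k (κ i j) + mu i j • κ (ell i j) k +
        mu j k • κ (ell j k) i + mu k i • κ (ell k i) j) * w .rho := by
  have hcom : ∀ i j f, d.D i (d.D j f) = d.D j (d.D i f)
      - (κ i j * d.D .rho f + mu i j • d.D (ell i j) f) := fun i j f => by
    have := congrArg (fun E : Derivation ℂ R R => E f) (hcomm i j)
    simp only [Derivation.commutator_apply, Derivation.neg_apply, Derivation.add_apply,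
      Derivation.smul_apply, smul_eq_mul] at this
    rw [sub_eq_add_neg, ← this]
    ring
  have hμ : ∀ k : Idx N K, mu .rho k = 0 := fun k => rfl
  have hw := mu_jacobi_smul w i j k
  simp only [FormalDiff.dTwo, FormalDiff.dOne, hc.sum, map_sub, map_add, Derivation.leibniz, hκ, hμ,
    Derivation.map_smul_of_tower, smul_eq_mul]
  rw [hcom i j, hcom j k, hcom k i]
  simp only [zsmul_eq_mul, Int.cast_mul] at hw ⊢
  linear_combination hw

/-- The square of the exterior derivative vanishes.  On the matrix entry of degree zero of the
Maurer-Cartan form, which is a constant along the connection form and zero otherwise, this is the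
Bianchi identity. -/
theorem squareZero_of_commutator (hc : HasVirasoroCoframe d κ)
    (hcomm : ∀ i j, ⁅d.D i, d.D j⁆ = -(κ i j • d.D .rho + mu i j • d.D (ell i j)))
    (hM : ∀ i j, loopCurv v s d.D κ i j = 0) : d.SquareZero := by
  have hκ : ∀ k, κ .rho k = 0 := kappa_rho hM
  constructor
  · intro f
    funext i j
    have := congrArg (fun E : Derivation ℂ R R => E f) (hcomm i j)
    simp only [Derivation.commutator_apply, Derivation.neg_apply, Derivation.add_apply,
      Derivation.smul_apply, smul_eq_mul] at this
    simp only [FormalDiff.dOne, FormalDiff.dFun, hc.sum, Pi.zero_apply]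
    rw [this]
    simp
  · intro w
    funext i j k
    rw [dTwo_dOne hc hcomm hκ]
    have e := dTwo_dOne hc hcomm hκ (fun k => (hA v s k).coeff 0 0 0) i j k
    have hd : ∀ i j, d.dOne (fun k => (hA v s k).coeff 0 0 0) i j =
        -(loopComm v s i j).coeff 0 0 0 := fun i j => by
      have := congrFun (congrFun (congrArg (fun x => x.coeff 0) (hM i j)) 0) 0
      simp only [loopCurv, coeff_add, coeff_sub, coeff_smul, coeff_zsmul, Matrix.add_apply,
        Matrix.sub_apply, Matrix.smul_apply, coeff_dC, smul_eq_mul] at this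
      rw [eq_neg_iff_add_eq_zero, FormalDiff.dOne, hc.sum]
      exact this
    have hb := congrFun (congrFun (congrArg (fun x => x.coeff 0)
      (bianchi_loopComm hM i j k)) 0) 0
    simp only [coeff_add, coeff_smul, coeff_zsmul, Matrix.add_apply, Matrix.smul_apply, coeff_dC,
      smul_eq_mul] at hb
    have h0 : d.dTwo (d.dOne fun k => (hA v s k).coeff 0 0 0) i j k = 0 := by
      rw [FormalDiff.dTwo, hc.sum i j fun l => d.dOne _ l k, hc.sum j k fun l => d.dOne _ l i,
        hc.sum k i fun l => d.dOne _ l j]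
      simp only [hd, map_neg, mul_neg, smul_neg]
      rw [← neg_eq_zero, ← show _ = (0 : R) from hb]
      ring
    rw [h0, coeff_hA_rho, if_pos rfl] at e
    have hJ := smul_rot_eq_zero (R := R) (r := d.D i (κ j k) + d.D j (κ k i) + d.D k (κ i j) +
      mu i j • κ (ell i j) k + mu j k • κ (ell j k) i + mu k i • κ (ell k i) j) (by
        have e' : _ * algebraMap ℂ R (Complex.I / 2) = 0 := e.symm
        ext a b
        fin_cases a <;> fin_cases b
        · exact e'
        · exact mul_zero _
        · exact mul_zero _
        · exact (mul_neg _ _).trans (by rw [e', neg_zero]; rfl))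
    rw [hJ, zero_mul]
    rfl

end Consequences

/-! ### The twisted parity condition -/

section Parity

variable {R : Type*} [CommRing R] [Algebra ℂ R]

theorem IsParity.sub {X Y : Loop R} (hX : IsParity X) (hY : IsParity Y) : IsParity (X - Y) := by
  rw [sub_eq_add_neg]
  exact hX.add hY.neg

theorem isParity_zero : IsParity (0 : Loop R) := ⟨by simp, by simp, by simp⟩

theorem IsParity.zsmul {X : Loop R} (hX : IsParity X) (k : ℤ) : IsParity (k • X) := by
  refine ⟨fun n => ?_, fun n hn => ?_, fun n hn => ?_⟩
  · rw [Pi.smul_apply, Matrix.trace_smul, hX.1 n, smul_zero]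
  · rw [Pi.smul_apply, Matrix.smul_apply, Matrix.smul_apply, (hX.2.1 n hn).1, (hX.2.1 n hn).2,
      smul_zero]
    exact ⟨rfl, rfl⟩
  · rw [Pi.smul_apply, Matrix.smul_apply, Matrix.smul_apply, (hX.2.2 n hn).1, (hX.2.2 n hn).2,
      smul_zero]
    exact ⟨rfl, rfl⟩

theorem IsParity.rsmul {X : Loop R} (hX : IsParity X) (r : R) : IsParity (fun n => r • X n) :=
  ⟨fun n => by simp [hX.1 n], fun n hn => by simp [hX.2.1 n hn], fun n hn => by simp [hX.2.2 n hn]⟩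

theorem IsParity.euler {X : Loop R} (hX : IsParity X) : IsParity (euler X) := by
  have h : ∀ n, CMCHierarchy.euler X n = (n • X) n := fun n => rfl
  exact ⟨fun n => by rw [h]; exact (hX.zsmul n).1 n,
    fun n hn => by rw [h]; exact (hX.zsmul n).2.1 n hn,
    fun n hn => by rw [h]; exact (hX.zsmul n).2.2 n hn⟩

theorem IsParity.loopBracket {X Y : Loop R} (hX : IsParity X) (hY : IsParity Y) :
    IsParity (loopBracket X Y) := by
  refine ⟨fun n => ?_, fun n hn => ?_, fun n hn => ?_⟩
  · refine finsum_induction (p := fun A : Matrix (Fin 2) (Fin 2) R => A.trace = 0) (by simp)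
      (fun A B hA hB => by simp [hA, hB]) fun m => ?_
    rw [Matrix.trace_sub, Matrix.trace_mul_comm, sub_self]
  · refine finsum_induction (p := fun A : Matrix (Fin 2) (Fin 2) R => A 0 0 = 0 ∧ A 1 1 = 0)
      (by simp) (fun A B hA hB => by simp [hA, hB]) fun m => ?_
    rcases Int.even_or_odd m with h | h
    · simp [Matrix.mul_apply, Fin.sum_univ_two, hX.2.2 _ h, hY.2.1 _ (hn.sub_even h)]
    · simp [Matrix.mul_apply, Fin.sum_univ_two, hX.2.1 _ h, hY.2.2 _ (hn.sub_odd h)]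
  · refine finsum_induction (p := fun A : Matrix (Fin 2) (Fin 2) R => A 0 1 = 0 ∧ A 1 0 = 0)
      (by simp) (fun A B hA hB => by simp [hA, hB]) fun m => ?_
    rcases Int.even_or_odd m with h | h
    · simp [Matrix.mul_apply, Fin.sum_univ_two, hX.2.2 _ h, hY.2.2 _ (hn.sub h)]
    · simp [Matrix.mul_apply, Fin.sum_univ_two, hX.2.1 _ h, hY.2.1 _ (hn.sub_odd h)]

theorem isParity_sh {x : LaurentLoop R} {p : ℤ} (hp : Even p) (hx : IsParity x.coeff) :
    IsParity (sh p x).coeff := by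
  have : (CMCHierarchy.sh p x).coeff = CMCHierarchy.shift p x.coeff :=
    funext fun n => coeff_sh p x n
  rw [this]
  exact IsParity.shift hp hx

theorem isParity_zsmul {x : LaurentLoop R} (k : ℤ) (hx : IsParity x.coeff) :
    IsParity (k • x).coeff := by
  have : (k • x).coeff = k • x.coeff := funext fun n => coeff_zsmul k x n
  rw [this]
  exact hx.zsmul k

theorem isParity_eul {x : LaurentLoop R} (hx : IsParity x.coeff) : IsParity (eul x).coeff :=
  hx.euler

theorem isParity_add {x y : LaurentLoop R} (hx : IsParity x.coeff) (hy : IsParity y.coeff) :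
    IsParity (x + y).coeff :=
  hx.add hy

theorem isParity_sub {x y : LaurentLoop R} (hx : IsParity x.coeff) (hy : IsParity y.coeff) :
    IsParity (x - y).coeff :=
  hx.sub hy

theorem isParity_neg {x : LaurentLoop R} (hx : IsParity x.coeff) : IsParity (-x).coeff :=
  hx.neg

theorem isParity_comm {x y : LaurentLoop R} (hx : IsParity x.coeff) (hy : IsParity y.coeff) :
    IsParity (x * y - y * x).coeff := by
  rw [← loopBracket_coeff]
  exact hx.loopBracket hy

end Parity

/-! ### Reading off the variables from a series -/

section Shape

variable {N K : ℕ} {R : Type*} [CommRing R] [Algebra ℂ R] (v : Gen N → R) (s : Sgn)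

theorem isParity_hA (i : Idx N K) : IsParity (hA v s i).coeff := (extPhi_mem v s K i).2.2

theorem even_vdeg (i : Idx N K) : Even (vdeg s i) := by
  cases i <;> simp [vdeg]

theorem isParity_hY : IsParity (hY v).coeff := isParity_mkLoop _ _ _

theorem isParity_hS : IsParity (hS v).coeff := isParity_fieldS v

theorem isParity_loopComm (i j : Idx N K) : IsParity (loopComm v s i j).coeff := by
  have h1 : ∀ i j : Idx N K,
      IsParity (vcoef s i • sh (vdeg s i) (eul (hA v s j)) : LaurentLoop R).coeff := fun i j =>
    isParity_zsmul _ (isParity_sh (even_vdeg s i) (isParity_eul (isParity_hA v s j)))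
  exact isParity_sub (isParity_add (isParity_comm (isParity_hA v s i) (isParity_hA v s j))
    (h1 i j)) (h1 j i)

theorem isParity_rhsY (i : Idx N K) : IsParity (rhsY v s i).coeff :=
  isParity_sub (isParity_neg (isParity_comm (isParity_hA v s i) (isParity_hY v)))
    (isParity_zsmul _ (isParity_sh (even_vdeg s i)
      (isParity_sub (isParity_eul (isParity_hY v)) (isParity_hY v))))

theorem isParity_rhsD (i : Idx N K) : IsParity (rhsD v s i).coeff := by
  have heven : ∀ m : Fin (N + 1), Even (-(2 * (m : ℤ) + 2)) := fun m => ⟨-(m + 1), by ring⟩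
  have h4 : ∀ x : LaurentLoop R, IsParity x.coeff → IsParity (timeDer i x).coeff := fun x hx => by
    cases i with
    | t m => exact (isParity_sh (heven m) hx).rsmul _
    | rho => exact isParity_zero
    | tb m => exact isParity_zero
    | s k => exact isParity_zero
  have h5 : ∀ x : LaurentLoop R, IsParity x.coeff → IsParity (timeMul v x).coeff := fun x hx => by
    rw [timeMul_apply]
    refine Finset.sum_induction _ (fun y : LaurentLoop R => IsParity y.coeff)
      (fun a b ha hb => isParity_add ha hb) isParity_zero fun m _ => ?_
    exact (isParity_sh (heven m) hx).rsmul _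
  refine isParity_sub (isParity_sub ?_ (h4 (hY v) (isParity_hY v)))
    (h5 (rhsY v s i) (isParity_rhsY v s i))
  exact isParity_add (isParity_sub (isParity_neg (isParity_comm (isParity_hA v s i)
    (isParity_hS v))) (isParity_zsmul _ (isParity_sh (even_vdeg s i) (isParity_add
    (isParity_eul (isParity_hS v)) (isParity_zsmul _ (isParity_hS v))))))
    (isParity_eul (isParity_hA v s i))

/-- The coefficients `a` of a loop of standard shape. -/
def entryA (x : LaurentLoop R) (n : ℕ) : R := (-Complex.I) • x.coeff (2 * n + 2) 1 1

/-- The coefficients `b` of a loop of standard shape. -/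
def entryB (x : LaurentLoop R) (n : ℕ) : R := (1 / 2 : ℂ) • x.coeff (2 * n + 1) 1 0

/-- The coefficients `c` of a loop of standard shape. -/
def entryC (x : LaurentLoop R) (n : ℕ) : R := (1 / 2 : ℂ) • x.coeff (2 * n + 1) 0 1

theorem two_mul_half_smul (r : R) : 2 * ((1 / 2 : ℂ) • r) = r := by
  rw [two_mul, ← add_smul]
  norm_num

/-- A loop of the right parity without terms of degree less than one has the standard shape. -/
theorem mkLoop_entries {x : LaurentLoop R} (hx : GeDeg 1 x) (hp : IsParity x.coeff) :
    mkLoop (entryA x) (entryB x) (entryC x) = x.coeff := by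
  funext n
  by_cases hn : n < 1
  · rw [hx n hn, mkLoop_of_nonpos _ _ _ _ (by omega)]
  have htr : x.coeff n 0 0 = -x.coeff n 1 1 := by
    have := hp.1 n
    rw [Matrix.trace_fin_two] at this
    exact eq_neg_of_add_eq_zero_left this
  rcases Int.even_or_odd' n with ⟨k, hk | hk⟩
  · obtain ⟨j, rfl⟩ : ∃ j : ℕ, k = j + 1 := ⟨(k - 1).toNat, by omega⟩
    obtain rfl : n = 2 * (j : ℤ) + 2 := by omega
    have he : Even (2 * (j : ℤ) + 2) := ⟨j + 1, by ring⟩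
    have ho : ¬ Odd (2 * (j : ℤ) + 2) := by simp
    have e1 : Complex.I • entryA x j = x.coeff (2 * j + 2) 1 1 := by
      simp [entryA, smul_smul]
    have := hp.2.2 _ he
    ext a b
    fin_cases a <;> fin_cases b
    · simpa [mkLoop, evenSer_apply, e1] using htr.symm
    · simpa [mkLoop, oddSer, ho] using this.1.symm
    · simpa [mkLoop, oddSer, ho] using this.2.symm
    · simpa [mkLoop, evenSer_apply] using e1
  · obtain ⟨j, rfl⟩ : ∃ j : ℕ, k = j := ⟨k.toNat, by omega⟩
    subst hk
    have ho : Odd (2 * (j : ℤ) + 1) := ⟨j, rfl⟩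
    have he : ¬ Even (2 * (j : ℤ) + 1) := by simp
    have := hp.2.1 _ ho
    ext a b
    fin_cases a <;> fin_cases b
    · simpa [mkLoop, evenSer, he] using this.1.symm
    · exact (congrArg (2 * ·) (oddSer_apply (entryC x) j)).trans (two_mul_half_smul _)
    · exact (congrArg (2 * ·) (oddSer_apply (entryB x) j)).trans (two_mul_half_smul _)
    · simpa [mkLoop, evenSer, he] using this.2.symm

end Shape

/-! ### The relations as identities of Laurent series -/

section Relations

variable {N : ℕ} {R : Type*} [CommRing R]

theorem coeff_mul_entry (x y : LaurentLoop R) (n : ℤ) (a b : Fin 2) : (x * y).coeff n a b =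
    serMul (fun m => x.coeff m a 0) (fun m => y.coeff m 0 b) n +
      serMul (fun m => x.coeff m a 1) (fun m => y.coeff m 1 b) n := by
  have hfin : ∀ c : Fin 2, (fun m : ℤ => x.coeff m a c * y.coeff (n - m) c b).HasFiniteSupport := by
    intro c
    obtain ⟨A, hA⟩ := bddBelow x
    obtain ⟨B, hB⟩ := bddBelow y
    refine (Set.finite_Icc A (n - B)).subset fun m hm => ⟨?_, ?_⟩
    · by_contra h
      exact hm (by simp [hA m (by omega)])
    · by_contra h
      exact hm (by simp [hB (n - m) (by omega)])
  have e := map_finsum ((Pi.evalAddMonoidHom (fun _ : Fin 2 => R) b).comp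
    (Pi.evalAddMonoidHom (fun _ : Fin 2 => Fin 2 → R) a)) (finite_support_mul x y n)
  rw [coeff_mul_eq_finsum]
  refine e.trans ?_
  simp only [serMul]
  rw [← finsum_add_distrib (hfin 0) (hfin 1)]
  refine finsum_congr fun m => ?_
  change (x.coeff m * y.coeff (n - m)) a b = _
  rw [Matrix.mul_apply, Fin.sum_univ_two]

/-- The square of a trace free loop is a scalar, by the theorem of Cayley and Hamilton. -/
theorem coeff_sq_of_trace_eq_zero {x : LaurentLoop R} (hx : ∀ n, (x.coeff n).trace = 0) (n : ℤ) :
    (x * x).coeff n = (-loopDet x.coeff n) • (1 : Matrix (Fin 2) (Fin 2) R) := by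
  have h11 : (fun m => x.coeff m 1 1) = -fun m => x.coeff m 0 0 := by
    funext m
    have := hx m
    rw [Matrix.trace_fin_two] at this
    exact eq_neg_of_add_eq_zero_right this
  have hfin : ∀ a b c d : Fin 2,
      (fun m : ℤ => x.coeff m a b * x.coeff (n - m) c d).HasFiniteSupport := by
    intro a b c d
    obtain ⟨A, hA⟩ := bddBelow x
    refine (Set.finite_Icc A (n - A)).subset fun m hm => ⟨?_, ?_⟩
    · by_contra h
      exact hm (by simp [hA m (by omega)])
    · by_contra h
      exact hm (by simp [hA (n - m) (by omega)])
  have hdet : loopDet x.coeff n = serMul (fun m => x.coeff m 0 0) (fun m => x.coeff m 1 1) n -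
      serMul (fun m => x.coeff m 0 1) (fun m => x.coeff m 1 0) n := by
    simp only [loopDet, serMul]
    rw [← finsum_sub_distrib (hfin _ _ _ _) (hfin _ _ _ _)]
  have hneg : ∀ f g : Ser R, serMul f (-g) n = -serMul f g n := fun f g => by rw [serMul_neg]; rfl
  rw [hdet, h11, hneg]
  ext a b
  rw [coeff_mul_entry]
  fin_cases a <;> fin_cases b
  · simp [add_comm]
  · simp only [Fin.zero_eta, Fin.mk_one, h11, hneg, serMul_comm (fun m => x.coeff m 0 0)]
    simp
  · simp only [Fin.zero_eta, Fin.mk_one, h11, neg_serMul, Pi.neg_apply,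
      serMul_comm (fun m => x.coeff m 1 0)]
    simp
  · simp only [Fin.mk_one, h11, neg_serMul, Pi.neg_apply, hneg,
      serMul_comm (fun m => x.coeff m 1 0)]
    simp [add_comm]

variable [Algebra ℂ R] (v : Gen N → R)

theorem relDet_iff (γ : ℂ) : RelDet v γ ↔
    ∀ n, loopDet (fieldY v) n + (if n = 2 then algebraMap ℂ R (4 * γ) else 0) = 0 := by
  have htr : ∀ n, ((hY v).coeff n).trace = 0 := (isParity_mkLoop _ _ _).1
  have e : ∀ n, (monomial 2 (algebraMap ℂ (Matrix (Fin 2) (Fin 2) R) (4 * γ))).coeff n =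
      (if n = 2 then algebraMap ℂ R (4 * γ) else 0) • (1 : Matrix (Fin 2) (Fin 2) R) := fun n => by
    rw [coeff_monomial]
    split_ifs
    · rw [algebraMap_smul, Algebra.algebraMap_eq_smul_one]
    · rw [zero_smul]
  have hinj : ∀ r t : R, r • (1 : Matrix (Fin 2) (Fin 2) R) = t • 1 ↔ r = t := fun r t =>
    ⟨fun h => by simpa using congrFun (congrFun h 0) 0, fun h => by rw [h]⟩
  rw [RelDet, LaurentLoop.ext_iff]
  refine forall_congr' fun n => ?_
  rw [coeff_sq_of_trace_eq_zero htr, e, hinj]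
  change -loopDet (fieldY v) n = _ ↔ _
  rw [neg_eq_iff_add_eq_zero]

theorem affBracket_hatS_hatY : (affBracket (hatS v) (hatY v)).2 =
    (sh (-1) (hS v * hY v - hY v * hS v + eul (hY v) - hY v)).coeff := by
  have hyc : shift (-1) (fieldY v) = (sh (-1) (hY v)).coeff := by
    funext n
    simp [shift, hY]
  have one : lamPow R 0 = (1 : ℤ) • lamPow R 0 := (one_smul _ _).symm
  have e : sh (-1) (hS v * hY v - hY v * hS v + eul (hY v) - hY v) =
      hS v * sh (-1) (hY v) - sh (-1) (hY v) * hS v + eul (sh (-1) (hY v)) := by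
    rw [mul_sh, sh_mul, eul_sh, map_sub, map_add, map_sub]
    module
  funext n
  simp only [affBracket, hatS, hatY, hyc]
  rw [show fieldS v = (hS v).coeff from rfl, loopBracket_coeff, one, serSmul_monomial, e]
  simp [serSmul, euler, -zsmul_eq_mul]

theorem relLift_iff : RelLift v ↔ ∀ n i j, (affBracket (hatS v) (hatY v)).2 n i j = 0 := by
  have h : RelLift v ↔ hS v * hY v - hY v * hS v + eul (hY v) - hY v = 0 := by
    rw [RelLift, ← sub_eq_zero]
    constructor <;> intro h <;> rw [← h] <;> abel
  rw [h, affBracket_hatS_hatY]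
  constructor
  · intro h n i j
    rw [h, map_zero]
    rfl
  · intro h
    ext n i j
    have := h (n - 1) i j
    rwa [coeff_sh, show n - 1 - -1 = n by ring] at this

end Relations

/-! ### Linear maps applied to the coefficients -/

section LinearMaps

variable {N K : ℕ} {P R : Type*} [CommRing P] [CommRing R] [Algebra ℂ P] [Algebra ℂ R]

/-- A linear map applied to all coefficients. -/
def mapL (δ : P →ₗ[ℂ] R) : LaurentLoop P →+ LaurentLoop R := mapC δ.toAddMonoidHom

@[simp] theorem coeff_mapL (δ : P →ₗ[ℂ] R) (x : LaurentLoop P) (n : ℤ) (a b : Fin 2) :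
    (mapL δ x).coeff n a b = δ (x.coeff n a b) := rfl

theorem mapL_sh (δ : P →ₗ[ℂ] R) (p : ℤ) (x : LaurentLoop P) : mapL δ (sh p x) = sh p (mapL δ x) :=
  mapC_sh _ _ _

theorem mapL_eul (δ : P →ₗ[ℂ] R) (x : LaurentLoop P) : mapL δ (eul x) = eul (mapL δ x) :=
  mapC_eul _ _

theorem mapL_mkLoop (δ : P →ₗ[ℂ] R) (a b c : ℕ → P) (n : ℤ) (i j : Fin 2) :
    δ (mkLoop a b c n i j) =
      mkLoop (fun k => δ (a k)) (fun k => δ (b k)) (fun k => δ (c k)) n i j := by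
  have he : ∀ f : ℕ → P, δ (evenSer f n) = evenSer (fun k => δ (f k)) n := fun f => by
    simp only [evenSer]
    split_ifs <;> simp
  have ho : ∀ f : ℕ → P, δ (oddSer f n) = oddSer (fun k => δ (f k)) n := fun f => by
    simp only [oddSer]
    split_ifs <;> simp
  fin_cases i <;> fin_cases j <;> simp [mkLoop, he, ho, two_mul]

theorem mapL_algHom_mul (π : P →ₐ[ℂ] R) (x y : LaurentLoop P) :
    mapL π.toLinearMap (x * y) = mapL π.toLinearMap x * mapL π.toLinearMap y := by
  ext n : 1
  have e : (mapL π.toLinearMap (x * y)).coeff n =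
      (AddMonoidHom.mapMatrix π.toLinearMap.toAddMonoidHom) ((x * y).coeff n) := rfl
  rw [e, coeff_mul_eq_finsum, coeff_mul_eq_finsum, map_finsum _ (finite_support_mul _ _ n)]
  refine finsum_congr fun m => ?_
  ext a b
  simp [Matrix.mul_apply, Fin.sum_univ_two]

theorem mapL_algHom_smul (π : P →ₐ[ℂ] R) (p : P) (x : LaurentLoop P) :
    mapL π.toLinearMap (p • x) = π p • mapL π.toLinearMap x := by
  ext n : 1
  ext a b
  simp

theorem mapL_algHom_hY (π : P →ₐ[ℂ] R) (x : Gen N → P) :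
    mapL π.toLinearMap (hY x) = hY fun g => π (x g) := by
  ext n : 1
  ext a b
  exact mapL_mkLoop π.toLinearMap _ _ _ n a b

theorem mapL_algHom_hD (π : P →ₐ[ℂ] R) (x : Gen N → P) :
    mapL π.toLinearMap (hD x) = hD fun g => π (x g) := by
  ext n : 1
  ext a b
  exact mapL_mkLoop π.toLinearMap _ _ _ n a b

theorem mapL_algHom_hS (π : P →ₐ[ℂ] R) (x : Gen N → P) :
    mapL π.toLinearMap (hS x) = hS fun g => π (x g) := by
  rw [hS_eq, hS_eq, map_add, mapL_algHom_hD, timeMul_apply, timeMul_apply, map_sum]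
  simp only [mapL_algHom_smul, mapL_sh, mapL_algHom_hY]
  simp only [timeCoef, map_smul]

end LinearMaps

/-! ### Evaluation of the relations -/

section Relations

variable {N : ℕ} {P R : Type*} [CommRing P] [CommRing R] [Algebra ℂ P] [Algebra ℂ R]

/-- The relation which prescribes the determinant of `Y`, in degree `n`. -/
def detRel (x : Gen N → P) (γ : ℂ) (n : ℤ) : P :=
  loopDet (fieldY x) n + if n = 2 then algebraMap ℂ P (4 * γ) else 0

/-- The relation saying that the lifts of `S` and `Y` commute, in degree `n`. -/
def liftRel (x : Gen N → P) (n : ℤ) (i j : Fin 2) : P := (affBracket (hatS x) (hatY x)).2 n i j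

theorem detRel_eq (x : Gen N → P) (γ : ℂ) (n : ℤ) : detRel x γ n =
    -(hY x * hY x).coeff n 0 0 + if n = 2 then algebraMap ℂ P (4 * γ) else 0 := by
  rw [coeff_sq_of_trace_eq_zero (isParity_hY x).1]
  simp only [Matrix.smul_apply, Matrix.one_apply_eq, smul_eq_mul, mul_one, neg_neg]
  rfl

theorem liftRel_eq (x : Gen N → P) (n : ℤ) (i j : Fin 2) : liftRel x n i j =
    (sh (-1) (hS x * hY x - hY x * hS x + eul (hY x) - hY x)).coeff n i j := by
  rw [← affBracket_hatS_hatY]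
  rfl

theorem algHom_detRel (π : P →ₐ[ℂ] R) (x : Gen N → P) (γ : ℂ) (n : ℤ) :
    π (detRel x γ n) = detRel (fun g => π (x g)) γ n := by
  rw [detRel_eq, detRel_eq, ← mapL_algHom_hY, ← mapL_algHom_mul, map_add, map_neg]
  congr 1
  split_ifs <;> simp

theorem algHom_liftRel (π : P →ₐ[ℂ] R) (x : Gen N → P) (n : ℤ) (i j : Fin 2) :
    π (liftRel x n i j) = liftRel (fun g => π (x g)) n i j := by
  rw [liftRel_eq, liftRel_eq, ← mapL_algHom_hY, ← mapL_algHom_hS, ← mapL_algHom_mul,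
    ← mapL_algHom_mul, ← mapL_eul, ← map_sub, ← map_add, ← map_sub, ← mapL_sh]
  rfl

theorem neg_affBracket (x y : Aff R) : affBracket (-x) y = -affBracket x y := by
  have h : ∀ x y : Aff R, affBracket y x = -affBracket x y := fun x y => by
    have h2 : loopBracket y.2 x.2 = -loopBracket x.2 y.2 := by
      funext n
      rw [Pi.neg_apply, loopBracket, loopBracket, ← finsum_neg_distrib,
        ← finsum_comp_equiv (Equiv.subLeft n)]
      refine finsum_congr fun m => ?_
      simp
    refine Prod.ext ?_ ?_
    · simp only [affBracket, Prod.fst_neg, neg_sub]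
    · simp only [affBracket, Prod.snd_neg, h2]
      abel
  rw [h, affBracket_neg, h x y, neg_neg]

theorem loopDet_fieldYbar (x : Gen N → P) (n : ℤ) :
    loopDet (fieldYbar x) n = loopDet (fieldY (swapGen x)) (-n) := by
  rw [loopDet, loopDet, ← finsum_comp_equiv (Equiv.neg ℤ)]
  refine finsum_congr fun m => ?_
  simp only [Equiv.neg_apply, fieldYbar_eq, neg_neg]
  rw [show -(n - -m) = -n - m by ring]

theorem affBracket_hatSbar_hatYbar (x : Gen N → P) (n : ℤ) (i j : Fin 2) :
    (affBracket (hatSbar x) (hatYbar x)).2 n i j = -liftRel (swapGen x) (-n) i j := by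
  have h := affBracket_reflect (hatSbar x) (hatYbar x)
  rw [affReflect_hatSbar, affReflect_hatYbar, neg_affBracket] at h
  have := congrFun (congrArg Prod.snd h) (-n)
  simp only [affReflect, reflect, neg_neg] at this
  rw [← this]
  rfl

/-- The conjugate relations are, up to sign, the relations for the conjugate variables. -/
theorem mem_relations_iff {γ : ℝ} {p : MvPolynomial (Gen N) ℂ} :
    p ∈ relations N γ ↔ ∃ n : ℤ, p = detRel MvPolynomial.X γ n ∨
      p = detRel (swapGen MvPolynomial.X) γ n ∨
      ∃ i j : Fin 2, p = liftRel MvPolynomial.X n i j ∨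
        p = -liftRel (swapGen MvPolynomial.X) n i j := by
  have hneg : ∀ n : ℤ, n = -2 ↔ -n = 2 := fun n => by omega
  have e : ∀ n : ℤ, loopDet (fieldYbar (MvPolynomial.X : Gen N → MvPolynomial (Gen N) ℂ)) n +
      (if n = -2 then MvPolynomial.C (4 * (γ : ℂ)) else 0) =
      detRel (swapGen MvPolynomial.X) γ (-n) := fun n => by
    rw [loopDet_fieldYbar, detRel]
    simp only [hneg n]
    rfl
  simp only [relations, Set.mem_ofPred_eq, e, affBracket_hatSbar_hatYbar]
  constructor
  · rintro ⟨n, h | h | ⟨i, j, h | h⟩⟩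
    · exact ⟨n, Or.inl h⟩
    · exact ⟨-n, Or.inr (Or.inl h)⟩
    · exact ⟨n, Or.inr (Or.inr ⟨i, j, Or.inl h⟩)⟩
    · exact ⟨-n, Or.inr (Or.inr ⟨i, j, Or.inr h⟩)⟩
  · rintro ⟨n, h | h | ⟨i, j, h | h⟩⟩
    · exact ⟨n, Or.inl h⟩
    · exact ⟨-n, Or.inr (Or.inl (by rwa [neg_neg]))⟩
    · exact ⟨n, Or.inr (Or.inr ⟨i, j, Or.inl h⟩)⟩
    · exact ⟨-n, Or.inr (Or.inr ⟨i, j, Or.inr (by rwa [neg_neg])⟩)⟩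

theorem algHom_swapGen (π : P →ₐ[ℂ] R) (x : Gen N → P) :
    (fun g => π (swapGen x g)) = swapGen fun g => π (x g) := by
  funext g
  cases g <;> simp [swapGen]

/-- An evaluation respects the relations if and only if the values satisfy the two relations and
their conjugates. -/
theorem relations_vanish_iff {γ : ℝ} (π : MvPolynomial (Gen N) ℂ →ₐ[ℂ] R) {v : Gen N → R}
    (hv : ∀ g, π (MvPolynomial.X g) = v g) : (∀ p ∈ relations N γ, π p = 0) ↔
      (RelDet v γ ∧ RelLift v) ∧ (RelDet (swapGen v) γ ∧ RelLift (swapGen v)) := by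
  have hv' : (fun g => π (MvPolynomial.X g)) = v := funext hv
  rw [relDet_iff, relLift_iff, relDet_iff, relLift_iff]
  change _ ↔ ((∀ n, detRel v γ n = 0) ∧ ∀ n i j, liftRel v n i j = 0) ∧
    ((∀ n, detRel (swapGen v) γ n = 0) ∧ ∀ n i j, liftRel (swapGen v) n i j = 0)
  constructor
  · intro h
    refine ⟨⟨fun n => ?_, fun n i j => ?_⟩, ⟨fun n => ?_, fun n i j => ?_⟩⟩
    · rw [← hv', ← algHom_detRel]
      exact h _ (mem_relations_iff.2 ⟨n, Or.inl rfl⟩)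
    · rw [← hv', ← algHom_liftRel]
      exact h _ (mem_relations_iff.2 ⟨n, Or.inr (Or.inr ⟨i, j, Or.inl rfl⟩)⟩)
    · rw [← hv', ← algHom_swapGen, ← algHom_detRel]
      exact h _ (mem_relations_iff.2 ⟨n, Or.inr (Or.inl rfl)⟩)
    · rw [← hv', ← algHom_swapGen, ← algHom_liftRel, ← neg_eq_zero, ← map_neg]
      exact h _ (mem_relations_iff.2 ⟨n, Or.inr (Or.inr ⟨i, j, Or.inr rfl⟩)⟩)
  · rintro ⟨⟨h1, h2⟩, h3, h4⟩ p hp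
    obtain ⟨n, rfl | rfl | ⟨i, j, rfl | rfl⟩⟩ := mem_relations_iff.1 hp
    · rw [algHom_detRel, hv', h1]
    · rw [algHom_detRel, algHom_swapGen, hv', h3]
    · rw [algHom_liftRel, hv', h2]
    · rw [map_neg, algHom_liftRel, algHom_swapGen, hv', h4, neg_zero]

end Relations

/-! ### The flows on the variables preserve the relations -/

section Flows

variable {N K : ℕ} {P R : Type*} [CommRing P] [CommRing R] [Algebra ℂ P] [Algebra ℂ R]

/-- The derivatives of the variables along the flow of index `i`, as the structure equations
prescribe them. -/
def flowVal (v : Gen N → R) (s : Sgn) (i : Idx N K) : Gen N → R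
  | .t m => FormalDiff.coframe (.t m) i
  | .tb m => FormalDiff.coframe (.tb m) i
  | .a n => entryA (rhsY v s i) n
  | .b n => entryB (rhsY v s i) n
  | .c n => entryC (rhsY v s i) n
  | .abar n => -entryA (rhsY (swapGen v) s.opp (swapIdx i)) n
  | .bbar n => entryC (rhsY (swapGen v) s.opp (swapIdx i)) n
  | .cbar n => entryB (rhsY (swapGen v) s.opp (swapIdx i)) n
  | .sa n => entryA (rhsD v s i) n
  | .sb n => entryB (rhsD v s i) n
  | .sc n => entryC (rhsD v s i) n
  | .sabar n => entryA (rhsD (swapGen v) s.opp (swapIdx i)) n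
  | .sbbar n => -entryC (rhsD (swapGen v) s.opp (swapIdx i)) n
  | .scbar n => -entryB (rhsD (swapGen v) s.opp (swapIdx i)) n
  | .u n => rhsU v s i (s.val * (2 * n))

theorem Sgn.opp_opp (s : Sgn) : s.opp.opp = s := by cases s <;> rfl

theorem rhsU_swap (v : Gen N → R) (s : Sgn) (i : Idx N K) (n : ℤ) :
    rhsU (swapGen v) s.opp (swapIdx i) n = rhsU v s i (-n) := by
  have hl : ∀ p q : ℤ, lamPow R (-p) q = lamPow R p (-q) := fun p q => by
    rw [← reflect_lamPow]
    rfl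
  have h1 : vcoef s.opp (swapIdx i) = -vcoef s i := by
    cases i <;> cases s <;> simp [vcoef, swapIdx, Sgn.opp, Sgn.val]
  have h2 : vdeg s.opp (swapIdx i) = -vdeg s i := by
    cases i <;> cases s <;> simp [vdeg, swapIdx, Sgn.opp, Sgn.val]
  rw [rhsU, rhsU, h1, h2, confDot_swap, hl, Pi.neg_apply, reflect]
  rw [show -(n - -vdeg s i) = -n - vdeg s i by ring]
  module

/-- The reflection carries flows to flows. -/
theorem swapGen_flowVal (v : Gen N → R) (s : Sgn) (i : Idx N K) :
    swapGen (flowVal v s i) = flowVal (swapGen v) s.opp (swapIdx i) := by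
  have ht : ∀ m, (FormalDiff.coframe (.tb m) : Idx N K → R) i =
      FormalDiff.coframe (.t m) (swapIdx i) := fun m => by
    classical
    cases i <;> simp [FormalDiff.coframe, swapIdx, Pi.single_apply]
  have htb : ∀ m, (FormalDiff.coframe (.t m) : Idx N K → R) i =
      FormalDiff.coframe (.tb m) (swapIdx i) := fun m => by
    classical
    cases i <;> simp [FormalDiff.coframe, swapIdx, Pi.single_apply]
  funext g
  cases g with
  | t m => exact ht m
  | tb m => exact htb m
  | u n =>
    have : -(s.opp.val * (2 * (n : ℤ))) = s.val * (2 * n) := by cases s <;> simp [Sgn.opp, Sgn.val]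
    rw [flowVal, rhsU_swap, this]
    rfl
  | _ n => simp [swapGen, flowVal, swapGen_swapGen, Sgn.opp_opp]

/-- The map `δ` is the derivation along `π` which gives the variables `x` the derivatives prescribed
by the flow of index `i` at the values `v` of the variables.  Maps along `π` are needed since the
flows are first defined on polynomials, with values in the quotient by the relations. -/
structure IsFlowAlong (π : P →ₐ[ℂ] R) (δ : P →ₗ[ℂ] R) (x : Gen N → P) (v : Gen N → R) (s : Sgn)
    (i : Idx N K) : Prop where
  leibniz : ∀ a b, δ (a * b) = δ a * π b + π a * δ b
  base : ∀ g, π (x g) = v g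
  flow : ∀ g, δ (x g) = flowVal v s i g

namespace IsFlowAlong

variable {π : P →ₐ[ℂ] R} {δ : P →ₗ[ℂ] R} {x : Gen N → P} {v : Gen N → R} {s : Sgn} {i : Idx N K}

theorem swap (h : IsFlowAlong π δ x v s i) :
    IsFlowAlong π δ (swapGen x) (swapGen v) s.opp (swapIdx i) where
  leibniz := h.leibniz
  base g := by
    have := congrFun (algHom_swapGen π x) g
    simp only [h.base] at this
    exact this
  flow g := by
    rw [← swapGen_flowVal]
    cases g <;> simp [swapGen, h.flow]

theorem map_algebraMap (h : IsFlowAlong π δ x v s i) (z : ℂ) : δ (algebraMap ℂ P z) = 0 := by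
  have := h.leibniz 1 1
  rw [mul_one, map_one π, mul_one, one_mul, left_eq_add] at this
  rw [Algebra.algebraMap_eq_smul_one, map_smul, this, smul_zero]

theorem mapL_mul (h : IsFlowAlong π δ x v s i) (y z : LaurentLoop P) :
    mapL δ (y * z) = mapL δ y * mapL π.toLinearMap z + mapL π.toLinearMap y * mapL δ z :=
  mapC_mul _ _ h.leibniz y z

theorem mapL_smul (h : IsFlowAlong π δ x v s i) (p : P) (y : LaurentLoop P) :
    mapL δ (p • y) = δ p • mapL π.toLinearMap y + π p • mapL δ y := by
  ext n : 1
  ext a b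
  simp [h.leibniz]

theorem base_hY (h : IsFlowAlong π δ x v s i) : mapL π.toLinearMap (hY x) = hY v := by
  rw [mapL_algHom_hY]
  simp only [h.base]

theorem base_hS (h : IsFlowAlong π δ x v s i) : mapL π.toLinearMap (hS x) = hS v := by
  rw [mapL_algHom_hS]
  simp only [h.base]

/-- The prescribed derivatives of the variables amount to the equation for `Y`, since the right hand
side of that equation has the shape of `Y`. -/
theorem flow_hY (h : IsFlowAlong π δ x v s i) (hv : RelLift v) : mapL δ (hY x) = rhsY v s i := by
  ext n : 1
  rw [← mkLoop_entries (geDeg_rhsY hv i) (isParity_rhsY v s i)]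
  ext a b
  refine (mapL_mkLoop δ _ _ _ n a b).trans ?_
  simp only [h.flow]
  rfl

theorem flow_hD (h : IsFlowAlong π δ x v s i) (hK : N + 1 ≤ K) (hv : RelLift v) :
    mapL δ (hD x) = rhsD v s i := by
  ext n : 1
  rw [← mkLoop_entries (geDeg_rhsD hK hv i) (isParity_rhsD v s i)]
  ext a b
  refine (mapL_mkLoop δ _ _ _ n a b).trans ?_
  simp only [h.flow]
  rfl

theorem flow_hS (h : IsFlowAlong π δ x v s i) (hK : N + 1 ≤ K) (hv : RelLift v) :
    mapL δ (hS x) = rhsS v s i := by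
  have e : rhsS v s i = timeDer i (hY v) + timeMul v (rhsY v s i) + rhsD v s i := by
    rw [rhsD]
    abel
  have hπ : ∀ m, π (timeCoef x m) = timeCoef v m := fun m => by
    rw [timeCoef, map_smul, h.base, timeCoef]
  have hδ : ∀ m, δ (timeCoef x m) =
      (Complex.I / 2 * (2 * (m : ℂ) + 1)) • FormalDiff.coframe (.t m) i := fun m => by
    rw [timeCoef, map_smul, h.flow]
    rfl
  have ht : ∑ m : Fin (N + 1), δ (timeCoef x m) • sh (-(2 * (m : ℤ) + 2)) (hY v) =
      timeDer i (hY v) := by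
    classical
    simp only [hδ]
    cases i with
    | t l =>
      rw [Finset.sum_eq_single l]
      · simp [FormalDiff.coframe, timeDer, Algebra.algebraMap_eq_smul_one]
      · intro m _ hm
        have : (Idx.t l : Idx N K) ≠ .t m := fun h => hm (by cases h; rfl)
        simp [FormalDiff.coframe, Pi.single_eq_of_ne this]
      · simp
    | rho => simp [FormalDiff.coframe, timeDer]
    | tb m => simp [FormalDiff.coframe, timeDer]
    | s k => simp [FormalDiff.coframe, timeDer]
  rw [hS_eq, map_add, h.flow_hD hK hv, e, timeMul_apply, map_sum]
  simp only [h.mapL_smul, mapL_sh, h.base_hY, h.flow_hY hv, hπ]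
  rw [Finset.sum_add_distrib, ht, timeMul_apply]

/-- The flows preserve the relation for the determinant: the derivative of the scalar series `Y²` is
its commutator with the Maurer-Cartan form, which is zero, and a term which vanishes since `Y²` is
homogeneous of degree two. -/
theorem map_detRel (h : IsFlowAlong π δ x v s i) {γ : ℂ} (hv : RelLift v) (hd : RelDet v γ)
    (n : ℤ) : δ (detRel x γ n) = 0 := by
  have hc : (if n = 2 then algebraMap ℂ P (4 * γ) else 0) =
      algebraMap ℂ P (if n = 2 then 4 * γ else 0) := by split_ifs <;> simp
  have key : mapL δ (hY x * hY x) = 0 := by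
    rw [h.mapL_mul, h.base_hY, h.flow_hY hv]
    have hm : hY v * hY v = algebraMap ℂ R (4 * γ) • sh 2 1 := by
      rw [hd]
      ext n : 1
      have h1 : (1 : LaurentLoop R).coeff (n - 2) = if n - 2 = 0 then 1 else 0 :=
        coeff_monomial 0 1 (n - 2)
      rw [coeff_monomial, coeff_smul, coeff_sh, h1]
      simp only [sub_eq_zero]
      split_ifs
      · rw [algebraMap_smul, Algebra.algebraMap_eq_smul_one]
      · rw [smul_zero]
    have hm1 : hA v s i * (hY v * hY v) = hY v * hY v * hA v s i := by
      rw [hm, mul_smul_comm, smul_mul_assoc, mul_sh, sh_mul, mul_one, one_mul]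
    have hm2 : eul (hY v) * hY v + hY v * eul (hY v) = (2 : ℤ) • (hY v * hY v) := by
      have h1 : eul (1 : LaurentLoop R) = 0 := by
        have := eul_mul (1 : LaurentLoop R) 1
        simpa using this
      rw [← eul_mul, hm, eul_smul, eul_sh, h1, map_zero, zero_add, smul_comm]
    have : rhsY v s i * hY v + hY v * rhsY v s i =
        -(hA v s i * (hY v * hY v) - hY v * hY v * hA v s i) -
        vcoef s i • sh (vdeg s i)
          (eul (hY v) * hY v + hY v * eul (hY v) - (2 : ℤ) • (hY v * hY v)) := by
      simp only [rhsY, mul_sub, sub_mul, mul_neg, neg_mul, mul_smul_comm, smul_mul_assoc, sh_mul,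
        mul_sh, map_sub, map_add, map_zsmul, mul_assoc]
      module
    rw [this, hm1, hm2]
    simp
  have := congrFun (congrFun (congrArg (fun y => y.coeff n) key) 0) 0
  rw [detRel_eq, hc, map_add, h.map_algebraMap, add_zero, map_neg, neg_eq_zero]
  exact this

/-- The flows preserve the relation saying that the lifts of `S` and `Y` commute. -/
theorem map_liftRel (h : IsFlowAlong π δ x v s i) (hK : N + 1 ≤ K) (hv : RelLift v) (n : ℤ)
    (a b : Fin 2) : δ (liftRel x n a b) = 0 := by
  have key : mapL δ (hS x * hY x - hY x * hS x + eul (hY x) - hY x) = 0 := by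
    rw [map_sub, map_add, map_sub, h.mapL_mul, h.mapL_mul, mapL_eul, h.base_hY, h.base_hS,
      h.flow_hY hv, h.flow_hS hK hv]
    have hSY : hS v * hY v = hY v * hS v + hY v - eul (hY v) := by
      rw [add_sub_assoc, ← hv]
      abel
    have hSY' : ∀ z, hS v * (hY v * z) = hY v * (hS v * z) + hY v * z - eul (hY v) * z := by
      intro z
      rw [← mul_assoc, hSY]
      simp only [add_mul, sub_mul, mul_assoc]
    have hESY : eul (hS v) * hY v + hS v * eul (hY v) =
        eul (hY v) * hS v + hY v * eul (hS v) + eul (hY v) - eul (eul (hY v)) := by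
      rw [← eul_mul, hSY, map_sub, map_add, eul_mul]
    have hESY' : eul (hS v) * hY v = eul (hY v) * hS v + hY v * eul (hS v) + eul (hY v)
        - eul (eul (hY v)) - hS v * eul (hY v) := by
      rw [← hESY]
      abel
    -- expand, and move every `S` to the right of `Y`
    simp only [rhsY, rhsS, mul_sub, sub_mul, mul_neg, neg_mul, mul_smul_comm, smul_mul_assoc,
      sh_mul, mul_sh, map_sub, map_add, map_neg, map_zsmul, mul_assoc, mul_add, add_mul, eul_mul,
      eul_sh, hSY, hSY', hESY', smul_add, smul_sub]
    module
  rw [liftRel_eq]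
  have := congrFun (congrFun (congrArg (fun y => y.coeff (n + 1)) key) a) b
  rw [coeff_sh, sub_neg_eq_add]
  exact this

end IsFlowAlong

end Flows

/-! ### The Maurer-Cartan equation and the curvature of the connection form -/

section Hierarchy

variable {N K : ℕ} {R : Type*} [CommRing R] [Algebra ℂ R] {v : Gen N → R} {s : Sgn}

theorem rhsU_eq_zero {n : ℤ} (hn : ¬ (0 ≤ s.val * n ∧ Even n)) (i : Idx N K) :
    rhsU v s i n = 0 := by
  cases i with
  | s k =>
    have h1 : n ≠ vdeg s (.s k : Idx N K) := by
      rintro rfl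
      refine hn ⟨?_, even_vdeg s _⟩
      cases s <;> simp [vdeg, Sgn.val]
    have h2 : ¬ (0 ≤ s.val * (n - vdeg s (.s k : Idx N K)) ∧
        Even (n - vdeg s (.s k : Idx N K))) := by
      rintro ⟨ha, hb⟩
      refine hn ⟨?_, by simpa using hb.add (even_vdeg s (.s k : Idx N K))⟩
      have : s.val * (n - vdeg s (.s k : Idx N K)) = s.val * n - 2 * (k : ℕ) := by
        cases s
        · simp [vdeg, Sgn.val]
        · simp only [vdeg, Sgn.val]
          ring
      omega
    have h3 : confSer v s (n - vdeg s (.s k : Idx N K)) = 0 := if_neg h2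
    have h4 : lamPow R (vdeg s (.s k : Idx N K)) n = 0 := Pi.single_eq_of_ne h1 _
    have h5 : lamPow R 0 (n - vdeg s (.s k : Idx N K)) = 0 :=
      Pi.single_eq_of_ne (sub_ne_zero.2 h1) _
    rw [rhsU, h4, confDot, Pi.add_apply, Pi.smul_apply, h5, euler, h3]
    simp
  | _ => simp [rhsU, vcoef]

/-- Derivations with the prescribed values on the variables satisfy the Killing field equations. -/
theorem killingHalf_of_flows {D : Idx N K → Derivation ℂ R R} (hK : N + 1 ≤ K) (hv : RelLift v)
    (hD : ∀ i g, D i (v g) = flowVal v s i g) : KillingHalf v s D := by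
  have h : ∀ i, IsFlowAlong (AlgHom.id ℂ R) (D i).toLinearMap v v s i := fun i =>
    { leibniz := fun a b => by simp [mul_comm, add_comm]
      base := fun g => rfl
      flow := hD i }
  refine ⟨fun i => (h i).flow_hY hv, fun i => (h i).flow_hS hK hv, fun i n => ?_⟩
  by_cases hn : 0 ≤ s.val * n ∧ Even n
  · obtain ⟨k, rfl⟩ : ∃ k : ℕ, n = s.val * (2 * k) := by
      obtain ⟨h0, l, rfl⟩ := hn
      refine ⟨(s.val * l).toNat, ?_⟩
      cases s <;> simp only [Sgn.val] at h0 ⊢ <;> omega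
    rw [confSer_apply, hD]
    rfl
  · rw [confSer, if_neg hn, map_zero, rhsU_eq_zero hn]

theorem killingHalf_swap_of_flows {D : Idx N K → Derivation ℂ R R} (hK : N + 1 ≤ K)
    (hv : RelLift (swapGen v)) (hD : ∀ i g, D i (v g) = flowVal v s i g) :
    KillingHalf (swapGen v) s.opp fun i => D (swapIdx i) := by
  refine killingHalf_of_flows hK hv fun i g => ?_
  have := congrFun (swapGen_flowVal v s (swapIdx i)) g
  rw [swapIdx_swapIdx] at this
  rw [← this]
  cases g <;> simp [swapGen, hD]

theorem loopComm_swap (i j : Idx N K) : loopComm v s j i = -loopComm v s i j := by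
  rw [loopComm, loopComm]
  abel

theorem loopComm_self (i : Idx N K) : loopComm v s i i = 0 := by
  rw [loopComm]
  abel

variable (v s) in
/-- The curvature of the connection form: the differential of `rho` has the component
`connCurv v s i j` along the `i`-th wedge the `j`-th coframe element. -/
def connCurv (i j : Idx N K) : R := (2 * Complex.I) • (loopComm v s i j).coeff 0 0 0

theorem connCurv_smul_rot (i j : Idx N K) : connCurv v s i j •
    !![algebraMap ℂ R (Complex.I / 2), 0; 0, -algebraMap ℂ R (Complex.I / 2)] +
      (loopComm v s i j).coeff 0 = 0 := by
  have h := isParity_loopComm v s i j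
  have htr := h.1 0
  rw [Matrix.trace_fin_two] at htr
  have hoff := h.2.2 0 Even.zero
  have e : connCurv v s i j * algebraMap ℂ R (Complex.I / 2) = -(loopComm v s i j).coeff 0 0 0 := by
    rw [connCurv, mul_comm, ← Algebra.smul_def, smul_smul]
    have : Complex.I / 2 * (2 * Complex.I) = -1 := by
      ring_nf
      exact Complex.I_sq
    rw [this, neg_one_smul]
  ext a b
  fin_cases a <;> fin_cases b
  · simp [e]
  · simp [hoff.1]
  · simp [hoff.2]
  · simp [e, htr]

/-- The Maurer-Cartan equation follows from the Killing field equations: the positive degrees are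
conjugate to the negative ones, and the part of degree zero, a diagonal matrix, is absorbed by the
differential of the connection form. -/
theorem loopCurv_connCurv_eq_zero {D : Idx N K → Derivation ℂ R R} (hK : N + 1 ≤ K)
    (hv : RelLift v) (hv' : RelLift (swapGen v)) (hD : KillingHalf v s D)
    (hD' : KillingHalf (swapGen v) s.opp fun i => D (swapIdx i)) (i j : Idx N K) :
    loopCurv v s D (connCurv v s) i j = 0 := by
  ext n : 1
  rw [coeff_zero]
  rcases lt_trichotomy n 0 with hn | rfl | hn
  · exact geDeg_loopCurv hK hv hD _ i j n hn
  · rw [coeff_zero_loopCurv, connCurv_smul_rot]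
  · rw [← neg_neg n, ← coeff_loopCurv_swap]
    exact geDeg_loopCurv hK hv' hD' _ _ _ (-n) (by omega)

/-- The Maurer-Cartan equation determines the curvature of the connection form. -/
theorem eq_connCurv {D : Idx N K → Derivation ℂ R R} {κ : Idx N K → Idx N K → R} {i j : Idx N K}
    (h : loopCurv v s D κ i j = 0) : κ i j = connCurv v s i j := by
  have h1 := coeff_zero_loopCurv (v := v) (s := s) (D := D) (κ := κ) i j
  rw [h, coeff_zero, ← connCurv_smul_rot (v := v) (s := s) i j] at h1
  have h2 := add_right_cancel h1
  rw [← sub_eq_zero, ← sub_smul] at h2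
  exact (sub_eq_zero.1 (smul_rot_eq_zero h2)).symm

end Hierarchy

/-! ### Existence and uniqueness of the exterior derivative -/

section Functions

variable {N K : ℕ} {γ : ℝ} {s : Sgn}

theorem coord_relations (N : ℕ) (γ : ℝ) : (RelDet (coord N γ) γ ∧ RelLift (coord N γ)) ∧
    (RelDet (swapGen (coord N γ)) γ ∧ RelLift (swapGen (coord N γ))) :=
  (relations_vanish_iff (Ideal.Quotient.mkₐ ℂ (Ideal.span (relations N γ))) fun _ => rfl).1
    fun _ hp => Ideal.Quotient.eq_zero_iff_mem.2 (Ideal.subset_span hp)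

theorem derivation_ext {E F : Derivation ℂ (Fn N γ) (Fn N γ)}
    (h : ∀ g, E (coord N γ g) = F (coord N γ g)) : E = F := by
  ext f
  obtain ⟨p, rfl⟩ := Ideal.Quotient.mk_surjective f
  induction p using MvPolynomial.induction_on with
  | C z =>
    exact (E.map_algebraMap z).trans (F.map_algebraMap z).symm
  | add p q hp hq => rw [map_add, map_add, map_add, hp, hq]
  | mul_X p g hp =>
    have := h g
    rw [coord] at this
    rw [map_mul, Derivation.leibniz, Derivation.leibniz, hp, this]

/-- The structure equations, with the conjugate equations replaced by equations for the conjugate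
variables, and with the form of the differentials of the coframe which they force. -/
theorem isExtendedCMC_iff (d : FormalDiff (Fn N γ) (Idx N K)) : IsExtendedCMC s d ↔
    ((∀ m i, d.D i (coord N γ (.t m)) = FormalDiff.coframe (.t m) i) ∧
      ∀ m i, d.D i (coord N γ (.tb m)) = FormalDiff.coframe (.tb m) i) ∧
    (KillingHalf (coord N γ) s d.D ∧ KillingHalf (swapGen (coord N γ)) s.opp d.swap.D) ∧
    HasVirasoroCoframe d (connCurv (coord N γ) s) ∧
    ∀ i j, loopCurv (coord N γ) s d.D (connCurv (coord N γ) s) i j = 0 := by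
  constructor
  · intro h
    have hc := hasVirasoroCoframe_of_curvature
      (fun m i j => by rw [← dOne_coframe, h.closed_t]; rfl)
      (fun m i j => by rw [← dOne_coframe, h.closed_tb]; rfl) h.maurer_cartan
    have hM := hc.curvature_eq_zero_iff.1 h.maurer_cartan
    have hκ : (fun i j => d.c i j .rho) = connCurv (coord N γ) s :=
      funext fun i => funext fun j => eq_connCurv (hM i j)
    rw [hκ] at hc hM
    have hS1 := (killing_S_iff _ s d).1 h.killing_S
    have hS2 := (killing_S_iff _ _ _).1 ((killing_Sbar_iff _ s d).1 h.killing_Sbar)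
    exact ⟨⟨fun m i => congrFun (h.d_t m) i, fun m i => congrFun (h.d_tb m) i⟩,
      ⟨⟨(killing_Y_iff _ s d).1 h.killing_Y, hS1.1, hS1.2⟩,
        ⟨(killing_Y_iff _ _ _).1 ((killing_Ybar_iff _ s d).1 h.killing_Ybar), hS2.1, hS2.2⟩⟩,
      hc, hM⟩
  · rintro ⟨⟨ht, htb⟩, ⟨h1, h2⟩, hc, hM⟩
    refine ⟨fun m => funext (ht m), fun m => funext (htb m), fun m => ?_, fun m => ?_,
      (killing_Y_iff _ s d).2 h1.eqY,
      (killing_Ybar_iff _ s d).2 ((killing_Y_iff _ _ _).2 h2.eqY),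
      (killing_S_iff _ s d).2 ⟨h1.eqS, h1.eqU⟩,
      (killing_Sbar_iff _ s d).2 ((killing_S_iff _ _ _).2 ⟨h2.eqS, h2.eqU⟩),
      hc.curvature_eq_zero_iff.2 hM⟩
    · funext i j
      rw [dOne_coframe, hc]
      cases i <;> cases j <;> simp [ell]
    · funext i j
      rw [dOne_coframe, hc]
      cases i <;> cases j <;> simp [ell]

theorem IsExtendedCMC.unique {d e : FormalDiff (Fn N γ) (Idx N K)} (hd : IsExtendedCMC s d)
    (he : IsExtendedCMC s e) : d = e := by
  obtain ⟨⟨ht, htb⟩, ⟨h1, h2⟩, hc, -⟩ := (isExtendedCMC_iff d).1 hd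
  obtain ⟨⟨ht', htb'⟩, ⟨h1', h2'⟩, hc', -⟩ := (isExtendedCMC_iff e).1 he
  have hsw : ∀ (d : FormalDiff (Fn N γ) (Idx N K)) i, d.swap.D (swapIdx i) = d.D i := fun d i => by
    simp [FormalDiff.swap]
  refine FormalDiff.ext (funext fun i => derivation_ext (eq_on_generators
    (fun m => (ht m i).trans (ht' m i).symm) (fun m => (htb m i).trans (htb' m i).symm)
    (fun n => ?_) ((h1.eqY i).trans (h1'.eqY i).symm) ((h1.eqS i).trans (h1'.eqS i).symm) ?_ ?_))
    (funext fun i => funext fun j => (hc i j).trans (hc' i j).symm)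
  · rw [← confSer_apply (coord N γ) s, h1.eqU, h1'.eqU]
  · rw [← hsw d, ← hsw e, h2.eqY, h2'.eqY]
  · rw [← hsw d, ← hsw e, h2.eqS, h2'.eqS]

/-- The flows preserve the relations, and therefore define derivations of the algebra of
functions. -/
theorem exists_flow (hK : N + 1 ≤ K) (i : Idx N K) : ∃ D : Derivation ℂ (Fn N γ) (Fn N γ),
    ∀ g, D (coord N γ g) = flowVal (coord N γ) s i g := by
  obtain ⟨⟨hd, hl⟩, hd', hl'⟩ := coord_relations N γ
  set π := Ideal.Quotient.mkₐ ℂ (Ideal.span (relations N γ)) with hπ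
  have hsurj : Function.Surjective π := Ideal.Quotient.mkₐ_surjective ℂ _
  set E : Derivation ℂ (MvPolynomial (Gen N) ℂ) (MvPolynomial (Gen N) ℂ) :=
    MvPolynomial.mkDerivation ℂ fun g =>
      Function.surjInv hsurj (flowVal (coord N γ) s i g) with hE
  have hEX : ∀ g, π (E (MvPolynomial.X g)) = flowVal (coord N γ) s i g := fun g => by
    rw [hE, MvPolynomial.mkDerivation_X]
    exact Function.surjInv_eq hsurj _
  have hflow : IsFlowAlong π (π.toLinearMap.comp E.toLinearMap) MvPolynomial.X (coord N γ) s i :=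
    { leibniz := fun a b => by simp [mul_comm, add_comm]
      base := fun g => rfl
      flow := hEX }
  have hrel : ∀ p ∈ relations N γ, π (E p) = 0 := fun p hp => by
    obtain ⟨n, rfl | rfl | ⟨a, b, rfl | rfl⟩⟩ := mem_relations_iff.1 hp
    · exact hflow.map_detRel hl hd n
    · exact hflow.swap.map_detRel hl' hd' n
    · exact hflow.map_liftRel hK hl n a b
    · rw [map_neg, map_neg, neg_eq_zero]
      exact hflow.swap.map_liftRel hK hl' n a b
  have hker : ∀ p, π p = 0 → π (E p) = 0 := fun p hp => by
    have hp' : p ∈ Ideal.span (relations N γ) := Ideal.Quotient.eq_zero_iff_mem.1 hp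
    refine Submodule.span_induction (p := fun p _ => π (E p) = 0) hrel (by simp)
      (fun a b _ _ ha hb => by rw [map_add, map_add, ha, hb, add_zero]) (fun a b hb h => ?_) hp'
    have hb' : π b = 0 := Ideal.Quotient.eq_zero_iff_mem.2 hb
    rw [smul_eq_mul, Derivation.leibniz, smul_eq_mul, smul_eq_mul, map_add, map_mul, map_mul, h,
      hb', mul_zero, zero_mul, add_zero]
  exact ⟨Derivation.liftOfSurjective hsurj hker, fun g =>
    (Derivation.liftOfSurjective_apply hsurj hker _).trans (hEX g)⟩

theorem exists_isExtendedCMC (N K : ℕ) (γ : ℝ) (s : Sgn) (hK : N + 1 ≤ K) :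
    ∃ d : FormalDiff (Fn N γ) (Idx N K), IsExtendedCMC s d := by
  obtain ⟨⟨-, hl⟩, -, hl'⟩ := coord_relations N γ
  choose D hD using fun i : Idx N K => exists_flow (γ := γ) (s := s) hK i
  let d : FormalDiff (Fn N γ) (Idx N K) :=
    { D := D
      c := fun i j => Finsupp.single .rho (connCurv (coord N γ) s i j) +
        Finsupp.single (ell i j) ((mu i j : ℤ) : Fn N γ)
      c_self := fun i => by
        have : mu i i = 0 := by cases i <;> simp [mu]
        simp [this, connCurv, loopComm_self]
      c_swap := fun i j => by
        rw [ell_comm j i, mu_swap, connCurv, connCurv, loopComm_swap]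
        simp only [coeff_neg, Matrix.neg_apply, smul_neg, Int.cast_neg, Finsupp.single_neg,
          neg_add] }
  have h1 : KillingHalf (coord N γ) s d.D := killingHalf_of_flows hK hl hD
  have h2 : KillingHalf (swapGen (coord N γ)) s.opp d.swap.D := killingHalf_swap_of_flows hK hl' hD
  exact ⟨d, (isExtendedCMC_iff d).2 ⟨⟨fun m i => hD i (.t m), fun m i => hD i (.tb m)⟩, ⟨h1, h2⟩,
    fun i j => rfl, loopCurv_connCurv_eq_zero hK hl hl' h1 h2⟩⟩

end Functions

/-! ### Virasoro relations and commuting flows -/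

section Commutation

variable {N K : ℕ} {R : Type*} [CommRing R] [Algebra ℂ R] {v : Gen N → R} {s : Sgn}

/-- Two components whose loop parts have only terms of positive degree do not contribute to the
curvature of the connection form. -/
theorem coeff_zero_loopComm_of_geDeg {i j : Idx N K} (hi : GeDeg 1 (hA v .plus i))
    (hj : GeDeg 1 (hA v .plus j)) : (loopComm v .plus i j).coeff 0 = 0 := by
  have hdeg : ∀ i : Idx N K, 0 ≤ vdeg .plus i := fun i => by cases i <;> simp [vdeg, Sgn.val]
  have h2 : ∀ {x : LaurentLoop R}, GeDeg (1 + 1) x → GeDeg 1 x := fun h => h.mono (by omega)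
  refine GeDeg.sub (GeDeg.add (GeDeg.sub (h2 (hi.mul hj)) (h2 (hj.mul hi))) ?_) ?_ 0 one_pos
  · exact (hj.eul.sh _ (by have := hdeg i; omega)).zsmul _
  · exact (hi.eul.sh _ (by have := hdeg j; omega)).zsmul _

theorem connCurv_eq_swap (i j : Idx N K) :
    connCurv v s i j = connCurv (swapGen v) s.opp (swapIdx i) (swapIdx j) := by
  rw [connCurv, connCurv, coeff_loopComm_swap, neg_zero]

theorem connCurv_s_s (j k : {k : ℕ // K ≤ k}) : connCurv v s (.s j : Idx N K) (.s k) = 0 := by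
  have h : ∀ w : Gen N → R, connCurv w .plus (.s j : Idx N K) (.s k) = 0 := fun w => by
    rw [connCurv, coeff_zero_loopComm_of_geDeg (geDeg_hA_s_plus w j) (geDeg_hA_s_plus w k),
      Matrix.zero_apply, smul_zero]
  cases s with
  | plus => exact h v
  | minus => exact (connCurv_eq_swap _ _).trans (h _)

theorem connCurv_tb_s (m : Fin (N + 1)) (k : {k : ℕ // K ≤ k}) :
    connCurv v .plus (.tb m : Idx N K) (.s k) = 0 := by
  rw [connCurv, coeff_zero_loopComm_of_geDeg (geDeg_hA_tb v _ m) (geDeg_hA_s_plus v k),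
    Matrix.zero_apply, smul_zero]

theorem connCurv_t_s (m : Fin (N + 1)) (k : {k : ℕ // K ≤ k}) :
    connCurv v .minus (.t m : Idx N K) (.s k) = 0 :=
  (connCurv_eq_swap _ _).trans (connCurv_tb_s m k)

theorem virasoroRelations_of_commutator {d : FormalDiff R (Idx N K)}
    (h : ∀ i j, ⁅d.D i, d.D j⁆ = -(connCurv v s i j • d.D .rho + mu i j • d.D (ell i j))) :
    VirasoroRelations d := by
  intro j k
  rw [h, connCurv_s_s, zero_smul, zero_add, ← neg_smul]
  congr 1
  simp only [mu]
  ring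

theorem flowsCommute_of_commutator {d : FormalDiff R (Idx N K)}
    (h : ∀ i j, ⁅d.D i, d.D j⁆ = -(connCurv v s i j • d.D .rho + mu i j • d.D (ell i j))) :
    FlowsCommute s d := by
  cases s with
  | plus =>
    refine fun m k => ⟨?_, -connCurv v .plus (.t m) (.s k), ?_⟩
    · rw [h, connCurv_tb_s]
      simp [mu]
    · rw [h]
      simp [mu]
  | minus =>
    refine fun m k => ⟨?_, -connCurv v .minus (.tb m) (.s k), ?_⟩
    · rw [h, connCurv_t_s]
      simp [mu]
    · rw [h]
      simp [mu]

end Commutation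

section Compatibility

variable {N K : ℕ} {γ : ℝ} {s : Sgn} {d : FormalDiff (Fn N γ) (Idx N K)}

theorem IsExtendedCMC.commutator (h : IsExtendedCMC s d) (i j : Idx N K) : ⁅d.D i, d.D j⁆ =
    -(connCurv (coord N γ) s i j • d.D .rho + mu i j • d.D (ell i j)) := by
  obtain ⟨⟨ht, htb⟩, ⟨h1, h2⟩, -, hM⟩ := (isExtendedCMC_iff d).1 h
  exact commutator_eq (fun _ _ => derivation_ext) ht htb h1 h2 hM i j

theorem IsExtendedCMC.squareZero (h : IsExtendedCMC s d) : d.SquareZero := by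
  obtain ⟨-, -, hc, hM⟩ := (isExtendedCMC_iff d).1 h
  exact squareZero_of_commutator hc h.commutator hM

end Compatibility

/-! ### Failure for a smaller cut-off -/

section Truncation

variable {N K : ℕ}

theorem dC_hD {R : Type*} [CommRing R] [Algebra ℂ R] {v : Gen N → R}
    {D : Idx N K → Derivation ℂ R R} (h : KillingHalf v .plus D) (k : {k : ℕ // K ≤ k})
    (ht : ∀ m, D (.s k) (v (.t m)) = 0) : dC (D (.s k)) (hD v) = rhsD v .plus (.s k) := by
  have e : hD v = hS v - timeMul v (hY v) := by rw [hS_eq]; abel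
  have et : ∀ m, D (.s k) (timeCoef v m) = 0 := fun m => by
    rw [timeCoef, Derivation.map_smul, ht, smul_zero]
  rw [e, map_sub, dC_timeMul, h.eqY, h.eqS, rhsD]
  simp [et, timeDer]

/-- If `K ≤ N`, the derivative of the dressed field along the positive generator of index `K` has
the lowest degree `2 K - 2 N - 1 < 0`.  Since the dressed field has only terms of positive degree,
the coefficient, a multiple of the last time and the leading coefficient of `Y`, has to vanish. -/
theorem timeCoef_smul_coeff_hY {R : Type*} [CommRing R] [Algebra ℂ R] {v : Gen N → R}
    {D : Idx N K → Derivation ℂ R R} (hKN : K ≤ N) (hv : RelLift v) (h : KillingHalf v .plus D)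
    (ht : ∀ m, D (.s ⟨K, le_rfl⟩) (v (.t m)) = 0) :
    (2 * (K : ℤ) - 2 * N - 1) • timeCoef v (Fin.last N) • (hY v).coeff 1 = 0 := by
  have hd := dC_hD h ⟨K, le_rfl⟩ ht
  have h0 := (geDeg_hD v).dC (D (.s ⟨K, le_rfl⟩)) (2 * K - 2 * N - 1) (by omega)
  rw [hd, rhsD_eq hv] at h0
  have hr := geDeg_rest v .plus (.s ⟨K, le_rfl⟩ : Idx N K)
  have hr' : restCoef .plus (.s ⟨K, le_rfl⟩ : Idx N K) = -1 := rfl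
  have he : vdeg .plus (.s ⟨K, le_rfl⟩ : Idx N K) = 2 * K := by simp [vdeg, Sgn.val]
  have e1 := ((hr.mul (geDeg_hD v)).sub ((geDeg_hD v).mul hr)) (2 * K - 2 * N - 1) (by omega)
  have e2 := hr.eul (2 * K - 2 * N - 1) (by omega)
  have e3 := (((geDeg_hD v).eul.add ((geDeg_hD v).zsmul (2 * (K : ℤ)))).sh (d := 1)
    (2 * (K : ℤ)) (by omega)) (2 * K - 2 * N - 1) (by omega)
  rw [hr', he, coeff_sub, coeff_sub, coeff_add, coeff_neg, coeff_zsmul, coeff_zsmul, e1, e2, e3,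
    coeff_sum, Finset.sum_eq_single (Fin.last N)] at h0
  · simp only [coeff_zsmul, coeff_smul, coeff_sh, Fin.val_last] at h0
    rw [show 2 * (K : ℤ) - 2 * N - 1 - (2 * K - (2 * N + 2)) = 1 by ring] at h0
    rw [← h0]
    module
  · intro m _ hm
    have : (m : ℕ) ≠ N := fun e => hm (Fin.ext e)
    rw [coeff_zsmul, coeff_smul, coeff_sh, geDeg_hY v _ (by have := m.2; omega), smul_zero,
      smul_zero]
  · simp

/-- The values of the variables at a point where `Y` is a monomial of degree one, the dressed field
is zero and all times are one. -/
def monomialVal (N : ℕ) (γ : ℂ) : Gen N → ℂ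
  | .t _ => 1
  | .tb _ => 1
  | .b n => if n = 0 then 1 else 0
  | .c n => if n = 0 then γ else 0
  | .bbar n => if n = 0 then γ else 0
  | .cbar n => if n = 0 then 1 else 0
  | _ => 0

theorem swapGen_monomialVal (γ : ℂ) : swapGen (monomialVal N γ) = monomialVal N γ := by
  funext g
  cases g <;> simp [swapGen, monomialVal]

theorem hY_monomialVal (γ : ℂ) : hY (monomialVal N γ) = monomial 1 !![0, 2 * γ; 2, 0] := by
  ext n : 1
  have he : evenSer (fun k => monomialVal N γ (.a k)) n = 0 := by
    simp [evenSer, monomialVal]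
  have ho : ∀ z : ℂ, oddSer (fun k => if k = 0 then z else 0) n = if n = 1 then z else 0 := by
    intro z
    by_cases h1 : n = 1
    · subst h1
      simp [oddSer]
    · by_cases h : 1 ≤ n ∧ Odd n
      · have : ((n - 1) / 2).toNat ≠ 0 := by
          obtain ⟨h2, j, hj⟩ := h
          omega
        simp [oddSer, h, this, h1]
      · simp [oddSer, h, h1]
  have e : (hY (monomialVal N γ)).coeff n = !![-(Complex.I • (0 : ℂ)), 2 * if n = 1 then γ else 0;
      2 * if n = 1 then 1 else 0, Complex.I • (0 : ℂ)] := by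
    change !![-(Complex.I • evenSer (fun k => monomialVal N γ (.a k)) n),
      2 * oddSer (fun k => if k = 0 then γ else 0) n;
      2 * oddSer (fun k => if k = 0 then 1 else 0) n,
      Complex.I • evenSer (fun k => monomialVal N γ (.a k)) n] = _
    rw [he, ho, ho]
  rw [e, coeff_monomial]
  split_ifs
  · simp
  · ext a b
    fin_cases a <;> fin_cases b <;> simp

theorem relations_monomialVal (γ : ℂ) :
    RelDet (monomialVal N γ) γ ∧ RelLift (monomialVal N γ) := by
  have hD0 : hD (monomialVal N γ) = 0 := by
    ext n : 1
    ext a b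
    have he : evenSer (fun _ : ℕ => (0 : ℂ)) n = 0 := by simp [evenSer]
    have ho : oddSer (fun _ : ℕ => (0 : ℂ)) n = 0 := by simp [oddSer]
    change mkLoop (fun _ => 0) (fun _ => 0) (fun _ => 0) n a b = 0
    fin_cases a <;> fin_cases b <;> simp [mkLoop, he, ho]
  constructor
  · rw [RelDet, hY_monomialVal]
    refine (HahnSeries.single_mul_single (R := Matrix (Fin 2) (Fin 2) ℂ)).trans ?_
    change monomial (1 + 1) _ = _
    congr 1
    ext a b
    fin_cases a <;> fin_cases b <;>
      simp [Matrix.mul_apply, Fin.sum_univ_two, Algebra.algebraMap_eq_smul_one] <;> ring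
  · have he : eul (hY (monomialVal N γ)) = hY (monomialVal N γ) := by
      ext n : 1
      rw [coeff_eul, hY_monomialVal, coeff_monomial]
      split_ifs with h
      · rw [h, one_smul]
      · rw [smul_zero]
    rw [RelLift, hS_eq, hD0, add_zero, timeMul_mul, mul_timeMul, he, sub_self, sub_self]

/-- The relations hold at the monomial point, so that all functions can be evaluated there. -/
theorem exists_evaluation (N : ℕ) (γ : ℝ) :
    ∃ ε : Fn N γ →ₐ[ℂ] ℂ, ∀ g, ε (coord N γ g) = monomialVal N γ g := by
  have h := relations_monomialVal (N := N) γ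
  have hrel := (relations_vanish_iff (MvPolynomial.aeval (monomialVal N γ))
    fun g => MvPolynomial.aeval_X _ g).2 ⟨h, by rwa [swapGen_monomialVal]⟩
  have hker : ∀ p ∈ Ideal.span (relations N γ), MvPolynomial.aeval (monomialVal N γ) p = 0 :=
    fun p hp => RingHom.mem_ker.1 (Ideal.span_le.2
      (fun q hq => RingHom.mem_ker.2 (hrel q hq)) hp)
  exact ⟨Ideal.Quotient.liftₐ _ _ hker, fun g =>
    (Ideal.Quotient.liftₐ_apply _ _ hker _).trans (MvPolynomial.aeval_X _ g)⟩

/-- For `K ≤ N` the equations of positive type contradict the nonvanishing of the last time and of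
the leading coefficient of `Y` at the monomial point. -/
theorem not_killingHalf {γ : ℝ} (hKN : K ≤ N) {v : Gen N → Fn N γ}
    {ε : Fn N γ →ₐ[ℂ] ℂ} (hε : ∀ g, ε (v g) = monomialVal N γ g) (hv : RelLift v)
    {D : Idx N K → Derivation ℂ (Fn N γ) (Fn N γ)} (hD : KillingHalf v .plus D)
    (ht : ∀ m, D (.s ⟨K, le_rfl⟩) (v (.t m)) = 0) : False := by
  have h := congrArg ε (congrFun (congrFun (timeCoef_smul_coeff_hY hKN hv hD ht) 1) 0)
  have h1 : ε ((hY v).coeff 1 1 0) = 2 := by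
    have e : mapL ε.toLinearMap (hY v) = hY (monomialVal N γ) := by
      rw [mapL_algHom_hY]
      simp only [hε]
    have := congrFun (congrFun (congrArg (fun x => x.coeff 1) e) 1) 0
    rw [hY_monomialVal, coeff_monomial, if_pos rfl] at this
    exact this
  have h2 : ε (timeCoef v (Fin.last N)) = Complex.I / 2 * (2 * (N : ℂ) + 1) := by
    rw [timeCoef, map_smul, hε]
    simp [monomialVal]
  rw [Matrix.smul_apply, Matrix.smul_apply, smul_eq_mul, map_zsmul, map_mul, h1, h2,
    Matrix.zero_apply, map_zero, zsmul_eq_mul] at h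
  have h3 : ((2 * (K : ℤ) - 2 * N - 1 : ℤ) : ℂ) ≠ 0 := Int.cast_ne_zero.2 (by omega)
  have h4 : 2 * (N : ℂ) + 1 ≠ 0 := by exact_mod_cast (by omega : 2 * N + 1 ≠ 0)
  exact mul_ne_zero h3 (mul_ne_zero (mul_ne_zero (div_ne_zero Complex.I_ne_zero two_ne_zero) h4)
    two_ne_zero) h

theorem not_isExtendedCMC {γ : ℝ} {s : Sgn} (hKN : K ≤ N) (d : FormalDiff (Fn N γ) (Idx N K)) :
    ¬ IsExtendedCMC s d := by
  intro h
  obtain ⟨⟨ht, htb⟩, ⟨h1, h2⟩, -⟩ := (isExtendedCMC_iff d).1 h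
  obtain ⟨⟨-, hl⟩, -, hl'⟩ := coord_relations N γ
  obtain ⟨ε, hε⟩ := exists_evaluation N γ
  cases s with
  | plus =>
    refine not_killingHalf hKN hε hl h1 fun m => ?_
    rw [ht]
    simp [FormalDiff.coframe]
  | minus =>
    refine not_killingHalf hKN (v := swapGen (coord N γ)) (ε := ε) (fun g => ?_) hl' h2 fun m => ?_
    · have := congrFun (algHom_swapGen ε (coord N γ)) g
      simp only [hε, swapGen_monomialVal] at this
      exact this
    · refine (htb m _).trans ?_
      simp [FormalDiff.coframe, swapIdx]

end Truncation

end CMCHierarchy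

end

theorem mainTheorem1 (N K : ℕ) (γ : ℝ) (hγ : γ ≠ 0) (s : CMCHierarchy.Sgn) :
    (N + 1 ≤ K →
      (∃! d : CMCHierarchy.FormalDiff (CMCHierarchy.Fn N γ) (CMCHierarchy.Idx N K),
        CMCHierarchy.IsExtendedCMC s d) ∧
      ∀ d : CMCHierarchy.FormalDiff (CMCHierarchy.Fn N γ) (CMCHierarchy.Idx N K),
        CMCHierarchy.IsExtendedCMC s d →
          d.SquareZero ∧ CMCHierarchy.VirasoroRelations d ∧ CMCHierarchy.FlowsCommute s d) ∧
    (K ≤ N →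
      ¬ ∃ d : CMCHierarchy.FormalDiff (CMCHierarchy.Fn N γ) (CMCHierarchy.Idx N K),
        CMCHierarchy.IsExtendedCMC s d) := by
  refine ⟨fun hK => ⟨?_, fun d hd => ⟨hd.squareZero,
    CMCHierarchy.virasoroRelations_of_commutator hd.commutator,
    CMCHierarchy.flowsCommute_of_commutator hd.commutator⟩⟩,
    fun hKN ⟨d, hd⟩ => CMCHierarchy.not_isExtendedCMC hKN d hd⟩
  obtain ⟨d, hd⟩ := CMCHierarchy.exists_isExtendedCMC N K γ s hK
  exact ⟨d, hd, fun e he => he.unique hd⟩
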